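/- Let $(M,g)$ be a connected smooth 3-dimensional Lorentzian manifold (signature $(-,+,+)$) with Levi-Civita connection $\nabla^g$. For a vector field $p$ and a 3-form $S$ on $M$, define $S(X,Y)$ by $g(S(X,Y),Z)=S(X,Y,Z)$; a metric connection $\nabla$ (i.e. $\nabla g=0$) is said to have twistor-free torsion with vectorial component $p$ and skew-symmetric component $S$ if its torsion is $T(X,Y)=g(X,p)Y-g(Y,p)X+S(X,Y)$; the torsion is parallel if $\nabla T=0$. A vector field $p$ is isotropic if it is nowhere zero and $g(p,p)=0$, and $S$ is non-degenerate if $\|S\|_g$ is not identically $0$. 1. Let $p$ be a smooth vector field and $S$ a smooth 3-form on $M$. Then $p$ is isotropic, $S$ is non-degenerate, and $(M,g)$ admits a metric connection with parallel twistor-free torsion having vectorial component $p$ and skew-symmetric component $S$ if and only if $p$ is isotropic and, for some orientation of $M$ (in particular $M$ is orientable) and some constant $a\in\mathbb R$, $a\neq 0$, $$S=a\,\mathrm{Vol}_g\quad\text{and}\quad \nabla^g_Xp=-g(X,p)\,p-\tfrac12 S(X,p)\quad\text{for all vector fields } X. \tag{$*$}$$ In particular, $(M,g)$ admits a metric connection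 with parallel twistor-free torsion having isotropic vectorial component and non-degenerate skew-symmetric component if and only if $M$ can be oriented and carries an isotropic vector field $p$ satisfying $(*)$ for some $a\ne0$. 2. If $M$ is oriented and $p$ is an isotropic smooth vector field satisfying $(*)$ for some $a\neq0$, then $(M,g)$ is a Kundt space with field $p$: $\nabla^g_pp=0$, $\operatorname{tr}\nabla^gp=0$, $\|(\nabla^gp)^{\rm sym}\|_g=0$ and $\|(\nabla^gp)^{\rm alt}\|_g=0$. 3. Let $M$ be oriented, $a\neq 0$ and $p$ a smooth vector field. Then $p$ is isotropic and satisfies $(*)$ if and only if around each point of $M$ there are local coordinates $(v,x,u)$, with $(\partial_x,\partial_v,\partial_u)$ positively oriented, and a smooth function $C(x,u)$ such that $$g=2\,dv\,du+2av\,dx\,du+(dx)^2+\bigl(-2ve^{-ax}+C(x,u)\bigr)(du)^2,\qquad p=e^{-ax}\partial_v. \tag{$**$}$$ Here $C$ is arbitrary: for all $a\ne0$ and all smooth $C:\mathbb R^2\to\mathbb R$, the formula $(**)$ defines on $\mathbb R^3$ a Lorentzian metric $g$ and an isotropic vector field $p$ that satisfy $(*)$ for the orientation in which $(\partial_x,\partial_v,\partial_u)$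 is positive. -/

import Mathlib

open Module Bundle Set Filter
open scoped Manifold ContDiff Topology

noncomputable section

/-- The model space of 3-dimensional manifolds. -/
abbrev E3 : Type := EuclideanSpace ℝ (Fin 3)

section Tensors

variable (M : Type*) [TopologicalSpace M] [ChartedSpace E3 M]

/-- Vector fields on `M` (no regularity). -/
abbrev VField : Type _ := ∀ x : M, TangentSpace (𝓡 3) x

/-- Fields of alternating trilinear forms on the tangent spaces of `M` (no regularity). -/
abbrev Form3 : Type _ := ∀ x : M, TangentSpace (𝓡 3) x [⋀^Fin 3]→ₗ[ℝ] ℝ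

/-- Affine connections on `M`; `cov Y x v` is `∇_v Y` at the point `x`. -/
abbrev AffConn [IsManifold (𝓡 3) ∞ M] : Type _ :=
  CovariantDerivative (𝓡 3) E3 (TangentSpace (𝓡 3) : M → Type _)

variable {M}

/-- Smooth vector fields. -/
def SmoothField [IsManifold (𝓡 3) ∞ M] (X : VField M) : Prop :=
  ContMDiff (𝓡 3) ((𝓡 3).prod 𝓘(ℝ, E3)) ∞ (fun x => (TotalSpace.mk' E3 x (X x) : TangentBundle (𝓡 3) M))

/-- Vector fields that are differentiable at `x`. -/
def DiffFieldAt [IsManifold (𝓡 3) ∞ M] (X : VField M) (x : M) : Prop :=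
  MDifferentiableAt (𝓡 3) ((𝓡 3).prod 𝓘(ℝ, E3))
    (fun y => (TotalSpace.mk' E3 y (X y) : TangentBundle (𝓡 3) M)) x

/-- Smooth 3-forms, i.e. elements of `Ω³(M)`. -/
def SmoothForm3 [IsManifold (𝓡 3) ∞ M] (S : Form3 M) : Prop :=
  ∀ X Y Z : VField M, SmoothField X → SmoothField Y → SmoothField Z →
    ContMDiff (𝓡 3) 𝓘(ℝ, ℝ) ∞ (fun x => S x ![X x, Y x, Z x])

end Tensors

/-- The signs `(-,+,+)` of a Lorentzian orthonormal basis in dimension 3. -/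
def lsign (i : Fin 3) : ℝ := if i = 0 then -1 else 1

/-- Smooth Lorentzian metrics on a 3-dimensional manifold: smooth symmetric bilinear forms on the
tangent spaces, of signature `(-,+,+)` at each point. -/
structure LorentzMetric (M : Type*) [TopologicalSpace M] [ChartedSpace E3 M]
    [IsManifold (𝓡 3) ∞ M] where
  form (x : M) : TangentSpace (𝓡 3) x →L[ℝ] TangentSpace (𝓡 3) x →L[ℝ] ℝ
  contMDiff : ContMDiff (𝓡 3) ((𝓡 3).prod 𝓘(ℝ, E3 →L[ℝ] E3 →L[ℝ] ℝ)) ∞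
    (fun x ↦ TotalSpace.mk' (E3 →L[ℝ] E3 →L[ℝ] ℝ)
      (E := fun y : M ↦ TangentSpace (𝓡 3) y →L[ℝ] TangentSpace (𝓡 3) y →L[ℝ] ℝ) x (form x))
  symm (x : M) (v w : TangentSpace (𝓡 3) x) : form x v w = form x w v
  exists_frame (x : M) : ∃ b : Basis (Fin 3) ℝ (TangentSpace (𝓡 3) x),
    ∀ i j, form x (b i) (b j) = if i = j then lsign i else 0

/-- Orientations of a 3-dimensional manifold: orientations of all tangent spaces such that near
each point there is a smooth positively oriented local frame. -/
structure SmoothOrientation (M : Type*) [TopologicalSpace M] [ChartedSpace E3 M]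
    [IsManifold (𝓡 3) ∞ M] where
  orient (x : M) : Orientation ℝ (TangentSpace (𝓡 3) x) (Fin 3)
  exists_frame (x₀ : M) : ∃ U ∈ 𝓝 x₀, ∃ X : Fin 3 → VField M,
    (∀ i, ContMDiffOn (𝓡 3) ((𝓡 3).prod 𝓘(ℝ, E3)) ∞
      (fun x => (TotalSpace.mk' E3 x (X i x) : TangentBundle (𝓡 3) M)) U) ∧
    ∀ x ∈ U, ∃ b : Basis (Fin 3) ℝ (TangentSpace (𝓡 3) x),
      (∀ i, b i = X i x) ∧ b.orientation = orient x

section Metric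

variable {M : Type*} [TopologicalSpace M] [ChartedSpace E3 M] [IsManifold (𝓡 3) ∞ M]

/-- A `g`-orthonormal basis of the tangent space at `x`. It is used only in expressions that do not
depend on its choice. -/
def LorentzMetric.frame (g : LorentzMetric M) (x : M) : Basis (Fin 3) ℝ (TangentSpace (𝓡 3) x) :=
  (g.exists_frame x).choose

open Classical in
/-- The volume form of `g` and of an orientation: it takes the value `1` on each positively
oriented orthonormal basis. -/
def volForm (g : LorentzMetric M) (o : SmoothOrientation M) : Form3 M := fun x =>
  if (g.frame x).orientation = o.orient x then (g.frame x).det else -(g.frame x).det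

/-- The square `g(S,S)` of the `g`-norm of a 3-form (full contraction). -/
def normSq3 (g : LorentzMetric M) (S : Form3 M) (x : M) : ℝ :=
  ∑ i, ∑ j, ∑ k, lsign i * lsign j * lsign k *
    (S x ![g.frame x i, g.frame x j, g.frame x k]) ^ 2

/-- `S` is non-degenerate if it is not true that `‖S‖_g = 0`. -/
def Nondegenerate3 (g : LorentzMetric M) (S : Form3 M) : Prop := ¬ ∀ x, normSq3 g S x = 0

/-- The square of the `g`-norm of a covariant 2-tensor at `x` (full contraction). -/
def normSq2 (g : LorentzMetric M) (x : M)
    (B : TangentSpace (𝓡 3) x → TangentSpace (𝓡 3) x → ℝ) : ℝ :=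
  ∑ i, ∑ j, lsign i * lsign j * (B (g.frame x i) (g.frame x j)) ^ 2

/-- Isotropic (null) vector fields: nowhere zero with `g(p,p) = 0`. -/
def IsIsotropic (g : LorentzMetric M) (p : VField M) : Prop :=
  ∀ x, p x ≠ 0 ∧ g.form x (p x) (p x) = 0

/-- `∇g = 0`. -/
def IsMetricConn (g : LorentzMetric M) (cov : AffConn M) : Prop :=
  ∀ (x : M) (Y Z : VField M), DiffFieldAt Y x → DiffFieldAt Z x →
    ∀ v : TangentSpace (𝓡 3) x,
      mvfderiv (𝓡 3) (fun y => g.form y (Y y) (Z y)) x v =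
        g.form x (cov Y x v) (Z x) + g.form x (Y x) (cov Z x v)

/-- Smooth metric torsion-free connections. -/
structure IsLeviCivita (g : LorentzMetric M) (D : AffConn M) : Prop where
  smooth : D.ContMDiffCovariantDerivative ∞
  metric : IsMetricConn g D
  torsion_free : ∀ x, D.torsion x = 0

/-- The torsion of `cov` has vectorial component `ξ`, skew-symmetric component `S` and zero
twistorial component: `T(X,Y) = (X ∧ Y)ξ + S(X,Y) = g(X,ξ)Y - g(Y,ξ)X + S(X,Y)`, where
`g(S(X,Y),Z) = S(X,Y,Z)`. -/
def HasTwistorFreeTorsion (g : LorentzMetric M) (cov : AffConn M) (ξ : VField M) (S : Form3 M) :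
    Prop :=
  ∀ (x : M) (X Y Z : TangentSpace (𝓡 3) x),
    g.form x (cov.torsion x X Y) Z =
      g.form x X (ξ x) * g.form x Y Z - g.form x Y (ξ x) * g.form x X Z + S x ![X, Y, Z]

/-- The torsion `T` of `cov` is parallel: `(∇_v T)(Y,Z) = ∇_v(T(Y,Z)) - T(∇_v Y,Z) - T(Y,∇_v Z)`
vanishes. -/
def HasParallelTorsion (cov : AffConn M) : Prop :=
  ∀ (x : M) (Y Z : VField M), DiffFieldAt Y x → DiffFieldAt Z x →
    ∀ v : TangentSpace (𝓡 3) x,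
      cov (fun y => cov.torsion y (Y y) (Z y)) x v =
        cov.torsion x (cov Y x v) (Z x) + cov.torsion x (Y x) (cov Z x v)

/-- `(M,g)` admits a (smooth) metric connection with parallel twistor-free torsion having vectorial
component `ξ` and skew-symmetric component `S`. -/
def AdmitsParallelTwistorFree (g : LorentzMetric M) (ξ : VField M) (S : Form3 M) : Prop :=
  ∃ cov : AffConn M, cov.ContMDiffCovariantDerivative ∞ ∧ IsMetricConn g cov ∧
    HasTwistorFreeTorsion g cov ξ S ∧ HasParallelTorsion cov

/-- The equation `∇^g_X p = -g(X,p)p - ½ S(X,p)` for all `X`, where `g(S(X,p),Z) = S(X,p,Z)`. -/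
def KundtEquation (g : LorentzMetric M) (D : AffConn M) (p : VField M) (S : Form3 M) : Prop :=
  ∀ (x : M) (X Z : TangentSpace (𝓡 3) x),
    g.form x (D p x X) Z =
      -(g.form x X (p x) * g.form x (p x) Z) - 1 / 2 * S x ![X, p x, Z]

/-- `p` is an isotropic vector field that makes `(M,g)` a Kundt space: it is geodesic,
expansion-free, shear-free and twist-free. Here `D` is the Levi-Civita connection. -/
structure IsKundtField (g : LorentzMetric M) (D : AffConn M) (p : VField M) : Prop where
  smooth : SmoothField p
  isotropic : IsIsotropic g p
  geodesic : ∀ x, D p x (p x) = 0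
  expansion_free : ∀ x, LinearMap.trace ℝ (TangentSpace (𝓡 3) x) (D p x).toLinearMap = 0
  shear_free : ∀ x, normSq2 g x (fun X Y =>
    1 / 2 * (g.form x (D p x X) Y + g.form x (D p x Y) X)) = 0
  twist_free : ∀ x, normSq2 g x (fun X Y =>
    1 / 2 * (g.form x (D p x X) Y - g.form x (D p x Y) X)) = 0

/-- The differential at `y` of the `i`-th coordinate of a chart. -/
def coordDiff (φ : OpenPartialHomeomorph M E3) (i : Fin 3) (y : M) :
    TangentSpace (𝓡 3) y →L[ℝ] ℝ :=
  mvfderiv (𝓡 3) (fun z => φ z i) y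

/-- In the coordinates `v = φ⁰, x = φ¹, u = φ²` one has
`g = 2dvdu + 2av dxdu + (dx)² + (-2v e^{-ax} + C(x,u))(du)²` and `p = e^{-ax}∂_v`, and
`Vol_g = dx ∧ dv ∧ du`, i.e. `(∂_x,∂_v,∂_u)` is positively oriented. -/
structure IsKundtChart (g : LorentzMetric M) (o : SmoothOrientation M) (p : VField M) (a : ℝ)
    (φ : OpenPartialHomeomorph M E3) (C : ℝ × ℝ → ℝ) : Prop where
  metric : ∀ y ∈ φ.source, ∀ X Y : TangentSpace (𝓡 3) y,
    g.form y X Y =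
      (coordDiff φ 0 y X * coordDiff φ 2 y Y + coordDiff φ 2 y X * coordDiff φ 0 y Y)
      + a * φ y 0 *
        (coordDiff φ 1 y X * coordDiff φ 2 y Y + coordDiff φ 2 y X * coordDiff φ 1 y Y)
      + coordDiff φ 1 y X * coordDiff φ 1 y Y
      + (-2 * φ y 0 * Real.exp (-a * φ y 1) + C (φ y 1, φ y 2)) *
        (coordDiff φ 2 y X * coordDiff φ 2 y Y)
  field : ∀ y ∈ φ.source, coordDiff φ 0 y (p y) = Real.exp (-a * φ y 1) ∧
    coordDiff φ 1 y (p y) = 0 ∧ coordDiff φ 2 y (p y) = 0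
  oriented : ∀ y ∈ φ.source, ∀ X : Fin 3 → TangentSpace (𝓡 3) y,
    volForm g o y X =
      Matrix.det (Matrix.of fun i j : Fin 3 => coordDiff φ ((![1, 0, 2] : Fin 3 → Fin 3) j) y (X i))

end Metric

end

open Module Bundle Set Filter
open scoped Manifold ContDiff Topology

noncomputable section

/-! Write ∇^g for the Levi-Civita connection `D`, p♭ = g(p,·), and σ for the squared component of S
in an orthonormal frame (`sqComponent`).

A metric connection is determined by its torsion, so the only candidate is ∇_X Y = ∇^g_X Y + g(X,Y)p
- g(Y,p)X + ½S(X,Y) (`form_sub_leviCivita`, `LorentzMetric.torsionConn`). Its torsion satisfies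
g((∇_v T)(Y,Z),W) = g(Y,∇_v p)g(Z,W) - g(Z,∇_v p)g(Y,W) + (∇_v S)(Y,Z,W). For W = Z the S-term drops
out, so T is parallel exactly when ∇p = 0 and ∇S = 0 (`HasParallelTorsion.parallel`). For null p the
equation ∇p = 0 is the Kundt equation. The condition on S is metric: S(X)S(Y) is -σ times a Gram
determinant (`form3_mul`), and metric connections obey the product rule for Gram determinants. Hence
a form of constant nonzero norm is parallel, and on a connected manifold a parallel form has
constant norm. If σ is a nonzero constant, S itself orients M and S = √σ Vol
(`exists_eq_smul_volForm`).

The Kundt properties are algebra: the symmetric part of ∇^g p is -p♭⊗p♭, the skew part is a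
contraction of S with p, and the trace and both norms have the factor g(p,p).

For the normal form, the Koszul formula in coordinates (`IsLeviCivita.two_mul_form_chartField`)
splits the Kundt equation into L_p g = -2 p♭⊗p♭ and dp♭ = -S(·,p,·). The form p♭∧dp♭ is a multiple
of g(p,p) = 0, so p^⊥ is integrable and there are coordinates with p♭ = f du, f > 0
(`exists_adapted_chart`). Define x by f = e^{-ax}. The equation for dp♭ gives p(x) = 0, and with the
value of det g it shows that g restricts to dx² on the leaves u = const (`KundtAt.adapted`). So g =
dx² + 2fθ du plus a multiple of du², where θ is a 1-form along the leaves with θ(p) = 1. The mixed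
components of L_p g make θ closed along the leaves, hence θ = dy there, with u as a parameter. With
v = f y one has dv du + av dx du = f dy du, and the coefficient of du² that remains defines C. The
du² component of L_p g gives p(C) = 0; as p = e^{-ax}∂_v, C depends on x and u only
(`exists_normalForm_functions`, `exists_normalForm_chart`). The converse is a computation in the
chart (`IsKundtChart.kundtEquation`).

Two analytic tools carry this: the Levi-Civita connection, constructed from the Koszul formula, and
a Frobenius theorem with smooth dependence on the initial value (`exists_frobenius`), proved by the
implicit function theorem in the Banach space of continuous curves. -/

/-- The standard basis vectors of `E3`. -/
abbrev stdVec (i : Fin 3) : E3 := EuclideanSpace.single i 1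

/-- The constant vector fields on `E3` given by the standard basis vectors. -/
def stdField (i : Fin 3) : VField E3 := fun _ => stdVec i

/-- The partial derivatives of a function on `E3`. -/
def pd (i : Fin 3) (F : E3 → ℝ) (z : E3) : ℝ := fderiv ℝ F z (stdVec i)

set_option linter.unusedSectionVars false

/-! ### Coordinate fields and coordinate differentials of a chart. -/

section Chart

variable {M : Type*} [TopologicalSpace M] [ChartedSpace E3 M]

/-- The coordinate vector fields of a chart. -/
def chartField (φ : OpenPartialHomeomorph M E3) (i : Fin 3) : VField M :=
  VectorField.mpullback (𝓡 3) (𝓡 3) φ (stdField i)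

lemma stdField_contMDiffAt (i : Fin 3) (z : E3) :
    ContMDiffAt (𝓡 3) ((𝓡 3).prod 𝓘(ℝ, E3)) ∞
      (fun x => (TotalSpace.mk' E3 x (stdField i x) : TangentBundle (𝓡 3) E3)) z :=
  contMDiffAt_vectorSpace_iff_contDiffAt.2 contDiffAt_const

lemma mlieBracket_stdField (i j : Fin 3) :
    VectorField.mlieBracket (𝓡 3) (stdField i) (stdField j) = 0 := by
  funext z
  rw [← VectorField.mlieBracketWithin_univ, VectorField.mlieBracketWithin_eq_lieBracketWithin]
  change VectorField.lieBracketWithin ℝ (fun _ : E3 => stdVec i) (fun _ : E3 => stdVec j) univ z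
    = (0 : E3)
  simp [VectorField.lieBracketWithin]

variable {φ : OpenPartialHomeomorph M E3} (hφ : φ ∈ IsManifold.maximalAtlas (𝓡 3) ∞ M) {y : M}
  (hy : y ∈ φ.source)

include hφ in
lemma chart_mdifferentiable : φ.MDifferentiable (𝓡 3) (𝓡 3) :=
  ⟨fun x hx => ((contMDiffOn_of_mem_maximalAtlas hφ).mdifferentiableOn (by simp)) x hx,
   fun x hx => ((contMDiffOn_symm_of_mem_maximalAtlas hφ).mdifferentiableOn (by simp)) x hx⟩

include hφ hy in
lemma chart_contMDiffAt : ContMDiffAt (𝓡 3) (𝓡 3) ∞ φ y :=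
  contMDiffAt_of_mem_maximalAtlas hφ hy

variable [IsManifold (𝓡 3) ∞ M]

omit [IsManifold (𝓡 3) ∞ M] in
include hφ hy in
lemma chart_mfderiv_invertible : (mfderiv (𝓡 3) (𝓡 3) φ y).IsInvertible :=
  ⟨(chart_mdifferentiable hφ).mfderiv hy, rfl⟩

lemma two_le_infty : (2 : WithTop ℕ∞) ≤ ∞ := by
  exact WithTop.coe_le_coe.2 (le_top : (2 : ℕ∞) ≤ ⊤)

lemma three_le_infty : (3 : WithTop ℕ∞) ≤ ∞ := by
  exact WithTop.coe_le_coe.2 (le_top : (3 : ℕ∞) ≤ ⊤)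

instance isManifold_minSmoothness : IsManifold (𝓡 3) (minSmoothness ℝ 2) M :=
  IsManifold.of_le (n := ∞) (by simp [two_le_infty])
instance isManifold_minSmoothness3 : IsManifold (𝓡 3) (minSmoothness ℝ 3) M :=
  IsManifold.of_le (n := ∞) (by simp [three_le_infty])

omit [IsManifold (𝓡 3) ∞ M] in
include hφ hy in
lemma coordDiff_apply (i : Fin 3) (X : TangentSpace (𝓡 3) y) :
    coordDiff φ i y X = (show E3 from mfderiv (𝓡 3) (𝓡 3) φ y X) i := by
  have hg : HasFDerivAt (fun z : E3 => z i) (EuclideanSpace.proj i : E3 →L[ℝ] ℝ) (φ y) :=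
    (EuclideanSpace.proj i : E3 →L[ℝ] ℝ).hasFDerivAt
  have h := HasMFDerivAt.comp y hg.hasMFDerivAt
    ((chart_contMDiffAt hφ hy).mdifferentiableAt (by simp)).hasMFDerivAt
  have := h.mfderiv
  unfold coordDiff mvfderiv
  erw [this]
  rfl

omit [IsManifold (𝓡 3) ∞ M] in
include hφ hy in
lemma mfderiv_chartField (i : Fin 3) :
    mfderiv (𝓡 3) (𝓡 3) φ y (chartField φ i y) = stdVec i := by
  rw [chartField, VectorField.mpullback_apply]
  obtain ⟨e, he⟩ := chart_mfderiv_invertible hφ hy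
  rw [← he]
  rw [ContinuousLinearMap.inverse_equiv]
  exact e.apply_symm_apply _

include hφ hy in
lemma coordDiff_chartField (i j : Fin 3) :
    coordDiff φ i y (chartField φ j y) = if i = j then 1 else 0 := by
  rw [coordDiff_apply hφ hy, mfderiv_chartField hφ hy]
  simp

include hφ hy in
lemma sum_coordDiff_smul (X : TangentSpace (𝓡 3) y) :
    ∑ i, coordDiff φ i y X • chartField φ i y = X := by
  obtain ⟨e, he⟩ := chart_mfderiv_invertible hφ hy
  apply e.injective
  rw [map_sum]
  simp_rw [map_smul]
  have h1 (i) : e (chartField φ i y) = stdVec i := by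
    have := mfderiv_chartField hφ hy i
    rwa [← he] at this
  have h2 (i) : coordDiff φ i y X = (show E3 from e X) i := by
    rw [coordDiff_apply hφ hy, ← he]; rfl
  simp_rw [h1, h2]
  have h3 (w : E3) : ∑ i, w i • stdVec i = w := by
    ext j
    fin_cases j <;> simp [Fin.sum_univ_three]
  exact h3 (e X)

include hφ hy in
lemma chartField_contMDiffAt (i : Fin 3) :
    ContMDiffAt (𝓡 3) ((𝓡 3).prod 𝓘(ℝ, E3)) ∞
      (fun x => (TotalSpace.mk' E3 x (chartField φ i x) : TangentBundle (𝓡 3) M)) y :=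
  ContMDiffAt.mpullback_vectorField_preimage (stdField_contMDiffAt i _) (chart_contMDiffAt hφ hy)
    (chart_mfderiv_invertible hφ hy) (by simp)

include hφ hy in
-- Pullback by a diffeomorphism is natural for the Lie bracket, and constant fields commute.
lemma mlieBracket_chartField (i j : Fin 3) :
    VectorField.mlieBracket (𝓡 3) (chartField φ i) (chartField φ j) y = 0 := by
  unfold chartField
  rw [← VectorField.mpullback_mlieBracket (n := ∞)
    ((stdField_contMDiffAt i _).mdifferentiableAt (by simp))
    ((stdField_contMDiffAt j _).mdifferentiableAt (by simp)) (chart_contMDiffAt hφ hy)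
    (by simp [two_le_infty]), mlieBracket_stdField]
  simp [VectorField.mpullback_apply]

include hφ hy in
lemma mvfderiv_chartField (i : Fin 3) (F : M → ℝ) (hF : MDifferentiableAt (𝓡 3) 𝓘(ℝ, ℝ) F y) :
    mvfderiv (𝓡 3) F y (chartField φ i y) = pd i (F ∘ φ.symm) (φ y) := by
  have h1 : MDifferentiableAt (𝓡 3) 𝓘(ℝ, ℝ) (F ∘ φ.symm) (φ y) := by
    refine MDifferentiableAt.comp _ ?_
      ((chart_mdifferentiable hφ).mdifferentiableAt_symm (φ.map_source hy))
    rwa [φ.left_inv hy]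
  have h2 : F =ᶠ[𝓝 y] (F ∘ φ.symm) ∘ φ := by
    filter_upwards [φ.open_source.mem_nhds hy] with z hz
    simp [φ.left_inv hz]
  have h3 := HasMFDerivAt.comp y h1.hasMFDerivAt
    ((chart_contMDiffAt hφ hy).mdifferentiableAt (by simp)).hasMFDerivAt
  have h4 := (h3.congr_of_eventuallyEq h2).mfderiv
  unfold mvfderiv pd
  erw [h4]
  change mfderiv (𝓡 3) 𝓘(ℝ, ℝ) (F ∘ φ.symm) (φ y) (mfderiv (𝓡 3) (𝓡 3) φ y (chartField φ i y)) = _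
  rw [mfderiv_chartField hφ hy, mfderiv_eq_fderiv]
  rfl

lemma contMDiffAt_mvfderiv_apply {f : M → ℝ} {V : VField M} {x : M}
    (hf : ContMDiffAt (𝓡 3) 𝓘(ℝ, ℝ) ∞ f x)
    (hV : ContMDiffAt (𝓡 3) ((𝓡 3).prod 𝓘(ℝ, E3)) ∞
      (fun x => (TotalSpace.mk' E3 x (V x) : TangentBundle (𝓡 3) M)) x) :
    ContMDiffAt (𝓡 3) 𝓘(ℝ, ℝ) ∞ (fun y => mvfderiv (𝓡 3) f y (V y)) x := by
  have h1 := ContMDiffAt.mfderiv_const (m := ∞) hf (by simp)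
  have h2 := ContMDiffAt.clm_apply_of_inCoordinates (n := ∞) h1 hV hf
  exact (contMDiff_snd_tangentBundle_modelSpace ℝ 𝓘(ℝ, ℝ)).contMDiffAt.comp _ h2
end Chart

/-! ### Global frames, orthonormal frames and Gram determinants. -/

section Frames

variable {M : Type*} [TopologicalSpace M] [ChartedSpace E3 M] [IsManifold (𝓡 3) ∞ M]

/-- Vector fields that are smooth at `x`. -/
abbrev SmoothFieldAt (X : VField M) (x : M) : Prop :=
  ContMDiffAt (𝓡 3) ((𝓡 3).prod 𝓘(ℝ, E3)) ∞
    (fun y => (TotalSpace.mk' E3 y (X y) : TangentBundle (𝓡 3) M)) x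

lemma SmoothFieldAt.diffFieldAt {X : VField M} {x : M} (h : SmoothFieldAt X x) :
    DiffFieldAt X x := ContMDiffAt.mdifferentiableAt h (by simp)

lemma SmoothField.smoothFieldAt {X : VField M} (h : SmoothField X) (x : M) :
    SmoothFieldAt X x := h x

lemma SmoothField.diffFieldAt {X : VField M} (h : SmoothField X) (x : M) :
    DiffFieldAt X x := (h.smoothFieldAt x).diffFieldAt

lemma chartField_smoothFieldAt {φ : OpenPartialHomeomorph M E3}
    (hφ : φ ∈ IsManifold.maximalAtlas (𝓡 3) ∞ M) {y : M} (hy : y ∈ φ.source) (i : Fin 3) :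
    SmoothFieldAt (chartField φ i) y := chartField_contMDiffAt hφ hy i

/-- A smooth field near `x` agrees near `x` with a globally smooth field. -/
lemma exists_smoothField_eventuallyEq [T2Space M] {X : VField M} {x : M} {U : Set M}
    (hU : U ∈ 𝓝 x) (hX : ∀ y ∈ U, SmoothFieldAt X y) :
    ∃ Y : VField M, SmoothField Y ∧ ∀ᶠ y in 𝓝 x, Y y = X y := by
  obtain ⟨f, hf⟩ : ∃ f : SmoothBumpFunction (𝓡 3) x, tsupport f ⊆ interior U := by
    have := (SmoothBumpFunction.nhds_basis_tsupport (I := 𝓡 3) x).mem_iff.1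
      (interior_mem_nhds.2 hU)
    obtain ⟨f, -, hf⟩ := this
    exact ⟨f, hf⟩
  refine ⟨fun y => f y • X y, ?_, ?_⟩
  · have h := ContMDiffOn.smul_section_of_tsupport (I := 𝓡 3) (n := ∞) (F := E3)
      (V := fun y : M => TangentSpace (𝓡 3) y) (s := X) (u := interior U) (ψ := f)
      (f.contMDiff.contMDiffOn) isOpen_interior hf
      (fun y hy => (hX y (interior_subset hy)).contMDiffWithinAt)
    exact h
  · filter_upwards [f.eventuallyEq_one] with y hy
    simp [hy]

/-- `SmoothForm3` tests a 3-form on globally smooth fields only, so the coordinate fields have to be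
cut off to global ones before a form can be evaluated on them. -/
lemma exists_smoothField_frame [T2Space M] (x : M) :
    ∃ X : Fin 3 → VField M, (∀ i, SmoothField (X i)) ∧
      ∀ᶠ y in 𝓝 x, ∀ i, X i y = chartField (chartAt E3 x) i y := by
  have h (i : Fin 3) := exists_smoothField_eventuallyEq
    (X := chartField (chartAt E3 x) i) (x := x) (U := (chartAt E3 x).source)
    ((chartAt E3 x).open_source.mem_nhds (mem_chart_source E3 x))
    (fun y hy => chartField_contMDiffAt (IsManifold.chart_mem_maximalAtlas x) hy i)
  choose X hX hX' using h
  exact ⟨X, hX, eventually_all.2 hX'⟩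

lemma SmoothField.sum {ι : Type*} (s : Finset ι) {X : ι → VField M} (hX : ∀ i, SmoothField (X i)) :
    SmoothField (fun y => ∑ i ∈ s, X i y) :=
  ContMDiff.sum_section (fun i _ => hX i)

lemma SmoothField.const_smul {X : VField M} (hX : SmoothField X) (a : ℝ) :
    SmoothField (fun y => a • X y) :=
  ContMDiff.const_smul_section hX

lemma exists_smoothField_apply_eq [T2Space M] {x : M} (v : TangentSpace (𝓡 3) x) :
    ∃ X : VField M, SmoothField X ∧ X x = v := by
  obtain ⟨X, hX, hX'⟩ := exists_smoothField_frame x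
  refine ⟨fun y => ∑ i, coordDiff (chartAt E3 x) i x v • X i y,
    SmoothField.sum _ fun i => (hX i).const_smul _, ?_⟩
  simp_rw [hX'.self_of_nhds]
  exact sum_coordDiff_smul (IsManifold.chart_mem_maximalAtlas x) (mem_chart_source E3 x) v

variable (g : LorentzMetric M)

lemma LorentzMetric.smoothAt_apply {X Y : VField M} {x : M} (hX : SmoothFieldAt X x)
    (hY : SmoothFieldAt Y x) :
    ContMDiffAt (𝓡 3) 𝓘(ℝ, ℝ) ∞ (fun y => g.form y (X y) (Y y)) x := by
  have h := ContMDiffAt.clm_bundle_apply₂ (F₁ := E3) (F₂ := E3) (F₃ := ℝ)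
    (E₃ := Bundle.Trivial M ℝ) (g.contMDiff x) hX hY
  exact (contMDiffAt_section x).1 h

lemma LorentzMetric.mdifferentiableAt_apply {X Y : VField M} {x : M} (hX : DiffFieldAt X x)
    (hY : DiffFieldAt Y x) :
    MDifferentiableAt (𝓡 3) 𝓘(ℝ, ℝ) (fun y => g.form y (X y) (Y y)) x := by
  have h := MDifferentiableAt.clm_bundle_apply₂ (F₁ := E3) (F₂ := E3) (F₃ := ℝ)
    (E₃ := Bundle.Trivial M ℝ) ((g.contMDiff x).mdifferentiableAt (by simp)) hX hY
  exact (mdifferentiableAt_section _ _).1 h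

lemma LorentzMetric.frame_apply (x : M) (i j : Fin 3) :
    g.form x (g.frame x i) (g.frame x j) = if i = j then lsign i else 0 :=
  (g.exists_frame x).choose_spec i j

lemma LorentzMetric.eq_zero_of_forall {x : M} {v : TangentSpace (𝓡 3) x}
    (h : ∀ w, g.form x v w = 0) : v = 0 := by
  rw [← (g.frame x).sum_repr v]
  refine Finset.sum_eq_zero fun j _ => ?_
  have h1 := h (g.frame x j)
  rw [← (g.frame x).sum_repr v] at h1
  simp only [map_sum, map_smul, sum_apply, smul_apply,
    g.frame_apply, smul_eq_mul, mul_ite, mul_zero, Finset.sum_ite_eq', Finset.mem_univ,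
    if_true] at h1
  have : lsign j ≠ 0 := by unfold lsign; split_ifs <;> norm_num
  rw [(mul_eq_zero.1 h1).resolve_right this, zero_smul]

lemma LorentzMetric.ext_of_forall {x : M} {v v' : TangentSpace (𝓡 3) x}
    (h : ∀ w, g.form x v w = g.form x v' w) : v = v' :=
  sub_eq_zero.1 (g.eq_zero_of_forall fun w => by simp [h])

/-- Each linear form on a tangent space is represented by a vector. -/
lemma LorentzMetric.exists_form_eq {x : M} (l : TangentSpace (𝓡 3) x →ₗ[ℝ] ℝ) :
    ∃ v, ∀ w, g.form x v w = l w := by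
  refine ⟨∑ i, (lsign i * l (g.frame x i)) • g.frame x i, fun w => ?_⟩
  conv_lhs => rw [← (g.frame x).sum_repr w]
  conv_rhs => rw [← (g.frame x).sum_repr w]
  simp only [map_sum, map_smul, sum_apply, smul_apply,
    g.frame_apply, smul_eq_mul, mul_ite, mul_zero, Finset.sum_ite_eq', Finset.mem_univ, if_true]
  refine Finset.sum_congr rfl fun i _ => ?_
  have : lsign i * lsign i = 1 := by unfold lsign; split_ifs <;> norm_num
  linear_combination (l (g.frame x i) * (g.frame x).repr w i) * this

/-- In the orthonormal frame the matrix of products factors as Aᵀ diag(-1,1,1) B; the minus sign is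
the determinant of the middle factor. -/
lemma LorentzMetric.frame_det_mul (x : M) (X Y : Fin 3 → TangentSpace (𝓡 3) x) :
    (g.frame x).det X * (g.frame x).det Y =
      -Matrix.det (Matrix.of fun i j => g.form x (X i) (Y j)) := by
  have h : (Matrix.of fun i j => g.form x (X i) (Y j)) =
      ((g.frame x).toMatrix X).transpose * Matrix.diagonal lsign * (g.frame x).toMatrix Y := by
    ext i j
    conv_lhs => rw [Matrix.of_apply, ← (g.frame x).sum_repr (X i), ← (g.frame x).sum_repr (Y j)]
    simp only [map_sum, map_smul, sum_apply, smul_apply,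
      g.frame_apply, smul_eq_mul, mul_ite, mul_zero, Finset.sum_ite_eq', Finset.mem_univ, if_true,
      Matrix.mul_apply, Matrix.transpose_apply, Matrix.diagonal_apply, Basis.toMatrix_apply]
    refine Finset.sum_congr rfl fun k _ => by ring
  rw [h, Matrix.det_mul, Matrix.det_mul, Matrix.det_transpose, Matrix.det_diagonal,
    Fin.prod_univ_three, Basis.det_apply, Basis.det_apply]
  simp [lsign]

/-- The basis of the tangent space formed by the coordinate vectors of a chart. -/
def chartBasis {φ : OpenPartialHomeomorph M E3} (hφ : φ ∈ IsManifold.maximalAtlas (𝓡 3) ∞ M) {y : M}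
    (hy : y ∈ φ.source) : Basis (Fin 3) ℝ (TangentSpace (𝓡 3) y) :=
  Basis.ofEquivFun
    { toFun := fun X i => coordDiff φ i y X
      map_add' := fun X Y => by ext; simp
      map_smul' := fun a X => by ext; simp
      invFun := fun c => ∑ i, c i • chartField φ i y
      left_inv := fun X => sum_coordDiff_smul hφ hy X
      right_inv := fun c => by
        ext j
        simp [coordDiff_chartField hφ hy] }

@[simp]
lemma chartBasis_apply {φ : OpenPartialHomeomorph M E3}
    (hφ : φ ∈ IsManifold.maximalAtlas (𝓡 3) ∞ M) {y : M} (hy : y ∈ φ.source) (i : Fin 3) :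
    chartBasis hφ hy i = chartField φ i y := by
  simp [chartBasis, Basis.ofEquivFun, Pi.single_apply]

/-- The determinant of the first three columns of a `3 × 3` linear system, with column `i` replaced
by the right hand side, over the determinant of the system. -/
def cramer3 (i : Fin 3) (Gb : (Fin 3 → Fin 3 → ℝ) × (Fin 3 → ℝ)) : ℝ :=
  Matrix.det (Matrix.of fun j k => if j = i then Gb.2 k else Gb.1 j k) /
    Matrix.det (Matrix.of Gb.1)

/-- Cramer's rule by rows: `b` is the combination of the rows of `G` with coefficients `c`, so
putting it in place of row `i` multiplies the determinant by `c i`. -/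
lemma cramer3_eq {G : Fin 3 → Fin 3 → ℝ} {b c : Fin 3 → ℝ} (hG : Matrix.det (Matrix.of G) ≠ 0)
    (h : ∀ j, ∑ i, c i * G i j = b j) (i : Fin 3) : cramer3 i (G, b) = c i := by
  rw [cramer3, div_eq_iff hG]
  simp only [Matrix.det_fin_three, Matrix.of_apply, ← h, Fin.sum_univ_three]
  fin_cases i <;> simp <;> ring

lemma contDiffAt_cramer3 (i : Fin 3) {Gb : (Fin 3 → Fin 3 → ℝ) × (Fin 3 → ℝ)}
    (hG : Matrix.det (Matrix.of Gb.1) ≠ 0) : ContDiffAt ℝ ∞ (cramer3 i) Gb := by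
  unfold cramer3
  refine ContDiffAt.div ?_ ?_ hG
  · fin_cases i <;> simp [Matrix.det_fin_three] <;> fun_prop
  · simp only [Matrix.det_fin_three, Matrix.of_apply]
    fun_prop

lemma mdifferentiableAt_pi_space {ι : Type*} [Fintype ι] {F : ι → Type*}
    [∀ i, NormedAddCommGroup (F i)] [∀ i, NormedSpace ℝ (F i)] {f : M → ∀ i, F i} {x : M}
    (h : ∀ i, MDifferentiableAt (𝓡 3) 𝓘(ℝ, F i) (fun y => f y i) x) :
    MDifferentiableAt (𝓡 3) 𝓘(ℝ, ∀ i, F i) f x := by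
  refine (mdifferentiableAt_iff ..).2 ⟨continuousAt_pi.2 fun i => (h i).continuousAt, ?_⟩
  exact differentiableWithinAt_pi.2 fun i => ((mdifferentiableAt_iff ..).1 (h i)).2

/-! ### Regularity of a field tested on its products with coordinate fields. -/

section Criterion

variable {φ : OpenPartialHomeomorph M E3} (hφ : φ ∈ IsManifold.maximalAtlas (𝓡 3) ∞ M) {y : M}
  (hy : y ∈ φ.source)

include hφ hy in
lemma LorentzMetric.chart_gram_det_ne_zero : Matrix.det (Matrix.of fun i j =>
    g.form y (chartField φ i y) (chartField φ j y)) ≠ 0 := by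
  have h := g.frame_det_mul y (fun i => chartField φ i y) (fun i => chartField φ i y)
  intro h0
  rw [h0, neg_zero, mul_self_eq_zero] at h
  have h2 := (g.frame y).isUnit_det (chartBasis hφ hy)
  have h3 : (fun i => chartField φ i y) = chartBasis hφ hy := by ext i; simp
  rw [h3] at h
  rw [h] at h2
  exact not_isUnit_zero h2

include hφ hy in
lemma LorentzMetric.eventually_eq_sum_cramer3 (X : VField M) : ∀ᶠ z in 𝓝 y, X z =
    ∑ i, cramer3 i (fun j k => g.form z (chartField φ j z) (chartField φ k z),
      fun k => g.form z (X z) (chartField φ k z)) • chartField φ i z := by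
  filter_upwards [φ.open_source.mem_nhds hy] with z hz
  conv_lhs => rw [← sum_coordDiff_smul hφ hz (X z)]
  refine Finset.sum_congr rfl fun i _ => ?_
  rw [cramer3_eq (g.chart_gram_det_ne_zero hφ hz)]
  intro j
  conv_rhs => rw [← sum_coordDiff_smul hφ hz (X z)]
  simp

/-- The Gram matrix of a chart and the products of a vector field with the coordinate fields. -/
def LorentzMetric.gramData (φ : OpenPartialHomeomorph M E3) (X : VField M) (z : M) :
    (Fin 3 → Fin 3 → ℝ) × (Fin 3 → ℝ) :=
  (fun j k => g.form z (chartField φ j z) (chartField φ k z),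
    fun k => g.form z (X z) (chartField φ k z))

include hφ hy in
-- The components of `X` are rational functions of the Gram data, with the nonvanishing Gram
-- determinant as denominator. Fields that are known only through their inner products, such as ∇^g
-- or the contorsion, are thereby reduced to scalar functions.
lemma LorentzMetric.smoothFieldAt_of_form (X : VField M)
    (h : ∀ i, ContMDiffAt (𝓡 3) 𝓘(ℝ, ℝ) ∞ (fun z => g.form z (X z) (chartField φ i z)) y) :
    SmoothFieldAt X y := by
  have hF : ContMDiffAt (𝓡 3) 𝓘(ℝ, (Fin 3 → Fin 3 → ℝ) × (Fin 3 → ℝ)) ∞ (g.gramData φ X) y :=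
    ContMDiffAt.prodMk_space (contMDiffAt_pi_space.2 fun j => contMDiffAt_pi_space.2 fun k =>
      g.smoothAt_apply (chartField_smoothFieldAt hφ hy j) (chartField_smoothFieldAt hφ hy k))
      (contMDiffAt_pi_space.2 h)
  have hc (i : Fin 3) : ContMDiffAt (𝓡 3) 𝓘(ℝ, ℝ) ∞ (cramer3 i ∘ g.gramData φ X) y :=
    ContMDiffAt.comp y (contDiffAt_cramer3 i (Gb := g.gramData φ X y)
      (g.chart_gram_det_ne_zero hφ hy)).contMDiffAt hF
  have h1 : SmoothFieldAt (fun z => ∑ i, (cramer3 i ∘ g.gramData φ X) z • chartField φ i z) y :=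
    ContMDiffAt.sum_section fun i _ => ContMDiffAt.smul_section (hc i)
      (chartField_smoothFieldAt hφ hy i)
  refine h1.congr_of_eventuallyEq ?_
  filter_upwards [g.eventually_eq_sum_cramer3 hφ hy X] with z hz
  exact congrArg _ hz

include hφ hy in
lemma LorentzMetric.diffFieldAt_of_form (X : VField M)
    (h : ∀ i, MDifferentiableAt (𝓡 3) 𝓘(ℝ, ℝ)
      (fun z => g.form z (X z) (chartField φ i z)) y) : DiffFieldAt X y := by
  have hF : MDifferentiableAt (𝓡 3) 𝓘(ℝ, (Fin 3 → Fin 3 → ℝ) × (Fin 3 → ℝ)) (g.gramData φ X) y :=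
    MDifferentiableAt.prodMk_space (mdifferentiableAt_pi_space fun j =>
      mdifferentiableAt_pi_space fun k =>
      g.mdifferentiableAt_apply (chartField_smoothFieldAt hφ hy j).diffFieldAt
        (chartField_smoothFieldAt hφ hy k).diffFieldAt)
      (mdifferentiableAt_pi_space h)
  have hc (i : Fin 3) : MDifferentiableAt (𝓡 3) 𝓘(ℝ, ℝ) (cramer3 i ∘ g.gramData φ X) y :=
    MDifferentiableAt.comp y ((contDiffAt_cramer3 i (Gb := g.gramData φ X y)
      (g.chart_gram_det_ne_zero hφ hy)).contMDiffAt.mdifferentiableAt (by simp)) hF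
  have h1 : DiffFieldAt (fun z => ∑ i, (cramer3 i ∘ g.gramData φ X) z • chartField φ i z) y :=
    MDifferentiableAt.sum_section fun i _ => MDifferentiableAt.smul_section (hc i)
      (chartField_smoothFieldAt hφ hy i).diffFieldAt
  refine h1.congr_of_eventuallyEq ?_
  filter_upwards [g.eventually_eq_sum_cramer3 hφ hy X] with z hz
  exact congrArg _ hz

end Criterion

/-- A field of endomorphisms is smooth if its values on smooth fields are. -/
lemma contMDiffAt_hom_of_forall {A : ∀ x : M, TangentSpace (𝓡 3) x →L[ℝ] TangentSpace (𝓡 3) x}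
    {x : M} (h : ∀ X : VField M, SmoothFieldAt X x → SmoothFieldAt (fun y => A y (X y)) x) :
    ContMDiffAt (𝓡 3) ((𝓡 3).prod 𝓘(ℝ, E3 →L[ℝ] E3)) ∞
      (fun y => TotalSpace.mk' (E3 →L[ℝ] E3)
        (E := fun y : M => TangentSpace (𝓡 3) y →L[ℝ] TangentSpace (𝓡 3) y) y (A y)) x := by
  rw [contMDiffAt_hom_bundle]
  refine ⟨contMDiffAt_id, ?_⟩
  -- `Φ` rebuilds an endomorphism from its columns, so that smoothness can be checked column by
  -- column.
  let Φ : (Fin 3 → E3) →ₗ[ℝ] (E3 →L[ℝ] E3) :=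
    ∑ i, (ContinuousLinearMap.smulRightL ℝ E3 E3 (EuclideanSpace.proj i)).toLinearMap ∘ₗ
      LinearMap.proj i
  have hΦ (L : E3 →L[ℝ] E3) : L = Φ.toContinuousLinearMap (fun i => L (stdVec i)) := by
    ext1 w
    have h3 : ∑ i, w i • stdVec i = w := by
      ext j
      fin_cases j <;> simp [Fin.sum_univ_three]
    conv_lhs => rw [← h3]
    simp [Φ]
  have h2 : ContMDiffAt (𝓡 3) 𝓘(ℝ, Fin 3 → E3) ∞ (fun y => fun i : Fin 3 =>
      (ContinuousLinearMap.inCoordinates E3 (TangentSpace (𝓡 3) : M → Type _) E3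
        (TangentSpace (𝓡 3) : M → Type _) x y x y (A y)) (stdVec i)) x := by
    refine contMDiffAt_pi_space.2 fun i => ?_
    set t := trivializationAt E3 (TangentSpace (𝓡 3) : M → Type _) x
    have hx : x ∈ t.baseSet := FiberBundle.mem_baseSet_trivializationAt' x
    let b : Basis (Fin 3) ℝ E3 := (EuclideanSpace.basisFun (Fin 3) ℝ).toBasis
    -- Read in the trivialization, the `i`-th column is the image under `A` of the `i`-th local
    -- frame field, to which the hypothesis applies.
    have h3 : SmoothFieldAt (t.localFrame b i) x := contMDiffAt_localFrame_of_mem ∞ t b i hx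
    have h4 := (contMDiffAt_section x).1 (h _ h3)
    refine h4.congr_of_eventuallyEq ?_
    filter_upwards [t.open_baseSet.mem_nhds hx] with y hy
    rw [ContinuousLinearMap.inCoordinates_eq hy hy]
    rw [Trivialization.localFrame_apply_of_mem_baseSet _ _ hy]
    simp [b, Trivialization.basisAt]
    rfl
  refine (Φ.toContinuousLinearMap.contMDiff.contMDiffAt.comp x h2).congr_of_eventuallyEq ?_
  exact Eventually.of_forall fun y => hΦ _

end Frames

/-! ### Existence of the Levi-Civita connection and the Koszul formula. -/

section LeviCivita

open VectorField

variable {M : Type*} [TopologicalSpace M] [ChartedSpace E3 M] [IsManifold (𝓡 3) ∞ M]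
  (g : LorentzMetric M)

/-- The derivative at `x` in direction `v` of the function `g(X,Y)`. -/
def LorentzMetric.deriv (X Y : VField M) (x : M) (v : TangentSpace (𝓡 3) x) : ℝ :=
  mvfderiv (𝓡 3) (fun y => g.form y (X y) (Y y)) x v

lemma LorentzMetric.deriv_comm (X Y : VField M) (x : M) (v : TangentSpace (𝓡 3) x) :
    g.deriv X Y x v = g.deriv Y X x v := by
  unfold LorentzMetric.deriv
  simp_rw [g.symm _ (X _)]

@[simp]
lemma LorentzMetric.deriv_add_vec (X Y : VField M) (x : M) (v w : TangentSpace (𝓡 3) x) :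
    g.deriv X Y x (v + w) = g.deriv X Y x v + g.deriv X Y x w := map_add _ _ _

@[simp]
lemma LorentzMetric.deriv_smul_vec (X Y : VField M) (x : M) (a : ℝ) (v : TangentSpace (𝓡 3) x) :
    g.deriv X Y x (a • v) = a * g.deriv X Y x v := map_smul _ _ _

variable {x : M} {X X' Y Z V W σ σ' : VField M} {f : M → ℝ}

lemma LorentzMetric.deriv_add_left (hX : DiffFieldAt X x) (hX' : DiffFieldAt X' x)
    (hY : DiffFieldAt Y x) (v : TangentSpace (𝓡 3) x) :
    g.deriv (X + X') Y x v = g.deriv X Y x v + g.deriv X' Y x v := by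
  unfold LorentzMetric.deriv
  rw [← add_apply, ← mvfderiv_fun_add (g.mdifferentiableAt_apply hX hY)
    (g.mdifferentiableAt_apply hX' hY)]
  simp

lemma LorentzMetric.deriv_smul_left (hf : MDifferentiableAt (𝓡 3) 𝓘(ℝ, ℝ) f x)
    (hX : DiffFieldAt X x) (hY : DiffFieldAt Y x) (v : TangentSpace (𝓡 3) x) :
    g.deriv (f • X) Y x v = f x * g.deriv X Y x v +
      mvfderiv (𝓡 3) f x v * g.form x (X x) (Y x) := by
  unfold LorentzMetric.deriv
  have h := mvfderiv_fun_mul hf (g.mdifferentiableAt_apply hX hY)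
  have h2 : (fun y => g.form y ((f • X) y) (Y y)) = fun y => f y * g.form y (X y) (Y y) := by
    ext y; simp
  rw [h2, h]
  simp only [add_apply, smul_apply, smul_eq_mul]
  ring

lemma LorentzMetric.deriv_add_right (hX : DiffFieldAt X x) (hX' : DiffFieldAt X' x)
    (hY : DiffFieldAt Y x) (v : TangentSpace (𝓡 3) x) :
    g.deriv Y (X + X') x v = g.deriv Y X x v + g.deriv Y X' x v := by
  rw [g.deriv_comm, g.deriv_add_left hX hX' hY, g.deriv_comm X, g.deriv_comm X']

lemma LorentzMetric.deriv_smul_right (hf : MDifferentiableAt (𝓡 3) 𝓘(ℝ, ℝ) f x)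
    (hX : DiffFieldAt X x) (hY : DiffFieldAt Y x) (v : TangentSpace (𝓡 3) x) :
    g.deriv Y (f • X) x v = f x * g.deriv Y X x v +
      mvfderiv (𝓡 3) f x v * g.form x (Y x) (X x) := by
  rw [g.deriv_comm, g.deriv_smul_left hf hX hY, g.deriv_comm X, g.symm]

/-- The right hand side of the Koszul formula for `2 g(∇_V σ, W)`. -/
def LorentzMetric.koszul (σ V W : VField M) (x : M) : ℝ :=
  g.deriv σ W x (V x) + g.deriv V W x (σ x) - g.deriv V σ x (W x)
    + g.form x (mlieBracket (𝓡 3) V σ x) (W x) - g.form x (mlieBracket (𝓡 3) V W x) (σ x)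
    - g.form x (mlieBracket (𝓡 3) σ W x) (V x)

/-- The derivatives of a factor `f` coming from the metric terms cancel those coming from the
brackets. The same happens in `W`, so for fixed σ the Koszul expression is a bilinear form on the
tangent space. -/
lemma LorentzMetric.koszul_tensorial_left (hσ : DiffFieldAt σ x) (hW : DiffFieldAt W x) :
    TensorialAt (𝓡 3) E3 (fun V : VField M => g.koszul σ V W x) x where
  smul {f V} hf hV := by
    simp only [LorentzMetric.koszul, g.deriv_smul_left hf hV hW, g.deriv_smul_left hf hV hσ,
      mlieBracket_smul_left hf hV, Pi.smul_apply', g.deriv_smul_vec, map_add, map_smul,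
      add_apply, smul_apply, smul_eq_mul,
      g.symm x (V x), neg_mul]
    ring
  add {V V'} hV hV' := by
    simp only [LorentzMetric.koszul, g.deriv_add_left hV hV' hW, g.deriv_add_left hV hV' hσ,
      mlieBracket_add_left hV hV', Pi.add_apply, g.deriv_add_vec, map_add,
      add_apply]
    ring

lemma LorentzMetric.koszul_tensorial_right (hσ : DiffFieldAt σ x) (hV : DiffFieldAt V x) :
    TensorialAt (𝓡 3) E3 (fun W : VField M => g.koszul σ V W x) x where
  smul {f W} hf hW := by
    simp only [LorentzMetric.koszul, g.deriv_smul_right hf hW hV, g.deriv_smul_right hf hW hσ,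
      mlieBracket_smul_right hf hW, Pi.smul_apply', g.deriv_smul_vec, map_add, map_smul,
      add_apply, smul_apply, smul_eq_mul]
    rw [g.symm x (W x) (σ x), g.symm x (W x) (V x)]
    ring
  add {W W'} hW hW' := by
    simp only [LorentzMetric.koszul, g.deriv_add_right hW hW' hV, g.deriv_add_right hW hW' hσ,
      mlieBracket_add_right hW hW', Pi.add_apply, g.deriv_add_vec, map_add,
      add_apply]
    ring

lemma LorentzMetric.koszul_add (hσ : DiffFieldAt σ x) (hσ' : DiffFieldAt σ' x)
    (hV : DiffFieldAt V x) (hW : DiffFieldAt W x) :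
    g.koszul (σ + σ') V W x = g.koszul σ V W x + g.koszul σ' V W x := by
  simp only [LorentzMetric.koszul, g.deriv_add_right hσ hσ' hV, g.deriv_add_left hσ hσ' hW,
    mlieBracket_add_right hσ hσ', mlieBracket_add_left hσ hσ', Pi.add_apply, g.deriv_add_vec,
    map_add, add_apply]
  ring

/-- In σ the derivatives of `f` do not cancel. What survives is the Leibniz term, with the factor 2
because the Koszul expression stands for 2g(∇_V σ, W). -/
lemma LorentzMetric.koszul_smul (hf : MDifferentiableAt (𝓡 3) 𝓘(ℝ, ℝ) f x)
    (hσ : DiffFieldAt σ x) (hV : DiffFieldAt V x) (hW : DiffFieldAt W x) :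
    g.koszul (f • σ) V W x = f x * g.koszul σ V W x +
      2 * mvfderiv (𝓡 3) f x (V x) * g.form x (σ x) (W x) := by
  simp only [LorentzMetric.koszul, g.deriv_smul_right hf hσ hV, g.deriv_smul_left hf hσ hW,
    mlieBracket_smul_right hf hσ, mlieBracket_smul_left hf hσ, Pi.smul_apply', g.deriv_smul_vec,
    map_add, map_smul, add_apply, smul_apply, smul_eq_mul,
    g.symm x (V x), neg_mul]
  ring

/-- The tensor `(V, W) ↦ 2 g(∇_V σ, W)` at `x`. -/
def LorentzMetric.koszulForm (σ : VField M) (x : M) (hσ : DiffFieldAt σ x) :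
    TangentSpace (𝓡 3) x →L[ℝ] TangentSpace (𝓡 3) x →L[ℝ] ℝ :=
  TensorialAt.mkHom₂ (I := 𝓡 3) (F := E3) (F' := E3) (fun V W => g.koszul σ V W x) x
    (fun _ hW => g.koszul_tensorial_left hσ hW) (fun _ hV => g.koszul_tensorial_right hσ hV)

/-- The vector that represents a linear form on a tangent space. -/
def LorentzMetric.sharp (x : M) (l : TangentSpace (𝓡 3) x →L[ℝ] ℝ) : TangentSpace (𝓡 3) x :=
  ∑ i, (lsign i * l (g.frame x i)) • g.frame x i

lemma LorentzMetric.form_sharp (l : TangentSpace (𝓡 3) x →L[ℝ] ℝ) (w : TangentSpace (𝓡 3) x) :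
    g.form x (g.sharp x l) w = l w := by
  conv_lhs => rw [← (g.frame x).sum_repr w]
  conv_rhs => rw [← (g.frame x).sum_repr w]
  simp only [LorentzMetric.sharp, map_sum, map_smul, sum_apply, smul_apply,
    g.frame_apply, smul_eq_mul, mul_ite, mul_zero, Finset.sum_ite_eq', Finset.mem_univ, if_true]
  refine Finset.sum_congr rfl fun i _ => ?_
  have : lsign i * lsign i = 1 := by unfold lsign; split_ifs <;> norm_num
  linear_combination (l (g.frame x i) * (g.frame x).repr w i) * this

instance tangentSpace_t2Space (x : M) : T2Space (TangentSpace (𝓡 3) x) :=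
  inferInstanceAs (T2Space E3)

instance tangentSpace_finiteDimensional (x : M) :
    FiniteDimensional ℝ (TangentSpace (𝓡 3) x) := inferInstanceAs (FiniteDimensional ℝ E3)

open Classical in
/-- The covariant derivative of the Levi-Civita connection. -/
def LorentzMetric.leviCivitaFun (σ : VField M) (x : M) :
    TangentSpace (𝓡 3) x →L[ℝ] TangentSpace (𝓡 3) x :=
  if hσ : DiffFieldAt σ x then
    LinearMap.toContinuousLinearMap
      { toFun := fun v => g.sharp x ((1 / 2 : ℝ) • g.koszulForm σ x hσ v)
        map_add' := fun v w => g.ext_of_forall fun u => by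
          simp only [map_add, smul_add, add_apply, g.form_sharp]
        map_smul' := fun a v => g.ext_of_forall fun u => by
          simp only [map_smul, smul_apply, g.form_sharp, RingHom.id_apply, smul_eq_mul]
          ring }
  -- A default value: the axioms of a covariant derivative concern only fields differentiable at
  -- `x`.
  else 0

lemma LorentzMetric.two_mul_form_leviCivitaFun (hσ : DiffFieldAt σ x) (hV : DiffFieldAt V x)
    (hW : DiffFieldAt W x) :
    2 * g.form x (g.leviCivitaFun σ x (V x)) (W x) = g.koszul σ V W x := by
  have h : g.leviCivitaFun σ x (V x) = g.sharp x ((1 / 2 : ℝ) • g.koszulForm σ x hσ (V x)) := by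
    simp only [LorentzMetric.leviCivitaFun, hσ, dite_true]
    rfl
  rw [h, g.form_sharp]
  have := TensorialAt.mkHom₂_apply (I := 𝓡 3) (F := E3) (F' := E3)
    (Φ := fun V W => g.koszul σ V W x)
    (fun _ hW => g.koszul_tensorial_left hσ hW) (fun _ hV => g.koszul_tensorial_right hσ hV) hV hW
  rw [smul_apply, LorentzMetric.koszulForm, this, smul_eq_mul]
  ring

lemma diffFieldAt_extend (v : TangentSpace (𝓡 3) x) :
    DiffFieldAt (FiberBundle.extend E3 v : VField M) x :=
  FiberBundle.mdifferentiableAt_extend (𝓡 3) E3 v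

/-- An endomorphism of the tangent space is determined by its products with fields. -/
lemma LorentzMetric.ext_of_fields {A B : TangentSpace (𝓡 3) x →L[ℝ] TangentSpace (𝓡 3) x}
    (h : ∀ V W : VField M, DiffFieldAt V x → DiffFieldAt W x →
      g.form x (A (V x)) (W x) = g.form x (B (V x)) (W x)) : A = B := by
  ext v : 1
  refine g.ext_of_forall fun w => ?_
  simpa using h _ _ (diffFieldAt_extend v) (diffFieldAt_extend w)

/-- The Levi-Civita connection. -/
def LorentzMetric.leviCivita : AffConn M where
  toFun := g.leviCivitaFun
  isCovariantDerivativeOnUniv :=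
    { add := fun {σ σ' x} hσ hσ' _ => g.ext_of_fields fun V W hV hW => by
        have h := g.two_mul_form_leviCivitaFun (σ := σ + σ') (x := x)
          (mdifferentiableAt_add_section hσ hσ') hV hW
        rw [g.koszul_add hσ hσ' hV hW, ← g.two_mul_form_leviCivitaFun hσ hV hW,
          ← g.two_mul_form_leviCivitaFun hσ' hV hW] at h
        simp only [add_apply, map_add]
        linarith
      leibniz := fun {σ f x} hσ hf _ => g.ext_of_fields fun V W hV hW => by
        have h := g.two_mul_form_leviCivitaFun (σ := f • σ) (x := x)
          (MDifferentiableAt.smul_section hf hσ) hV hW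
        rw [g.koszul_smul hf hσ hV hW, ← g.two_mul_form_leviCivitaFun hσ hV hW] at h
        simp only [add_apply, smul_apply, map_add, map_smul, smul_eq_mul,
          ContinuousLinearMap.smulRight_apply]
        linarith }

lemma LorentzMetric.deriv_smoothAt (hX : SmoothFieldAt X x) (hY : SmoothFieldAt Y x)
    (hV : SmoothFieldAt V x) :
    ContMDiffAt (𝓡 3) 𝓘(ℝ, ℝ) ∞ (fun y => g.deriv X Y y (V y)) x :=
  contMDiffAt_mvfderiv_apply (g.smoothAt_apply hX hY) hV

lemma SmoothFieldAt.mlieBracket (hX : SmoothFieldAt X x) (hY : SmoothFieldAt Y x) :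
    SmoothFieldAt (mlieBracket (𝓡 3) X Y) x := by
  have : IsManifold (𝓡 3) (((⊤ : ℕ∞) : WithTop ℕ∞) + 1) M := by
    simpa using (inferInstance : IsManifold (𝓡 3) ∞ M)
  exact ContMDiffAt.mlieBracket_vectorField (m := ⊤) (n := ⊤) hX hY (by simp)

lemma SmoothFieldAt.eventually_diffFieldAt (hX : SmoothFieldAt X x) :
    ∀ᶠ y in 𝓝 x, DiffFieldAt X y := by
  have h : ContMDiffAt (𝓡 3) ((𝓡 3).prod 𝓘(ℝ, E3)) 1
    (fun y => (TotalSpace.mk' E3 y (X y) : TangentBundle (𝓡 3) M)) x := hX.of_le (by simp)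
  filter_upwards [(contMDiffAt_iff_contMDiffAt_nhds (by simp)).1 h] with y hy
  exact ContMDiffAt.mdifferentiableAt hy (by simp)

lemma LorentzMetric.leviCivita_smooth : g.leviCivita.ContMDiffCovariantDerivative ∞ := by
  refine ⟨⟨fun {σ} hσ x _ => ContMDiffAt.contMDiffWithinAt ?_⟩⟩
  have hσ' : SmoothField σ := contMDiffOn_univ.1 (by simpa using hσ)
  refine contMDiffAt_hom_of_forall fun V hV => ?_
  have hφ := IsManifold.chart_mem_maximalAtlas (I := 𝓡 3) (n := ∞) x
  have hx := mem_chart_source E3 x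
  refine g.smoothFieldAt_of_form hφ hx _ fun i => ?_
  have hW := chartField_smoothFieldAt hφ hx i
  have h1 : ContMDiffAt (𝓡 3) 𝓘(ℝ, ℝ) ∞
      (fun y => (1 / 2 : ℝ) * g.koszul σ V (chartField (chartAt E3 x) i) y) x := by
    refine contMDiffAt_const.mul ?_
    have hs := hσ'.smoothFieldAt x
    exact (((((g.deriv_smoothAt hs hW hV).add (g.deriv_smoothAt hV hW hs)).sub
      (g.deriv_smoothAt hV hs hW)).add (g.smoothAt_apply (hV.mlieBracket hs) hW)).sub
      (g.smoothAt_apply (hV.mlieBracket hW) hs)).sub (g.smoothAt_apply (hs.mlieBracket hW) hV)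
  refine h1.congr_of_eventuallyEq ?_
  filter_upwards [hV.eventually_diffFieldAt, hW.eventually_diffFieldAt] with y hVy hWy
  rw [← g.two_mul_form_leviCivitaFun (hσ'.diffFieldAt y) hVy hWy]
  change g.form y (g.leviCivitaFun σ y (V y)) _ = _
  ring

/-- Adding the Koszul expressions with `Y` and `Z` exchanged, everything cancels except twice the
derivative of g(Y,Z) along `V`. -/
lemma LorentzMetric.leviCivita_metric : IsMetricConn g g.leviCivita := by
  intro x Y Z hY hZ v
  obtain ⟨V, hV, rfl⟩ : ∃ V : VField M, DiffFieldAt V x ∧ V x = v :=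
    ⟨_, diffFieldAt_extend v, by simp⟩
  have h1 := g.two_mul_form_leviCivitaFun hY hV hZ
  have h2 := g.two_mul_form_leviCivitaFun hZ hV hY
  simp only [LorentzMetric.koszul] at h1 h2
  rw [mlieBracket_swap (V := Z) (W := Y)] at h2
  rw [g.deriv_comm Z Y] at h2
  change g.deriv Y Z x (V x) = g.form x (g.leviCivitaFun Y x (V x)) (Z x) +
    g.form x (Y x) (g.leviCivitaFun Z x (V x))
  rw [g.symm x (Y x)]
  simp only [Pi.neg_apply, map_neg, neg_apply] at h2
  linarith

/-- Subtracting the Koszul expressions with `V` and `W` exchanged leaves 2g([V,W],U). -/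
lemma LorentzMetric.leviCivita_torsion (x : M) : g.leviCivita.torsion x = 0 := by
  ext v w : 2
  obtain ⟨V, hV, rfl⟩ : ∃ V : VField M, DiffFieldAt V x ∧ V x = v :=
    ⟨_, diffFieldAt_extend v, by simp⟩
  obtain ⟨W, hW, rfl⟩ : ∃ V : VField M, DiffFieldAt V x ∧ V x = w :=
    ⟨_, diffFieldAt_extend w, by simp⟩
  rw [CovariantDerivative.torsion_apply _ hV hW]
  refine g.ext_of_forall fun u => ?_
  obtain ⟨U, hU, rfl⟩ : ∃ V : VField M, DiffFieldAt V x ∧ V x = u :=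
    ⟨_, diffFieldAt_extend u, by simp⟩
  have h1 := g.two_mul_form_leviCivitaFun hW hV hU
  have h2 := g.two_mul_form_leviCivitaFun hV hW hU
  simp only [LorentzMetric.koszul] at h1 h2
  rw [mlieBracket_swap (V := W) (W := V), g.deriv_comm W V] at h2
  change g.form x (g.leviCivitaFun W x (V x) - g.leviCivitaFun V x (W x) - _) _ = g.form x 0 _
  simp only [Pi.neg_apply, map_neg, neg_apply, map_sub, sub_apply, map_zero, zero_apply] at h2 ⊢
  linarith

lemma LorentzMetric.isLeviCivita_leviCivita : IsLeviCivita g g.leviCivita :=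
  ⟨g.leviCivita_smooth, g.leviCivita_metric, g.leviCivita_torsion⟩

/-- The **Koszul formula**. -/
lemma IsLeviCivita.two_mul_form {D : AffConn M} (hD : IsLeviCivita g D) (hσ : DiffFieldAt σ x)
    (hV : DiffFieldAt V x) (hW : DiffFieldAt W x) :
    2 * g.form x (D σ x (V x)) (W x) = g.koszul σ V W x := by
  have t {A B : VField M} (hA : DiffFieldAt A x) (hB : DiffFieldAt B x) :
      mlieBracket (𝓡 3) A B x = D B x (A x) - D A x (B x) := by
    have := D.torsion_apply hA hB
    rw [hD.torsion_free] at this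
    exact (sub_eq_zero.1 this.symm).symm
  have m {A B : VField M} (hA : DiffFieldAt A x) (hB : DiffFieldAt B x) (v) :
      g.deriv A B x v = g.form x (D A x v) (B x) + g.form x (A x) (D B x v) :=
    hD.metric x A B hA hB v
  simp only [LorentzMetric.koszul, t hV hσ, t hV hW, t hσ hW, m hσ hW, m hV hW, m hV hσ, map_sub,
    sub_apply]
  rw [g.symm x (V x) (D W x (σ x)), g.symm x (σ x) (D W x (V x)), g.symm x (V x) (D σ x (W x))]
  ring

end LeviCivita

/-! ### Smoothness of the superposition operator γ ↦ F ∘ γ on continuous maps from a compact space.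
-/

section Nemytskii

variable {K : Type} [TopologicalSpace K] [CompactSpace K]
  {E E' : Type} [NormedAddCommGroup E] [NormedSpace ℝ E] [NormedAddCommGroup E'] [NormedSpace ℝ E']

/-- The normed space of continuous linear maps, as a type with its norm topology only. -/
def NormedHom (E E' : Type) [NormedAddCommGroup E] [NormedSpace ℝ E] [NormedAddCommGroup E']
    [NormedSpace ℝ E'] : Type := E →L[ℝ] E'

instance : NormedAddCommGroup (NormedHom E E') := inferInstanceAs (NormedAddCommGroup (E →L[ℝ] E'))

instance : NormedSpace ℝ (NormedHom E E') := inferInstanceAs (NormedSpace ℝ (E →L[ℝ] E'))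

/-- Reading a continuous linear map as an element of `NormedHom`. -/
def NormedHom.of : (E →L[ℝ] E') →L[ℝ] NormedHom E E' := ContinuousLinearMap.id ℝ (E →L[ℝ] E')

/-- The continuous linear map underlying an element of `NormedHom`. -/
def NormedHom.hom : NormedHom E E' →L[ℝ] E →L[ℝ] E' := ContinuousLinearMap.id ℝ (E →L[ℝ] E')

@[simp]
lemma NormedHom.hom_of (A : E →L[ℝ] E') : NormedHom.hom (NormedHom.of A) = A := rfl

lemma NormedHom.norm_hom (A : NormedHom E E') : ‖NormedHom.hom A‖ = ‖A‖ := rfl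

/-- Pointwise application of a family of linear maps to a family of vectors. -/
def pointwiseApply (K : Type) [TopologicalSpace K] [CompactSpace K] (E E' : Type)
    [NormedAddCommGroup E] [NormedSpace ℝ E] [NormedAddCommGroup E'] [NormedSpace ℝ E'] :
    C(K, NormedHom E E') →L[ℝ] C(K, E) →L[ℝ] C(K, E') :=
  LinearMap.mkContinuous₂
    (LinearMap.mk₂ ℝ
      (fun (A : C(K, NormedHom E E')) (h : C(K, E)) =>
        (⟨fun t => NormedHom.hom (A t) (h t), by fun_prop⟩ : C(K, E')))
      (fun A B h => by ext; simp) (fun a A h => by ext; simp)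
      (fun A h k => by ext; simp) (fun a A h => by ext; simp)) 1
    (fun A h => by
      refine (ContinuousMap.norm_le _ (by positivity)).2 fun t => ?_
      rw [one_mul]
      exact ((NormedHom.hom (A t)).le_opNorm (h t)).trans
        (mul_le_mul (A.norm_coe_le_norm t) (h.norm_coe_le_norm t) (norm_nonneg _) (norm_nonneg _)))

/-- The mean value inequality at each `t`, made uniform in `t`: continuity of γ ↦ DF ∘ γ in the sup
norm gives one δ such that DF varies by at most ε on every ball of radius δ around a point γ(t). -/
lemma hasFDerivAt_continuousMap_comp {F : E → E'} (hF : ContDiff ℝ 1 F) (γ : C(K, E)) :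
    HasFDerivAt (fun γ : C(K, E) => (⟨F, hF.continuous⟩ : C(E, E')).comp γ)
      (pointwiseApply K E E'
        ((⟨fun z => NormedHom.of (fderiv ℝ F z),
          NormedHom.of.continuous.comp (hF.continuous_fderiv (by simp))⟩ :
            C(E, NormedHom E E')).comp γ)) γ := by
  set dF : C(E, NormedHom E E') := ⟨fun z => NormedHom.of (fderiv ℝ F z),
          NormedHom.of.continuous.comp (hF.continuous_fderiv (by simp))⟩
  rw [hasFDerivAt_iff_isLittleO_nhds_zero, Asymptotics.isLittleO_iff]
  intro ε hε
  have hc : ContinuousAt (fun γ : C(K, E) => dF.comp γ) γ :=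
    (ContinuousMap.continuous_postcomp dF).continuousAt
  obtain ⟨δ, hδ, h⟩ := Metric.continuousAt_iff.1 hc ε hε
  filter_upwards [Metric.ball_mem_nhds 0 hδ] with k hk
  refine (ContinuousMap.norm_le _ (by positivity)).2 fun t => ?_
  have hk' : ‖k t‖ < δ := (k.norm_coe_le_norm t).trans_lt (by simpa using hk)
  have h1 : ∀ z ∈ Metric.ball (γ t) δ, ‖fderiv ℝ F z - fderiv ℝ F (γ t)‖ ≤ ε := by
    intro z hz
    -- Translating γ by the constant `z - γ t` gives a nearby map through `z` at `t`, which turns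
    -- the sup-norm estimate into one at the point `z`.
    have h2 : dist (γ + ContinuousMap.const K (z - γ t)) γ < δ := by
      rw [dist_eq_norm, add_sub_cancel_left]
      refine ((ContinuousMap.norm_le _ (norm_nonneg (z - γ t))).2 fun s => le_rfl).trans_lt ?_
      rwa [← dist_eq_norm]
    have h3 := (ContinuousMap.dist_le hε.le).1 (h h2).le t
    rw [dist_eq_norm] at h3
    rw [← NormedHom.norm_hom, map_sub] at h3
    simpa [dF] using h3
  have h4 := (convex_ball (γ t) δ).norm_image_sub_le_of_norm_hasFDerivWithin_le'
    (fun z hz => ((hF.differentiable (by simp)) z).hasFDerivAt.hasFDerivWithinAt) h1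
    (Metric.mem_ball_self hδ) (y := γ t + k t) (by simpa [dist_eq_norm] using hk')
  simp only [add_sub_cancel_left] at h4
  exact h4.trans (mul_le_mul_of_nonneg_left (k.norm_coe_le_norm t) hε.le)

/-- The derivative is the superposition operator of DF followed by the continuous linear map
`pointwiseApply`, so the order goes up by induction. The target space is quantified inside because
DF takes values in a space of linear maps. -/
lemma contDiff_continuousMap_comp_nat (n : ℕ) : ∀ {E' : Type} [NormedAddCommGroup E']
    [NormedSpace ℝ E'] {F : E → E'} (hF : ContDiff ℝ ∞ F),
    ContDiff ℝ n (fun γ : C(K, E) => (⟨F, hF.continuous⟩ : C(E, E')).comp γ) := by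
  induction n with
  | zero =>
    intro E' _ _ F hF
    exact contDiff_zero.2 (ContinuousMap.continuous_postcomp _)
  | succ n ih =>
    intro E' _ _ F hF
    have hF1 : ContDiff ℝ 1 F := hF.of_le (by simp)
    have hd : ContDiff ℝ ∞ (fun z => NormedHom.of (fderiv ℝ F z)) :=
      NormedHom.of.contDiff.comp (hF.fderiv_right (by simp))
    refine contDiff_succ_iff_hasFDerivAt.2 ⟨_, ?_, fun γ => hasFDerivAt_continuousMap_comp hF1 γ⟩
    exact (pointwiseApply K E E').contDiff.comp (ih hd)

lemma contDiff_continuousMap_comp {F : E → E'} (hF : ContDiff ℝ ∞ F) :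
    ContDiff ℝ ∞ (fun γ : C(K, E) => (⟨F, hF.continuous⟩ : C(E, E')).comp γ) :=
  contDiff_infty.2 fun n => contDiff_continuousMap_comp_nat n hF

end Nemytskii

/-! ### The equation along rays, written as an equation in a Banach space of curves. -/

section Frobenius

open unitInterval

variable {W Z : Type} [NormedAddCommGroup W] [NormedSpace ℝ W]
  [NormedAddCommGroup Z] [NormedSpace ℝ Z] [CompleteSpace Z]

/-- Integration of continuous curves from `0`. -/
def primitiveCLM (Z : Type) [NormedAddCommGroup Z] [NormedSpace ℝ Z] [CompleteSpace Z] :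
    C(I, Z) →L[ℝ] C(I, Z) :=
  LinearMap.mkContinuous
    -- The projection to `[0,1]` extends γ to the real line by its end values, which makes the
    -- integrand continuous everywhere.
    { toFun := fun γ => ⟨fun t => ∫ s in (0 : ℝ)..t, γ (projIcc 0 1 zero_le_one s), by
        have : Continuous fun t : ℝ => ∫ s in (0 : ℝ)..t, γ (projIcc 0 1 zero_le_one s) :=
          intervalIntegral.continuous_primitive
            (fun a b => Continuous.intervalIntegrable (by fun_prop) _ _) 0
        exact this.comp continuous_subtype_val⟩
      map_add' := fun γ γ' => by
        ext t
        exact intervalIntegral.integral_add (Continuous.intervalIntegrable (by fun_prop) _ _)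
          (Continuous.intervalIntegrable (by fun_prop) _ _)
      map_smul' := fun a γ => by
        ext t
        exact intervalIntegral.integral_smul _ _ } 1 (fun γ => by
      refine (ContinuousMap.norm_le _ (by positivity)).2 fun t => ?_
      have h := intervalIntegral.norm_integral_le_of_norm_le_const (a := (0 : ℝ)) (b := t)
        (f := fun s => γ (projIcc 0 1 zero_le_one s)) (C := ‖γ‖) (fun s _ => γ.norm_coe_le_norm _)
      refine h.trans ?_
      rw [sub_zero, abs_of_nonneg t.2.1, mul_comm]
      exact mul_le_mul_of_nonneg_right t.2.2 (norm_nonneg _))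

/-- The curve `s ↦ (s w, γ s)`. -/
def radialCurve (W Z : Type) [NormedAddCommGroup W] [NormedSpace ℝ W] [NormedAddCommGroup Z]
    [NormedSpace ℝ Z] : W × C(I, Z) →L[ℝ] C(I, W × Z) :=
  LinearMap.mkContinuous
    { toFun := fun p => ⟨fun s => ((s : ℝ) • p.1, p.2 s), by fun_prop⟩
      map_add' := fun p q => by ext <;> simp
      map_smul' := fun a p => by
        ext s
        · exact smul_comm (s : ℝ) a p.1
        · rfl } 1 (fun p => by
      refine (ContinuousMap.norm_le _ (by positivity)).2 fun t => ?_
      rw [one_mul]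
      refine norm_prod_le_iff.2 ⟨?_, ?_⟩
      · change ‖(t : ℝ) • p.1‖ ≤ _
        rw [norm_smul, Real.norm_of_nonneg t.2.1]
        exact (mul_le_of_le_one_left (norm_nonneg _) t.2.2).trans (norm_fst_le p)
      · exact (p.2.norm_coe_le_norm t).trans (norm_snd_le p))

/-- The defect of the equation `γ(t) = c + ∫₀ᵗ F(sw, γ(s)) w ds`. -/
def radialDefect (F : C(W × Z, NormedHom W Z)) (q : (W × Z) × C(I, Z)) : C(I, Z) :=
  q.2 - ContinuousMap.const I q.1.2 - primitiveCLM Z (pointwiseApply I W Z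
    (F.comp (radialCurve W Z (q.1.1, q.2))) (ContinuousMap.const I q.1.1))

/-- Constant maps, as a continuous linear map. -/
def constCLM (Z : Type) [NormedAddCommGroup Z] [NormedSpace ℝ Z] : Z →L[ℝ] C(I, Z) :=
  LinearMap.mkContinuous
    { toFun := fun c => ContinuousMap.const I c
      map_add' := fun _ _ => rfl
      map_smul' := fun _ _ => rfl } 1 (fun c => by
      refine (ContinuousMap.norm_le _ (by positivity)).2 fun t => ?_
      rw [one_mul]
      exact le_rfl)

lemma contDiff_radialDefect {F : W × Z → NormedHom W Z} (hF : ContDiff ℝ ∞ F) :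
    ContDiff ℝ ∞ (radialDefect ⟨F, hF.continuous⟩) := by
  have h1 : ContDiff ℝ ∞ (fun q : (W × Z) × C(I, Z) =>
      (⟨F, hF.continuous⟩ : C(W × Z, NormedHom W Z)).comp (radialCurve W Z (q.1.1, q.2))) :=
    (contDiff_continuousMap_comp hF).comp ((radialCurve W Z).contDiff.comp (by fun_prop))
  have h2 : ContDiff ℝ ∞ (fun q : (W × Z) × C(I, Z) => constCLM W q.1.1) := by fun_prop
  have h3 : ContDiff ℝ ∞ (fun q : (W × Z) × C(I, Z) => constCLM Z q.1.2) := by fun_prop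
  have h4 := (pointwiseApply I W Z).isBoundedBilinearMap.contDiff.comp (h1.prodMk h2)
  exact (contDiff_snd.sub h3).sub ((primitiveCLM Z).contDiff.comp h4)

/-- On the trivial ray w = 0 the integral drops out, so the partial derivative in γ is the identity
and the implicit function theorem applies there without any estimate. -/
lemma radialDefect_zero (F : C(W × Z, NormedHom W Z)) (c : Z) (γ : C(I, Z)) :
    radialDefect F ((0, c), γ) = γ - ContinuousMap.const I c := by
  have : pointwiseApply I W Z (F.comp (radialCurve W Z (0, γ))) (ContinuousMap.const I 0) = 0 := by
    ext t; simp
  rw [radialDefect, this, map_zero, sub_zero]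

end Frobenius

/-! ### A form of the implicit function theorem with smoothness on a neighbourhood. -/

section Implicit

variable {P G : Type} [NormedAddCommGroup P] [NormedSpace ℝ P] [CompleteSpace P]
  [NormedAddCommGroup G] [NormedSpace ℝ G] [CompleteSpace G]

/-- A solution of a smooth implicit equation whose partial derivative is the identity. -/
lemma exists_smooth_implicit {Φ : P × G → G} (hΦ : ContDiff ℝ ∞ Φ) (u : P × G)
    (hu : ∀ γ, Φ (u.1, γ) = γ - u.2) :
    ∃ ψ : P → G, ψ u.1 = u.2 ∧ (∀ᶠ p in 𝓝 u.1, ContDiffAt ℝ ∞ ψ p) ∧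
      (∀ᶠ p in 𝓝 u.1, Φ (p, ψ p) = 0) ∧ ∀ᶠ q in 𝓝 u, Φ q = 0 → ψ q.1 = q.2 := by
  have h0 : Φ u = 0 := by simpa using hu u.2
  have hinv : fderiv ℝ Φ u ∘L .inr ℝ P G = ContinuousLinearMap.id ℝ G := by
    have h1 : HasFDerivAt (fun γ : G => Φ (u.1, γ)) (fderiv ℝ Φ u ∘L .inr ℝ P G) u.2 :=
      ((hΦ.differentiable (by simp)) u).hasFDerivAt.comp u.2 (hasFDerivAt_prodMk_right u.1 u.2)
    refine h1.unique ?_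
    simp only [hu]
    exact (hasFDerivAt_id u.2).sub_const u.2
  have hopen : ∀ᶠ q in 𝓝 u, (fderiv ℝ Φ q ∘L .inr ℝ P G).IsInvertible := by
    have hc : ContinuousAt (fun q => fderiv ℝ Φ q ∘L .inr ℝ P G) u :=
      ((hΦ.continuous_fderiv (by simp)).clm_comp continuous_const).continuousAt
    refine hc.eventually (p := fun A => A.IsInvertible) ?_
    simp only [hinv]
    exact (ContinuousLinearEquiv.refl ℝ G).nhds
  have h1 := hopen.self_of_nhds
  have hn : (∞ : ℕ∞ω) ≠ 0 := by simp
  set ψ := (hΦ.contDiffAt (x := u)).implicitFunction hn h1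
  have hψu : ψ u.1 = u.2 := ContDiffAt.implicitFunction_apply_self _ hn h1
  have hψs : ContDiffAt ℝ ∞ ψ u.1 := ContDiffAt.contDiffAt_implicitFunction _ hn h1
  have hψ0 : ∀ᶠ p in 𝓝 u.1, Φ (p, ψ p) = 0 := by
    filter_upwards [ContDiffAt.eventually_apply_implicitFunction (hΦ.contDiffAt (x := u)) hn h1]
      with p hp using hp.trans h0
  have hψ1 : ∀ᶠ p in 𝓝 u.1, ContinuousAt ψ p := by
    filter_upwards [(hψs.of_le (m := ((1 : ℕ) : ℕ∞ω)) (by exact_mod_cast le_top)).eventually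
      (by simp)] with p hp using hp.continuousAt
  refine ⟨ψ, hψu, ?_, hψ0, ?_⟩
  -- `ContDiffAt ℝ ∞` at `u.1` provides a neighbourhood for each finite order, possibly shrinking
  -- with the order. Smoothness at a nearby `p` is therefore obtained afresh: the implicit function
  -- based at `(p, ψ p)` agrees with ψ near `p`.
  · have hpair : ContinuousAt (fun p => (p, ψ p)) u.1 :=
      continuousAt_id.prodMk hψs.continuousAt
    have hopen' : ∀ᶠ p in 𝓝 u.1, (fderiv ℝ Φ (p, ψ p) ∘L .inr ℝ P G).IsInvertible := by
      refine hpair.eventually (p := fun q => (fderiv ℝ Φ q ∘L .inr ℝ P G).IsInvertible) ?_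
      simpa only [hψu] using hopen
    filter_upwards [hopen', hψ0.eventually_nhds, hψ1] with p hp h2 h3
    refine (ContDiffAt.contDiffAt_implicitFunction
      (hΦ.contDiffAt (x := (p, ψ p))) hn hp).congr_of_eventuallyEq ?_
    have h4 := ContDiffAt.eventually_apply_eq_iff_implicitFunction
      (hΦ.contDiffAt (x := (p, ψ p))) hn hp
    have hpair' : ContinuousAt (fun p => (p, ψ p)) p := continuousAt_id.prodMk h3
    filter_upwards [hpair'.eventually h4, h2] with p' h5 h6
    exact (h5.1 (h6.trans h2.self_of_nhds.symm)).symm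
  · filter_upwards [ContDiffAt.eventually_apply_eq_iff_implicitFunction
      (hΦ.contDiffAt (x := u)) hn h1] with q hq h2
    exact hq.1 (h2.trans h0.symm)

end Implicit

/-! ### The Frobenius theorem for globally smooth right-hand sides. -/

section Frobenius

open unitInterval

variable {W Z : Type} [NormedAddCommGroup W] [NormedSpace ℝ W] [CompleteSpace W]
  [NormedAddCommGroup Z] [NormedSpace ℝ Z] [CompleteSpace Z]

omit [CompleteSpace W] [NormedSpace ℝ Z] [CompleteSpace Z] in
lemma eventually_forall_radial {Q : W × Z → Prop} {c₀ : Z} (h : ∀ᶠ p in 𝓝 ((0 : W), c₀), Q p) :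
    ∀ᶠ p in 𝓝 ((0 : W), c₀), ∀ t ∈ Icc (0 : ℝ) 1, Q (t • p.1, p.2) := by
  rw [Metric.eventually_nhds_iff_ball] at h ⊢
  obtain ⟨ε, hε, h⟩ := h
  refine ⟨ε, hε, fun p hp t ht => h _ ?_⟩
  rw [Metric.mem_ball, Prod.dist_eq] at hp ⊢
  refine lt_of_le_of_lt (max_le_max ?_ le_rfl) hp
  rw [dist_zero_right, dist_zero_right, norm_smul, Real.norm_of_nonneg ht.1]
  exact mul_le_of_le_one_left (norm_nonneg _) ht.2

omit [CompleteSpace W] in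
lemma radialDefect_eq_zero_iff (F : C(W × Z, NormedHom W Z)) (w : W) (c : Z) (γ : C(I, Z)) :
    radialDefect F ((w, c), γ) = 0 ↔ ∀ t : I, γ t = c + ∫ s in (0 : ℝ)..t,
      NormedHom.hom (F ((projIcc 0 1 zero_le_one s : ℝ) • w, γ (projIcc 0 1 zero_le_one s))) w := by
  constructor
  · intro h t
    have h1 : γ t - c - ∫ s in (0 : ℝ)..t,
      NormedHom.hom (F ((projIcc 0 1 zero_le_one s : ℝ) • w, γ (projIcc 0 1 zero_le_one s))) w = 0 :=
      congrArg (fun δ : C(I, Z) => δ t) h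
    rw [sub_sub, sub_eq_zero] at h1
    exact h1
  · intro h
    ext t
    change γ t - c - ∫ s in (0 : ℝ)..t,
      NormedHom.hom (F ((projIcc 0 1 zero_le_one s : ℝ) • w, γ (projIcc 0 1 zero_le_one s))) w = 0
    rw [sub_sub, sub_eq_zero]
    exact h t

/-- The radial solution `f` of the total differential equation `∂_w f = F(w, f)`. -/
lemma exists_radial_solution {F : W × Z → W →L[ℝ] Z} (hF : ContDiff ℝ ∞ F) (c₀ : Z) :
    ∃ f : W × Z → Z, (∀ᶠ p in 𝓝 ((0 : W), c₀), ContDiffAt ℝ ∞ f p) ∧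
      (∀ᶠ p in 𝓝 ((0 : W), c₀), f (0, p.2) = p.2) ∧
      ∀ᶠ p in 𝓝 ((0 : W), c₀), fderiv ℝ f p (p.1, 0) = F (p.1, f p) p.1 := by
  set F' : C(W × Z, NormedHom W Z) :=
    ⟨fun z => NormedHom.of (F z), NormedHom.of.continuous.comp hF.continuous⟩
  have hF' : ContDiff ℝ ∞ (fun z => NormedHom.of (F z)) := by
    have h := (NormedHom.of (E := W) (E' := Z)).contDiff (n := ∞)
    exact h.comp hF
  obtain ⟨ψ, hψ0, hψs, hψ, hψu⟩ := exists_smooth_implicit (contDiff_radialDefect hF')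
    (((0 : W), c₀), ContinuousMap.const I c₀) (fun γ => radialDefect_zero F' c₀ γ)
  have heval : ContDiff ℝ ∞ (fun γ : C(I, Z) => γ 1) :=
    (ContinuousMap.evalCLM ℝ (1 : I) : C(I, Z) →L[ℝ] Z).contDiff
  have hs : ∀ᶠ p in 𝓝 ((0 : W), c₀), ContDiffAt ℝ ∞ (fun p => ψ p 1) p := by
    filter_upwards [hψs] with p hp using heval.contDiffAt.comp p hp
  have hψc : ContinuousAt ψ ((0 : W), c₀) := hψs.self_of_nhds.continuousAt
  -- `f (τ w, c)` is the value at `τ` of the curve of `(w, c)`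
  have hscale : ∀ᶠ p in 𝓝 ((0 : W), c₀), ∀ τ : I, ψ ((τ : ℝ) • p.1, p.2) 1 = ψ p τ := by
    obtain ⟨ε, hε, hu⟩ := Metric.eventually_nhds_iff_ball.1 hψu
    have h1 : ∀ᶠ p in 𝓝 ((0 : W), c₀), dist (ψ p) (ContinuousMap.const I c₀) < ε := by
      have := hψc.eventually (Metric.ball_mem_nhds _ hε)
      rwa [hψ0] at this
    filter_upwards [h1, hψ, eventually_forall_radial (Metric.ball_mem_nhds _ hε)]
      with p h1 h2 h3 τ
    -- Reparametrizing the curve of `(w, c)` by s ↦ τs solves the equation of `(τw, c)`. Being close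
    -- to the constant curve at `c₀`, it is the curve selected by ψ, by local uniqueness.
    set γ : C(I, Z) := (ψ p).comp ⟨fun s => τ * s, by fun_prop⟩
    have h4 : ψ ((τ : ℝ) • p.1, p.2) = γ := by
      refine hu (((τ : ℝ) • p.1, p.2), γ) ?_ ?_
      · rw [Metric.mem_ball, Prod.dist_eq]
        refine max_lt (h3 τ τ.2) ((ContinuousMap.dist_lt_iff hε).2 fun s => ?_)
        exact (ContinuousMap.dist_lt_iff hε).1 h1 (τ * s)
      · have h5 := (radialDefect_eq_zero_iff F' p.1 p.2 (ψ p)).1 h2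
        refine (radialDefect_eq_zero_iff F' _ _ γ).2 fun t => ?_
        change ψ p (τ * t) = _
        rw [h5 (τ * t)]
        congr 1
        have h6 := intervalIntegral.smul_integral_comp_mul_left (a := 0) (b := (t : ℝ))
          (fun s : ℝ => NormedHom.hom (F' ((projIcc 0 1 zero_le_one s : ℝ) • p.1,
            ψ p (projIcc 0 1 zero_le_one s))) p.1) (τ : ℝ)
        rw [mul_zero] at h6
        refine h6.symm.trans ?_
        rw [← intervalIntegral.integral_smul]
        refine intervalIntegral.integral_congr fun s hs => ?_
        rw [uIcc_of_le t.2.1] at hs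
        have hs' : s ∈ Icc (0 : ℝ) 1 := ⟨hs.1, hs.2.trans t.2.2⟩
        have hp1 : projIcc (0 : ℝ) 1 zero_le_one s = ⟨s, hs'⟩ := projIcc_of_mem _ hs'
        have hp2 : projIcc (0 : ℝ) 1 zero_le_one (τ * s) = τ * ⟨s, hs'⟩ :=
          projIcc_of_mem zero_le_one (τ * (⟨s, hs'⟩ : I)).2
        simp only [hp1, hp2]
        rw [map_smul, smul_smul, mul_comm s]
        rfl
    rw [h4]
    change ψ p (τ * 1) = _
    rw [mul_one]
  refine ⟨fun p => ψ p 1, hs, ?_, ?_⟩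
  · have hc : ContinuousAt (fun p : W × Z => ((0 : W), p.2)) ((0 : W), c₀) := by fun_prop
    filter_upwards [hc.eventually hψ] with p hp
    rw [(radialDefect_eq_zero_iff F' _ _ _).1 hp 1]
    simp
  · filter_upwards [hs, hscale, hψ] with p h1 h2 h3
    have h5 := (radialDefect_eq_zero_iff F' p.1 p.2 (ψ p)).1 h3
    have hd1 : HasDerivAt (fun t : ℝ => ψ (t • p.1, p.2) 1)
        (fderiv ℝ (fun p => ψ p 1) p (p.1, 0)) 1 := by
      have hl : HasDerivAt (fun t : ℝ => (t • p.1, p.2)) (p.1, (0 : Z)) 1 := by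
        simpa using ((hasDerivAt_id (1 : ℝ)).smul_const p.1).prodMk (hasDerivAt_const (1 : ℝ) p.2)
      have hf : HasFDerivAt (fun p => ψ p 1) (fderiv ℝ (fun p => ψ p 1) p)
          ((1 : ℝ) • p.1, p.2) := by
        simpa using (h1.differentiableAt (by simp)).hasFDerivAt
      exact hf.comp_hasDerivAt (1 : ℝ) hl
    have hcont : Continuous fun s : ℝ => F ((projIcc (0 : ℝ) 1 zero_le_one s : ℝ) • p.1,
        ψ p (projIcc 0 1 zero_le_one s)) p.1 := by
      have := hF.continuous
      fun_prop
    -- The integral equation is known only on `[0,1]`, so at the endpoint 1 the derivatives are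
    -- compared within that interval.
    have hd2 := ((hcont.integral_hasStrictDerivAt 0 1).hasDerivAt.const_add p.2).hasDerivWithinAt
      (s := Icc 0 1)
    have hd3 : HasDerivWithinAt (fun t : ℝ => ψ (t • p.1, p.2) 1)
        (F ((projIcc (0 : ℝ) 1 zero_le_one 1 : ℝ) • p.1, ψ p (projIcc 0 1 zero_le_one 1)) p.1)
        (Icc 0 1) 1 := by
      refine hd2.congr (fun t ht => ?_) ?_
      · exact (h2 ⟨t, ht⟩).trans (h5 ⟨t, ht⟩)
      · exact (h2 1).trans (h5 1)
    have h6 := (uniqueDiffOn_Icc zero_lt_one (1 : ℝ) (by simp)).eq_deriv _ hd1.hasDerivWithinAt hd3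
    rw [h6, projIcc_right]
    simp

/-- The Frobenius theorem for total differential equations `∂_w f = F(w, f)`. -/
theorem exists_frobenius_of_contDiff {F : W × Z → W →L[ℝ] Z} (hF : ContDiff ℝ ∞ F) (c₀ : Z)
    (hint : ∀ᶠ p in 𝓝 ((0 : W), c₀), ∀ ξ η,
      fderiv ℝ F p (ξ, F p ξ) η = fderiv ℝ F p (η, F p η) ξ) :
    ∃ f : W × Z → Z, (∀ᶠ p in 𝓝 ((0 : W), c₀), ContDiffAt ℝ ∞ f p) ∧
      (∀ᶠ p in 𝓝 ((0 : W), c₀), f (0, p.2) = p.2) ∧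
      ∀ᶠ p in 𝓝 ((0 : W), c₀), ∀ η, fderiv ℝ f p (η, 0) = F (p.1, f p) η := by
  obtain ⟨f, hs, h0, hr⟩ := exists_radial_solution hF c₀
  refine ⟨f, hs, h0, ?_⟩
  set h : W × Z → W × Z := fun p => (p.1, f p)
  have hh0 : h (0, c₀) = (0, c₀) := Prod.ext rfl h0.self_of_nhds
  have hhc : ContinuousAt h (0, c₀) := continuousAt_fst.prodMk hs.self_of_nhds.continuousAt
  have hint' : ∀ᶠ p in 𝓝 ((0 : W), c₀), ∀ ξ η,
      fderiv ℝ F (h p) (ξ, F (h p) ξ) η = fderiv ℝ F (h p) (η, F (h p) η) ξ := by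
    rw [← hh0] at hint
    exact hhc.eventually hint
  have hbd : ∀ᶠ p in 𝓝 ((0 : W), c₀), ‖fderiv ℝ F (h p)‖ ≤ ‖fderiv ℝ F (0, c₀)‖ + 1 := by
    have : ContinuousAt (fun p => ‖fderiv ℝ F (h p)‖) (0, c₀) :=
      ((hF.continuous_fderiv (by simp)).continuousAt.comp hhc).norm
    filter_upwards [this.eventually (gt_mem_nhds
      (show ‖fderiv ℝ F (h (0, c₀))‖ < ‖fderiv ℝ F (0, c₀)‖ + 1 by
      rw [hh0]; linarith))] with p hp using hp.le
  filter_upwards [eventually_forall_radial (hs.and (hr.eventually_nhds.and (hint'.and hbd)))]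
    with p hp η
  obtain ⟨w, c⟩ := p
  -- `Q` is the failure of the equation in the direction η. The function t ↦ t Q(tw, c) will satisfy
  -- a linear differential equation and it vanishes at t = 0.
  set Q : W × Z → Z := fun p => fderiv ℝ f p (η, 0) - F (h p) η with hQ
  set K := (‖fderiv ℝ F (0, c₀)‖ + 1) * ‖w‖
  -- derivatives of the solution along the segment
  have hd : ∀ t ∈ Icc (0 : ℝ) 1, ∃ Q' : W × Z →L[ℝ] Z, HasFDerivAt Q Q' (t • w, c) ∧
      Q (t • w, c) + t • Q' (w, 0) = fderiv ℝ F (h (t • w, c)) (0, t • Q (t • w, c)) w := by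
    intro t ht
    obtain ⟨h1, h2, h3, -⟩ := hp t ht
    simp only at h1 h2 h3
    set z : W × Z := (t • w, c)
    set A := fderiv ℝ F (h z)
    have hf : HasFDerivAt f (fderiv ℝ f z) z := (h1.differentiableAt (by simp)).hasFDerivAt
    have hf2 : HasFDerivAt (fderiv ℝ f) (fderiv ℝ (fderiv ℝ f) z) z :=
      ((h1.fderiv_right (m := 1)
        (by rw [one_add_one_eq_two]; exact two_le_infty)).differentiableAt (by simp)).hasFDerivAt
    have hsymm := (h1.of_le two_le_infty).isSymmSndFDerivAt (by simp)
    have hh : HasFDerivAt h ((ContinuousLinearMap.fst ℝ W Z).prod (fderiv ℝ f z)) z :=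
      hasFDerivAt_fst.prodMk hf
    have hFh : HasFDerivAt (fun p => F (h p))
        (A ∘L (ContinuousLinearMap.fst ℝ W Z).prod (fderiv ℝ f z)) z :=
      ((hF.differentiable (by simp)) (h z)).hasFDerivAt.comp z hh
    refine ⟨_, (hf2.clm_apply (hasFDerivAt_const (η, (0 : Z)) z)).sub
      (hFh.clm_apply (hasFDerivAt_const η z)), ?_⟩
    -- The equation in the radial direction holds near `z`; differentiating it in the direction η
    -- relates `Q` to its radial derivative.
    have hrad : (fun p : W × Z => fderiv ℝ f p (p.1, 0) - F (h p) p.1) =ᶠ[𝓝 z] fun _ => 0 := by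
      filter_upwards [h2] with p hp using sub_eq_zero.2 hp
    have hl : HasFDerivAt (fun p : W × Z => (p.1, (0 : Z)))
        ((ContinuousLinearMap.fst ℝ W Z).prod 0) z := hasFDerivAt_fst.prodMk (hasFDerivAt_const _ _)
    have hd1 :=
      ((hf2.clm_apply hl).sub (hFh.clm_apply hasFDerivAt_fst)).congr_of_eventuallyEq hrad.symm
    have hd2 := congrArg (fun L : W × Z →L[ℝ] Z => L (η, 0))
      (hd1.unique (hasFDerivAt_const (0 : Z) z))
    have hrz : fderiv ℝ f z (t • w, 0) = F (h z) (t • w) := h2.self_of_nhds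
    have hQz : fderiv ℝ f z (η, 0) = F (h z) η + Q z := by simp [hQ]
    -- Integrability exchanges η with the radial direction in the derivative of F, and the symmetry
    -- of the second derivative does the same for f.
    have hz := h3 η (t • w)
    have hs1 := hsymm (t • w, 0) (η, 0)
    have e1 : ∀ L : W × Z →L[ℝ] Z, t • L (w, 0) = L (t • w, 0) := fun L => by
      rw [← map_smul, Prod.smul_mk, smul_zero]
    rw [e1]
    have ez : z.1 = t • w := rfl
    have e2 : A (η, F (h z) η + Q z) = A (η, F (h z) η) + A (0, Q z) := by
      rw [← map_add, Prod.mk_add_mk, add_zero]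
    have e3 : A (0, t • Q z) = t • A (0, Q z) := by
      rw [← map_smul, Prod.smul_mk, smul_zero]
    simp [ez] at hd2 ⊢
    rw [hs1, hrz, ← hz, e3, map_smul, smul_apply]
    rw [hQz, e2, add_apply, smul_add] at hd2
    linear_combination (norm := module) hd2
  have hR : ∀ t ∈ Icc (0 : ℝ) 1, t • Q (t • w, c) = 0 := by
    choose! Q' hQ' hQe using hd
    have hder : ∀ t ∈ Icc (0 : ℝ) 1, HasDerivAt (fun t : ℝ => t • Q (t • w, c))
        (fderiv ℝ F (h (t • w, c)) (0, t • Q (t • w, c)) w) t := by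
      intro t ht
      have hl : HasDerivAt (fun t : ℝ => (t • w, c)) (w, (0 : Z)) t := by
        simpa using ((hasDerivAt_id t).smul_const w).prodMk (hasDerivAt_const t c)
      have := (hasDerivAt_id t).smul ((hQ' t ht).comp_hasDerivAt t hl)
      rw [← hQe t ht]
      convert this using 1
      · rfl
      · rw [one_smul, add_comm]; rfl
    -- Grönwall: a function vanishing at 0 whose derivative is bounded by `K` times its own norm is
    -- zero.
    refine eq_zero_of_abs_deriv_le_mul_abs_self_of_eq_zero_right (K := K)
      (fun t ht => (hder t ht).continuousAt.continuousWithinAt)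
      (fun t ht => (hder t (Ico_subset_Icc_self ht)).hasDerivWithinAt) (by simp) ?_
    intro t ht
    refine (ContinuousLinearMap.le_opNorm _ _).trans ?_
    have h1 := (hp t (Ico_subset_Icc_self ht)).2.2.2
    have h2 := (fderiv ℝ F (h (t • w, c))).le_opNorm (0, t • Q (t • w, c))
    have h3 : ‖((0 : W), t • Q (t • w, c))‖ = ‖t • Q (t • w, c)‖ := by
      rw [Prod.norm_def]; simp
    rw [h3] at h2
    calc _ ≤ ((‖fderiv ℝ F (0, c₀)‖ + 1) * ‖t • Q (t • w, c)‖) * ‖w‖ := by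
          gcongr
          exact h2.trans (by gcongr)
      _ = _ := by ring
  have := hR 1 (by simp)
  simp only [one_smul] at this
  exact sub_eq_zero.1 this

end Frobenius

/-! ### The Frobenius theorem for germs, by cutting off the right-hand side. -/

section LocalFrobenius

/-- A germ of a smooth map is the germ of a globally smooth map. -/
lemma exists_contDiff_eventuallyEq {E V : Type} [NormedAddCommGroup E] [NormedSpace ℝ E]
    [FiniteDimensional ℝ E] [NormedAddCommGroup V] [NormedSpace ℝ V] {F : E → V} {z : E}
    (hF : ∀ᶠ p in 𝓝 z, ContDiffAt ℝ ∞ F p) : ∃ G : E → V, ContDiff ℝ ∞ G ∧ G =ᶠ[𝓝 z] F := by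
  obtain ⟨r, hr, hball⟩ := Metric.eventually_nhds_iff_ball.1 hF
  let χ : ContDiffBump z := ⟨r / 4, r / 2, by positivity, by linarith⟩
  refine ⟨fun p => χ p • F p, contDiff_iff_contDiffAt.2 fun p => ?_, ?_⟩
  · by_cases hp : p ∈ Metric.ball z r
    · exact χ.contDiff.contDiffAt.smul (hball p hp)
    · have hz : p ∉ tsupport χ := by
        rw [χ.tsupport_eq]
        intro h
        have h1 : dist p z ≤ r / 2 := h
        exact hp (lt_of_le_of_lt h1 (by linarith))
      refine (contDiffAt_const (c := (0 : V))).congr_of_eventuallyEq ?_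
      filter_upwards [notMem_tsupport_iff_eventuallyEq.1 hz] with q hq
      simp only [hq]
      simp
  · filter_upwards [χ.eventuallyEq_one] with p hp
    simp [hp]

variable {W Z : Type} [NormedAddCommGroup W] [NormedSpace ℝ W] [FiniteDimensional ℝ W]
  [NormedAddCommGroup Z] [NormedSpace ℝ Z] [FiniteDimensional ℝ Z]

/-- The local Frobenius theorem for total differential equations `∂_w f = F(w, f)`. -/
theorem exists_frobenius {F : W × Z → W →L[ℝ] Z} (c₀ : Z)
    (hF : ∀ᶠ p in 𝓝 ((0 : W), c₀), ContDiffAt ℝ ∞ F p)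
    (hint : ∀ᶠ p in 𝓝 ((0 : W), c₀), ∀ ξ η,
      fderiv ℝ F p (ξ, F p ξ) η = fderiv ℝ F p (η, F p η) ξ) :
    ∃ f : W × Z → Z, (∀ᶠ p in 𝓝 ((0 : W), c₀), ContDiffAt ℝ ∞ f p) ∧
      (∀ᶠ p in 𝓝 ((0 : W), c₀), f (0, p.2) = p.2) ∧
      ∀ᶠ p in 𝓝 ((0 : W), c₀), ∀ η, fderiv ℝ f p (η, 0) = F (p.1, f p) η := by
  have := FiniteDimensional.complete ℝ W
  have := FiniteDimensional.complete ℝ Z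
  obtain ⟨G, hG, hGF⟩ := exists_contDiff_eventuallyEq hF
  obtain ⟨f, hs, h0, hf⟩ := exists_frobenius_of_contDiff hG c₀ (by
    filter_upwards [hint, hGF.eventually_nhds] with p hp h1 ξ η
    have h2 : G p = F p := h1.self_of_nhds
    rw [Filter.EventuallyEq.fderiv_eq h1, h2]
    exact hp ξ η)
  refine ⟨f, hs, h0, ?_⟩
  have hc : ContinuousAt (fun p : W × Z => (p.1, f p)) (0, c₀) :=
    continuousAt_fst.prodMk hs.self_of_nhds.continuousAt
  have h1 : (fun p : W × Z => (p.1, f p)) (0, c₀) = (0, c₀) := Prod.ext rfl h0.self_of_nhds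
  have h2 : ∀ᶠ p in 𝓝 ((0 : W), c₀), G (p.1, f p) = F (p.1, f p) := by
    refine hc.eventually (p := fun p => G p = F p) ?_
    rw [h1]
    exact hGF
  filter_upwards [hf, h2] with p h3 h4 η
  rw [h3, h4]

end LocalFrobenius

/-! ### Leaves, leafwise primitives and local diffeomorphisms in three variables. -/

section Space

/-- The splitting `(z₀, z₁, z₂) ↦ ((z₀, z₁), z₂)` of the model space. -/
def splitE3 : E3 →L[ℝ] (ℝ × ℝ) × ℝ :=
  ((EuclideanSpace.proj 0).prod (EuclideanSpace.proj 1)).prod (EuclideanSpace.proj 2)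

/-- The inverse of `splitE3`. -/
def unsplitE3 : (ℝ × ℝ) × ℝ →L[ℝ] E3 :=
  LinearMap.toContinuousLinearMap
    { toFun := fun p => !₂[p.1.1, p.1.2, p.2]
      map_add' := fun p q => by ext i; fin_cases i <;> simp
      map_smul' := fun a p => by ext i; fin_cases i <;> simp }

lemma splitE3_apply (z : E3) : splitE3 z = ((z 0, z 1), z 2) := rfl

lemma unsplitE3_apply (p : (ℝ × ℝ) × ℝ) : unsplitE3 p = !₂[p.1.1, p.1.2, p.2] := rfl

@[simp] lemma splitE3_unsplitE3 (p : (ℝ × ℝ) × ℝ) : splitE3 (unsplitE3 p) = p := by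
  simp [splitE3_apply, unsplitE3_apply]

lemma unsplitE3_zero_one : unsplitE3 ((1, 0), 0) = stdVec 0 := by
  ext i; fin_cases i <;> simp [unsplitE3_apply, stdVec]

lemma unsplitE3_one_zero : unsplitE3 ((0, 1), 0) = stdVec 1 := by
  ext i; fin_cases i <;> simp [unsplitE3_apply, stdVec]

lemma unsplitE3_two : unsplitE3 ((0, 0), 1) = stdVec 2 := by
  ext i; fin_cases i <;> simp [unsplitE3_apply, stdVec]

lemma unsplitE3_eq (a b c : ℝ) :
    unsplitE3 ((a, b), c) = a • stdVec 0 + b • stdVec 1 + c • stdVec 2 := by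
  ext i; fin_cases i <;> simp [unsplitE3_apply, stdVec]

/-- The leaves `z₂ = f` of an integrable plane field `dz₂ = α₀ dz₀ + α₁ dz₁`. -/
theorem exists_leaf_function {α₀ α₁ : E3 → ℝ} (z₀ : E3)
    (h₀ : ∀ᶠ z in 𝓝 z₀, ContDiffAt ℝ ∞ α₀ z) (h₁ : ∀ᶠ z in 𝓝 z₀, ContDiffAt ℝ ∞ α₁ z)
    (hint : ∀ᶠ z in 𝓝 z₀, pd 0 α₁ z + α₀ z * pd 2 α₁ z = pd 1 α₀ z + α₁ z * pd 2 α₀ z) :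
    ∃ f : E3 → ℝ, (∀ᶠ z in 𝓝 z₀, ContDiffAt ℝ ∞ f z) ∧ f z₀ = z₀ 2 ∧ pd 2 f z₀ = 1 ∧
      ∀ᶠ z in 𝓝 z₀, pd 0 f z = α₀ !₂[z 0, z 1, f z] ∧ pd 1 f z = α₁ !₂[z 0, z 1, f z] := by
  -- the translated problem
  set L : (ℝ × ℝ) × ℝ → E3 := fun p => unsplitE3 (p + ((z₀ 0, z₀ 1), 0)) with hL
  have hLs : ContDiff ℝ ∞ L := unsplitE3.contDiff.comp (contDiff_id.add contDiff_const)
  have hL' : ∀ p, HasFDerivAt L unsplitE3 p := fun p => by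
    have := unsplitE3.hasFDerivAt (x := p + ((z₀ 0, z₀ 1), 0))
    exact this.comp p ((hasFDerivAt_id p).add_const _)
  have hL0 : L ((0, 0), z₀ 2) = z₀ := by
    rw [hL]; ext i; fin_cases i <;> simp [unsplitE3_apply]
  have hLc : Tendsto L (𝓝 ((0, 0), z₀ 2)) (𝓝 z₀) := by
    have := hLs.continuous.tendsto ((0, 0), z₀ 2)
    rwa [hL0] at this
  set F : (ℝ × ℝ) × ℝ → (ℝ × ℝ) →L[ℝ] ℝ := fun p =>
    α₀ (L p) • ContinuousLinearMap.fst ℝ ℝ ℝ + α₁ (L p) • ContinuousLinearMap.snd ℝ ℝ ℝ with hF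
  obtain ⟨f, hs, h0, hf⟩ := exists_frobenius (F := F) (z₀ 2) (by
    filter_upwards [hLc.eventually h₀, hLc.eventually h₁] with p h0 h1
    exact ((h0.comp p hLs.contDiffAt).smul contDiffAt_const).add
      ((h1.comp p hLs.contDiffAt).smul contDiffAt_const)) (by
    filter_upwards [hLc.eventually h₀, hLc.eventually h₁, hLc.eventually hint] with p h0 h1 h2 ξ η
    have d0 : HasFDerivAt (fun p => α₀ (L p)) (fderiv ℝ α₀ (L p) ∘L unsplitE3) p :=
      (h0.differentiableAt (by simp)).hasFDerivAt.comp p (hL' p)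
    have d1 : HasFDerivAt (fun p => α₁ (L p)) (fderiv ℝ α₁ (L p) ∘L unsplitE3) p :=
      (h1.differentiableAt (by simp)).hasFDerivAt.comp p (hL' p)
    have dF := (d0.smul_const (ContinuousLinearMap.fst ℝ ℝ ℝ)).add
      (d1.smul_const (ContinuousLinearMap.snd ℝ ℝ ℝ))
    obtain ⟨ξ0, ξ1⟩ := ξ
    obtain ⟨η0, η1⟩ := η
    rw [show fderiv ℝ F p = _ from dF.fderiv]
    simp only [pd] at h2
    simp [hF, unsplitE3_eq]
    linear_combination (ξ0 * η1 - ξ1 * η0) * h2)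
  set N : E3 → (ℝ × ℝ) × ℝ := fun z => splitE3 z - ((z₀ 0, z₀ 1), 0) with hN
  have hNs : ContDiff ℝ ∞ N := splitE3.contDiff.sub contDiff_const
  have hN' : ∀ z, HasFDerivAt N splitE3 z := fun z => splitE3.hasFDerivAt.sub_const _
  have hN0 : N z₀ = ((0, 0), z₀ 2) := by simp [hN, splitE3_apply]
  have hNc : Tendsto N (𝓝 z₀) (𝓝 ((0, 0), z₀ 2)) := by
    have := hNs.continuous.tendsto z₀
    rwa [hN0] at this
  have hpd : ∀ᶠ z in 𝓝 z₀, ∀ i, pd i (f ∘ N) z = fderiv ℝ f (N z) (splitE3 (stdVec i)) := by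
    filter_upwards [hNc.eventually hs] with z hz i
    rw [pd, ((hz.differentiableAt (by simp)).hasFDerivAt.comp z (hN' z)).fderiv]
    rfl
  refine ⟨f ∘ N, ?_, ?_, ?_, ?_⟩
  · filter_upwards [hNc.eventually hs] with z hz using hz.comp z hNs.contDiffAt
  · rw [Function.comp_apply, hN0]; exact h0.self_of_nhds
  · rw [hpd.self_of_nhds, hN0, ← unsplitE3_two, splitE3_unsplitE3]
    -- At w = 0 the solution equals its initial value. Its derivative in `c` is thus 1, which makes
    -- the label of the leaf usable as a coordinate.
    have h1 : (fun c : ℝ => f ((0, 0), c)) =ᶠ[𝓝 (z₀ 2)] id := by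
      have hc : Tendsto (fun c : ℝ => (((0 : ℝ), (0 : ℝ)), c)) (𝓝 (z₀ 2)) (𝓝 ((0, 0), z₀ 2)) :=
        (Continuous.prodMk_right _).tendsto _
      exact hc.eventually h0
    have h2 : HasFDerivAt (fun c : ℝ => f ((0, 0), c)) _ (z₀ 2) :=
      (hs.self_of_nhds.differentiableAt (by simp)).hasFDerivAt.comp (z₀ 2)
        (hasFDerivAt_prodMk_right _ _)
    have h3 := h2.unique ((hasFDerivAt_id (z₀ 2)).congr_of_eventuallyEq h1)
    exact congrArg (fun A : ℝ →L[ℝ] ℝ => A 1) h3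
  · have hLN : ∀ z, L ((N z).1, f (N z)) = !₂[z 0, z 1, f (N z)] := by
      intro z
      ext i; fin_cases i <;> simp [hL, hN, unsplitE3_apply, splitE3_apply]
    filter_upwards [hpd, hNc.eventually hf] with z h1 h2
    rw [h1, h1, ← unsplitE3_zero_one, ← unsplitE3_one_zero, splitE3_unsplitE3, splitE3_unsplitE3,
      h2, h2, Function.comp_apply, ← hLN]
    simp [hF]

/-- The Poincaré lemma in the first two variables, with the third one as a parameter. -/
theorem exists_parametric_primitive {θ₀ θ₁ : E3 → ℝ} (z₀ : E3)
    (h₀ : ∀ᶠ z in 𝓝 z₀, ContDiffAt ℝ ∞ θ₀ z) (h₁ : ∀ᶠ z in 𝓝 z₀, ContDiffAt ℝ ∞ θ₁ z)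
    (hclosed : ∀ᶠ z in 𝓝 z₀, pd 0 θ₁ z = pd 1 θ₀ z) :
    ∃ y : E3 → ℝ, (∀ᶠ z in 𝓝 z₀, ContDiffAt ℝ ∞ y z) ∧
      ∀ᶠ z in 𝓝 z₀, pd 0 y z = θ₀ z ∧ pd 1 y z = θ₁ z := by
  set L₁ : (ℝ × ℝ) × (ℝ × ℝ) →L[ℝ] E3 := unsplitE3 ∘L
    (ContinuousLinearMap.fst ℝ _ _).prod
      (ContinuousLinearMap.fst ℝ ℝ ℝ ∘L ContinuousLinearMap.snd ℝ _ _) with hL₁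
  set k : E3 := unsplitE3 ((z₀ 0, z₀ 1), 0) with hk
  set L : (ℝ × ℝ) × (ℝ × ℝ) → E3 := fun p => L₁ p + k with hL
  have hLs : ContDiff ℝ ∞ L := L₁.contDiff.add contDiff_const
  have hL' : ∀ p, HasFDerivAt L L₁ p := fun p => L₁.hasFDerivAt.add_const _
  have hL0 : L ((0, 0), (z₀ 2, 0)) = z₀ := by
    rw [hL]; ext i; fin_cases i <;> simp [hL₁, hk, unsplitE3_apply]
  have hLc : Tendsto L (𝓝 ((0, 0), (z₀ 2, 0))) (𝓝 z₀) := by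
    have := hLs.continuous.tendsto ((0, 0), (z₀ 2, 0))
    rwa [hL0] at this
  set A₀ : (ℝ × ℝ) →L[ℝ] (ℝ × ℝ) :=
    ContinuousLinearMap.inr ℝ ℝ ℝ ∘L ContinuousLinearMap.fst ℝ ℝ ℝ with hA₀
  set A₁ : (ℝ × ℝ) →L[ℝ] (ℝ × ℝ) :=
    ContinuousLinearMap.inr ℝ ℝ ℝ ∘L ContinuousLinearMap.snd ℝ ℝ ℝ with hA₁
  -- The unknown is a pair: its first component is the parameter z₂, with zero derivative, and the
  -- second is the primitive. The parameter enters as an initial value, so joint smoothness comes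
  -- from the Frobenius theorem.
  set F : (ℝ × ℝ) × (ℝ × ℝ) → (ℝ × ℝ) →L[ℝ] (ℝ × ℝ) := fun p =>
    θ₀ (L p) • A₀ + θ₁ (L p) • A₁ with hF
  obtain ⟨f, hs, h0, hf⟩ := exists_frobenius (F := F) (z₀ 2, 0) (by
    filter_upwards [hLc.eventually h₀, hLc.eventually h₁] with p h0 h1
    exact ((h0.comp p hLs.contDiffAt).smul contDiffAt_const).add
      ((h1.comp p hLs.contDiffAt).smul contDiffAt_const)) (by
    filter_upwards [hLc.eventually h₀, hLc.eventually h₁, hLc.eventually hclosed]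
      with p h0 h1 h2 ξ η
    have d0 : HasFDerivAt (fun p => θ₀ (L p)) (fderiv ℝ θ₀ (L p) ∘L L₁) p :=
      (h0.differentiableAt (by simp)).hasFDerivAt.comp p (hL' p)
    have d1 : HasFDerivAt (fun p => θ₁ (L p)) (fderiv ℝ θ₁ (L p) ∘L L₁) p :=
      (h1.differentiableAt (by simp)).hasFDerivAt.comp p (hL' p)
    have dF := (d0.smul_const A₀).add (d1.smul_const A₁)
    obtain ⟨ξ0, ξ1⟩ := ξ
    obtain ⟨η0, η1⟩ := η
    rw [show fderiv ℝ F p = _ from dF.fderiv]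
    simp only [pd] at h2
    simp [hF, hL₁, hA₀, hA₁, unsplitE3_eq]
    linear_combination (ξ0 * η1 - ξ1 * η0) * h2)
  set N₁ : E3 →L[ℝ] (ℝ × ℝ) × (ℝ × ℝ) :=
    ((EuclideanSpace.proj 0).prod (EuclideanSpace.proj 1)).prod ((EuclideanSpace.proj 2).prod 0)
    with hN₁
  set N : E3 → (ℝ × ℝ) × (ℝ × ℝ) := fun z => N₁ z - ((z₀ 0, z₀ 1), 0) with hN
  have hNs : ContDiff ℝ ∞ N := N₁.contDiff.sub contDiff_const
  have hN0 : N z₀ = ((0, 0), (z₀ 2, 0)) := by simp [hN, hN₁]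
  have hNc : Tendsto N (𝓝 z₀) (𝓝 ((0, 0), (z₀ 2, 0))) := by
    have := hNs.continuous.tendsto z₀
    rwa [hN0] at this
  -- the first component of the solution is constant along the leaves
  have hfst : ∀ᶠ p in 𝓝 ((0 : ℝ × ℝ), (z₀ 2, (0 : ℝ))), (f p).1 = p.2.1 := by
    filter_upwards [eventually_forall_radial (hs.and hf), h0] with p hp h0
    have hder : ∀ t ∈ Icc (0 : ℝ) 1, HasDerivAt (fun t : ℝ => (f (t • p.1, p.2)).1) 0 t := by
      intro t ht
      obtain ⟨h1, h2⟩ := hp t ht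
      have hl : HasDerivAt (fun t : ℝ => (t • p.1, p.2)) (p.1, (0 : ℝ × ℝ)) t := by
        simpa using ((hasDerivAt_id t).smul_const p.1).prodMk (hasDerivAt_const t p.2)
      have h3 := ((h1.differentiableAt (by simp)).hasFDerivAt.comp_hasDerivAt t hl)
      have h4 := (ContinuousLinearMap.fst ℝ ℝ ℝ).hasFDerivAt.comp_hasDerivAt t h3
      refine h4.congr_deriv ?_
      rw [h2]
      simp [hF, hA₀, hA₁]
    have h3 := constant_of_has_deriv_right_zero
      (fun t ht => (hder t ht).continuousAt.continuousWithinAt)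
      (fun t ht => (hder t (Ico_subset_Icc_self ht)).hasDerivWithinAt) 1 (by simp)
    simp only [one_smul, zero_smul] at h3
    rw [show f p = f (p.1, p.2) from rfl, h3, h0]
  refine ⟨fun z => (f (N z)).2, ?_, ?_⟩
  · filter_upwards [hNc.eventually hs] with z hz using
      contDiff_snd.contDiffAt.comp z (hz.comp z hNs.contDiffAt)
  · filter_upwards [hNc.eventually hs, hNc.eventually hf, hNc.eventually hfst] with z h1 h2 h3
    have hLa : ∀ p, L p = !₂[p.1.1 + z₀ 0, p.1.2 + z₀ 1, p.2.1] := by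
      intro p
      ext i; fin_cases i <;> simp [hL, hL₁, hk, unsplitE3_apply]
    have hL3 : L ((N z).1, f (N z)) = z := by
      rw [hLa, h3]
      ext i; fin_cases i <;> simp [hN, hN₁]
    have hd : HasFDerivAt (fun z => (f (N z)).2)
        (ContinuousLinearMap.snd ℝ ℝ ℝ ∘L (fderiv ℝ f (N z) ∘L N₁)) z :=
      (ContinuousLinearMap.snd ℝ ℝ ℝ).hasFDerivAt.comp z
        ((h1.differentiableAt (by simp)).hasFDerivAt.comp z (N₁.hasFDerivAt.sub_const _))
    have e0 : N₁ (stdVec 0) = ((1, 0), 0) := by simp [hN₁, stdVec]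
    have e1 : N₁ (stdVec 1) = ((0, 1), 0) := by simp [hN₁, stdVec]
    constructor
    · rw [pd, hd.fderiv]
      change (fderiv ℝ f (N z) (N₁ (stdVec 0))).2 = _
      rw [e0, h2]
      simp [hF, hA₀, hA₁, hL3]
    · rw [pd, hd.fderiv]
      change (fderiv ℝ f (N z) (N₁ (stdVec 1))).2 = _
      rw [e1, h2]
      simp [hF, hA₀, hA₁, hL3]

/-- The inverse function theorem on `E3`, in the language of the structure groupoid. -/
theorem exists_localDiffeo {Φ : E3 → E3} {z₀ : E3} (hΦ : ∀ᶠ z in 𝓝 z₀, ContDiffAt ℝ ∞ Φ z)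
    (hinj : Function.Injective (fderiv ℝ Φ z₀)) {s : Set E3} (hs : s ∈ 𝓝 z₀) :
    ∃ e : OpenPartialHomeomorph E3 E3, z₀ ∈ e.source ∧ e.source ⊆ s ∧ (∀ z, e z = Φ z) ∧
      (∃ r > 0, e.target = Metric.ball (Φ z₀) r) ∧ e ∈ contDiffGroupoid ∞ (𝓡 3) := by
  have hΦ0 := hΦ.self_of_nhds
  have hn : (∞ : ℕ∞ω) ≠ 0 := by simp
  set A : E3 ≃L[ℝ] E3 :=
    (LinearEquiv.ofInjectiveEndo (fderiv ℝ Φ z₀ : E3 →ₗ[ℝ] E3) hinj).toContinuousLinearEquiv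
  have hA : (A : E3 →L[ℝ] E3) = fderiv ℝ Φ z₀ := by ext v; rfl
  have hA' : HasFDerivAt Φ (A : E3 →L[ℝ] E3) z₀ := by
    rw [hA]; exact (hΦ0.differentiableAt hn).hasFDerivAt
  set e₀ := hΦ0.toOpenPartialHomeomorph Φ hA' hn
  have he₀ : (e₀ : E3 → E3) = Φ := hΦ0.toOpenPartialHomeomorph_coe hA' hn
  have hz₀ : z₀ ∈ e₀.source := hΦ0.mem_toOpenPartialHomeomorph_source hA' hn
  have hinv : ∀ᶠ z in 𝓝 z₀, (fderiv ℝ Φ z).IsInvertible := by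
    have hc : ContinuousAt (fderiv ℝ Φ) z₀ := (hΦ0.fderiv_right (m := 0) (by simp)).continuousAt
    refine hc.eventually (p := fun B => B.IsInvertible) ?_
    rw [← hA]
    exact A.nhds
  obtain ⟨U, hU, hUo, hz₀U⟩ := eventually_nhds_iff.1
    ((hΦ.and hinv).and ((eventually_mem_set.2 (e₀.open_source.mem_nhds hz₀)).and
      (eventually_mem_set.2 hs)))
  have hV : IsOpen (e₀ '' U) := e₀.isOpen_image_of_subset_source hUo fun z hz => (hU z hz).2.1
  -- The target is cut down to a ball so that moving one coordinate towards that of the centre stays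
  -- inside; `exists_normalForm_chart` needs this to remove a variable.
  obtain ⟨r, hr, hball⟩ := Metric.isOpen_iff.1 hV (Φ z₀) ⟨z₀, hz₀U, by rw [he₀]⟩
  set e := (e₀.symm.restrOpen (Metric.ball (Φ z₀) r) Metric.isOpen_ball).symm
  have hcoe : ∀ z, e z = Φ z := fun z => congrFun he₀ z
  have htarget : e.target = Metric.ball (Φ z₀) r := by
    change e₀.target ∩ Metric.ball (Φ z₀) r = _
    refine inter_eq_self_of_subset_right fun y hy => ?_
    obtain ⟨z, hz, rfl⟩ := hball hy
    exact e₀.map_source (hU z hz).2.1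
  have hsymm : ∀ y, e.symm y = e₀.symm y := fun y => rfl
  have hsU : ∀ z ∈ e.source, z ∈ U := by
    intro z hz
    have h1 := e.map_source hz
    rw [htarget, hcoe] at h1
    obtain ⟨z', hz', h2⟩ := hball h1
    have h3 : e.symm (e z) = z' := by
      rw [hcoe, hsymm, ← h2]; exact e₀.left_inv (hU z' hz').2.1
    rw [e.left_inv hz] at h3
    rwa [h3]
  refine ⟨e, ?_, fun z hz => (hU z (hsU z hz)).2.2, hcoe, ⟨r, hr, htarget⟩, ?_⟩
  · have : Φ z₀ ∈ e.target := by rw [htarget]; exact Metric.mem_ball_self hr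
    have h1 := e.map_target this
    rwa [hsymm, ← he₀, e₀.left_inv hz₀] at h1
  · rw [contDiffGroupoid, mem_groupoid_of_pregroupoid]
    have h1 : ContDiffOn ℝ ∞ e e.source := fun z hz =>
      ((hU z (hsU z hz)).1.1.congr_of_eventuallyEq (.of_forall hcoe)).contDiffWithinAt
    have h2 : ContDiffOn ℝ ∞ e.symm e.target := by
      intro y hy
      obtain ⟨⟨h3, h4⟩, -⟩ := hU _ (hsU _ (e.map_target hy))
      obtain ⟨B, hB⟩ := h4
      have h5 : HasFDerivAt e (B : E3 →L[ℝ] E3) (e.symm y) := by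
        rw [hB, show (e : E3 → E3) = Φ from funext hcoe]
        exact (h3.differentiableAt hn).hasFDerivAt
      exact (e.contDiffAt_symm hy h5
        (h3.congr_of_eventuallyEq (.of_forall hcoe))).contDiffWithinAt
    simpa [contDiffPregroupoid] using! ⟨h1, h2⟩

lemma trans_mem_maximalAtlas {M : Type*} [TopologicalSpace M] [ChartedSpace E3 M]
    {φ : OpenPartialHomeomorph M E3} (hφ : φ ∈ IsManifold.maximalAtlas (𝓡 3) ∞ M)
    {e : OpenPartialHomeomorph E3 E3} (he : e ∈ contDiffGroupoid ∞ (𝓡 3)) :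
    φ ≫ₕ e ∈ IsManifold.maximalAtlas (𝓡 3) ∞ M := by
  refine mem_maximalAtlas_iff.2 fun e' he' => ?_
  obtain ⟨h1, h2⟩ := mem_maximalAtlas_iff.1 hφ e' he'
  have e1 : (φ ≫ₕ e).symm ≫ₕ e' = e.symm ≫ₕ (φ.symm ≫ₕ e') := by
    rw [OpenPartialHomeomorph.trans_symm_eq_symm_trans_symm, OpenPartialHomeomorph.trans_assoc]
  have e2 : e'.symm ≫ₕ (φ ≫ₕ e) = (e'.symm ≫ₕ φ) ≫ₕ e :=
    (OpenPartialHomeomorph.trans_assoc _ _ _).symm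
  constructor
  · rw [e1]
    exact (contDiffGroupoid ∞ (𝓡 3)).trans ((contDiffGroupoid ∞ (𝓡 3)).symm he) h1
  · rw [e2]
    exact (contDiffGroupoid ∞ (𝓡 3)).trans h2 he

end Space

/-! ### Calculus of partial derivatives on `E3`. -/

section PartialDerivatives

variable {F H : E3 → ℝ} {z : E3}

lemma pd_add (i : Fin 3) (hF : DifferentiableAt ℝ F z) (hH : DifferentiableAt ℝ H z) :
    pd i (fun z => F z + H z) z = pd i F z + pd i H z := by
  simp only [pd, fderiv_fun_add hF hH, add_apply]

lemma pd_sub (i : Fin 3) (hF : DifferentiableAt ℝ F z) (hH : DifferentiableAt ℝ H z) :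
    pd i (fun z => F z - H z) z = pd i F z - pd i H z := by
  simp only [pd, fderiv_fun_sub hF hH, sub_apply]

lemma pd_mul (i : Fin 3) (hF : DifferentiableAt ℝ F z) (hH : DifferentiableAt ℝ H z) :
    pd i (fun z => F z * H z) z = pd i F z * H z + F z * pd i H z := by
  simp only [pd, fderiv_fun_mul hF hH, add_apply, smul_apply, smul_eq_mul]
  ring

lemma pd_const_mul (i : Fin 3) (c : ℝ) (hF : DifferentiableAt ℝ F z) :
    pd i (fun z => c * F z) z = c * pd i F z := by
  simp only [pd, fderiv_const_mul hF, smul_apply, smul_eq_mul]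

lemma pd_const (i : Fin 3) (c : ℝ) : pd i (fun _ => c) z = 0 := by
  simp [pd]

lemma pd_congr (i : Fin 3) (h : F =ᶠ[𝓝 z] H) : pd i F z = pd i H z := by
  simp only [pd, h.fderiv_eq]

lemma pd_contDiffAt (i : Fin 3) (hF : ContDiffAt ℝ ∞ F z) : ContDiffAt ℝ ∞ (pd i F) z :=
  (hF.fderiv_right (m := ∞) (by simp)).clm_apply contDiffAt_const

lemma pd_pd_comm (i j : Fin 3) (hF : ContDiffAt ℝ ∞ F z) : pd i (pd j F) z = pd j (pd i F) z := by
  have h2 : HasFDerivAt (fderiv ℝ F) (fderiv ℝ (fderiv ℝ F) z) z :=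
    ((hF.fderiv_right (m := 1) (by rw [one_add_one_eq_two]; exact two_le_infty)).differentiableAt
      (by simp)).hasFDerivAt
  have h3 : ∀ i j, pd i (pd j F) z = fderiv ℝ (fderiv ℝ F) z (stdVec i) (stdVec j) := by
    intro i j
    have : HasFDerivAt (pd j F) _ z := h2.clm_apply (hasFDerivAt_const (stdVec j) z)
    rw [pd, this.fderiv]
    simp
  rw [h3, h3]
  exact (hF.of_le two_le_infty).isSymmSndFDerivAt (by simp) _ _

lemma pd_coord (i j : Fin 3) : pd i (fun z => z j) z = if i = j then 1 else 0 := by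
  have : HasFDerivAt (fun z : E3 => z j) (EuclideanSpace.proj j : E3 →L[ℝ] ℝ) z :=
    (EuclideanSpace.proj j : E3 →L[ℝ] ℝ).hasFDerivAt
  rw [pd, this.fderiv]
  simp [stdVec, eq_comm]

lemma eq_sum_stdVec (h : E3) : h = ∑ i, h i • stdVec i := by
  ext j
  fin_cases j <;> simp [Fin.sum_univ_three, stdVec]

lemma fderiv_eq_sum_pd (F : E3 → ℝ) (z h : E3) : fderiv ℝ F z h = ∑ i, h i * pd i F z := by
  conv_lhs => rw [eq_sum_stdVec h]
  simp [pd]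

end PartialDerivatives

/-! ### The functions v, x and C in coordinates adapted to p^⊥. -/

section NormalForm

/-- The covector `g(p, ·)` in coordinates. -/
def lower (G : Fin 3 → Fin 3 → E3 → ℝ) (q : Fin 3 → E3 → ℝ) (j : Fin 3) : E3 → ℝ :=
  fun z => ∑ k, q k z * G k j z

/-- The Kundt equation in coordinates at `z`, for a metric `G`, a field `q` and the component `s`
of the volume form. -/
structure KundtAt (a : ℝ) (G : Fin 3 → Fin 3 → E3 → ℝ) (q : Fin 3 → E3 → ℝ) (s : E3 → ℝ)
    (z : E3) : Prop where
  smooth_metric : ∀ i j, ContDiffAt ℝ ∞ (G i j) z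
  smooth_field : ∀ i, ContDiffAt ℝ ∞ (q i) z
  symm : ∀ i j, G i j z = G j i z
  vol_sq : s z ^ 2 = -Matrix.det (Matrix.of fun i j => G i j z)
  vol_ne : s z ≠ 0
  null : ∑ j, q j z * lower G q j z = 0
  lie : ∀ i j, (∑ k, q k z * pd k (G i j) z) + (∑ k, G k j z * pd i (q k) z) +
    (∑ k, G i k z * pd j (q k) z) = -2 * (lower G q i z * lower G q j z)
  curl : ∀ i j, pd i (lower G q j) z - pd j (lower G q i) z =
    -(a * (s z * Matrix.det (Matrix.of ![Pi.single i 1, fun k => q k z, Pi.single j 1])))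

/-- The normal form of a Kundt metric at `z` in the coordinates `v, x, u`. -/
structure NormalAt (a : ℝ) (G : Fin 3 → Fin 3 → E3 → ℝ) (q : Fin 3 → E3 → ℝ) (s : E3 → ℝ)
    (v x u C : E3 → ℝ) (z : E3) : Prop where
  metric : ∀ i j, G i j z = (pd i v z * pd j u z + pd i u z * pd j v z)
    + a * v z * (pd i x z * pd j u z + pd i u z * pd j x z) + pd i x z * pd j x z
    + (-2 * v z * Real.exp (-a * x z) + C z) * (pd i u z * pd j u z)
  field_v : ∑ k, q k z * pd k v z = Real.exp (-a * x z)
  field_x : ∑ k, q k z * pd k x z = 0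
  field_u : ∑ k, q k z * pd k u z = 0
  field_C : ∑ k, q k z * pd k C z = 0
  vol : s z = Matrix.det (Matrix.of fun i j : Fin 3 => pd i ((![x, v, u] : Fin 3 → E3 → ℝ) j) z)

variable {a : ℝ} {G : Fin 3 → Fin 3 → E3 → ℝ} {q : Fin 3 → E3 → ℝ} {s : E3 → ℝ}

lemma KundtAt.smooth_lower {z : E3} (h : KundtAt a G q s z) (j : Fin 3) :
    ContDiffAt ℝ ∞ (lower G q j) z :=
  ContDiffAt.sum fun k _ => (h.smooth_field k).mul (h.smooth_metric k j)

/-- Algebraic consequences of the Kundt equation in coordinates adapted to `p^⊥`. -/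
lemma KundtAt.adapted {z : E3} (h : KundtAt a G q s z) (ha : a ≠ 0)
    (h0 : lower G q 0 =ᶠ[𝓝 z] 0) (h1 : lower G q 1 =ᶠ[𝓝 z] 0) (h2 : 0 < lower G q 2 z)
    {x : E3 → ℝ} (hx : ContDiffAt ℝ ∞ x z)
    (hf : lower G q 2 =ᶠ[𝓝 z] fun z => Real.exp (-a * x z)) :
    q 2 z = 0 ∧ (∀ i, pd i (lower G q 2) z = -a * lower G q 2 z * pd i x z) ∧
    lower G q 2 z * pd 0 x z = s z * q 1 z ∧ lower G q 2 z * pd 1 x z = -(s z * q 0 z) ∧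
    G 0 0 z = pd 0 x z ^ 2 ∧ G 0 1 z = pd 0 x z * pd 1 x z ∧ G 1 1 z = pd 1 x z ^ 2 ∧
    q 0 z * G 0 2 z + q 1 z * G 1 2 z = lower G q 2 z := by
  have e0 : lower G q 0 z = 0 := h0.self_of_nhds
  have e1 : lower G q 1 z = 0 := h1.self_of_nhds
  -- As p♭ = f du with f ≠ 0, nullity of p says that p is tangent to the leaves u = const.
  have hq2 : q 2 z = 0 := by
    have := h.null
    rw [Fin.sum_univ_three, e0, e1] at this
    simpa [h2.ne'] using this
  have hp : ∀ i, pd i (lower G q 2) z = -a * lower G q 2 z * pd i x z := by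
    intro i
    have hd : HasFDerivAt (fun z => Real.exp (-a * x z)) _ z :=
      (((hx.differentiableAt (by simp)).hasFDerivAt.const_mul (-a))).exp
    rw [pd_congr i hf, hf.self_of_nhds, pd, hd.fderiv]
    simp [pd]
    ring
  -- Since p♭ = f du and df = -a f dx, these components of dp♭ express the leafwise derivatives of x
  -- through p; dividing by a uses a ≠ 0.
  have c0 := h.curl 0 2
  have c1 := h.curl 1 2
  rw [pd_congr 2 h0, hp] at c0
  rw [pd_congr 2 h1, hp] at c1
  have hz : ∀ i, pd i (0 : E3 → ℝ) z = 0 := fun i => pd_const i 0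
  rw [hz] at c0 c1
  simp [Matrix.det_fin_three] at c0 c1
  set f := lower G q 2 z with hfz
  have hx0 : f * pd 0 x z = s z * q 1 z := by
    apply mul_left_cancel₀ ha
    linear_combination c0
  have hx1 : f * pd 1 x z = -(s z * q 0 z) := by
    apply mul_left_cancel₀ ha
    linear_combination -c1
  have l0 : q 0 z * G 0 0 z + q 1 z * G 0 1 z = 0 := by
    simpa [lower, Fin.sum_univ_three, hq2, h.symm 1 0] using e0
  have l1 : q 0 z * G 0 1 z + q 1 z * G 1 1 z = 0 := by
    simpa [lower, Fin.sum_univ_three, hq2] using e1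
  have l2 : q 0 z * G 0 2 z + q 1 z * G 1 2 z = f := by
    simp [hfz, lower, Fin.sum_univ_three, hq2]
  have hdet := h.vol_sq
  rw [Matrix.det_fin_three] at hdet
  simp only [Matrix.of_apply, h.symm 1 0, h.symm 2 0, h.symm 2 1] at hdet
  have hf2 : f ^ 2 ≠ 0 := pow_ne_zero 2 h2.ne'
  -- By `l0` and `l1` the vector (q₀,q₁) spans the kernel of the leaf metric, which is therefore λ
  -- times the square of the covector (q₁,-q₀). Then det G = -λf², so s² = λf², and `hx0`, `hx1`
  -- identify the leaf metric with dx².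
  refine ⟨hq2, hp, hx0, hx1, ?_, ?_, ?_, l2⟩
  · apply mul_left_cancel₀ hf2
    linear_combination -(q 0 z * G 0 2 z + q 1 z * G 1 2 z + f) * G 0 0 z * l2
      + G 0 2 z ^ 2 * (q 0 z * l0 - q 1 z * l1) + 2 * G 0 2 z * G 1 2 z * q 1 z * l0
      + G 2 2 z * q 1 z * (G 0 0 z * l1 - G 0 1 z * l0) - q 1 z ^ 2 * hdet
      - (f * pd 0 x z + s z * q 1 z) * hx0
  · apply mul_left_cancel₀ hf2
    linear_combination -(q 0 z * G 0 2 z + q 1 z * G 1 2 z + f) * G 0 1 z * l2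
      + q 0 z * G 0 2 z ^ 2 * l1 + q 1 z * G 1 2 z ^ 2 * l0
      - G 2 2 z * q 0 z * (G 0 0 z * l1 - G 0 1 z * l0) + q 0 z * q 1 z * hdet
      - f * pd 1 x z * hx0 - s z * q 1 z * hx1
  · apply mul_left_cancel₀ hf2
    linear_combination -(q 0 z * G 0 2 z + q 1 z * G 1 2 z + f) * G 1 1 z * l2
      + 2 * G 0 2 z * G 1 2 z * q 0 z * l1 + G 1 2 z ^ 2 * (q 1 z * l1 - q 0 z * l0)
      + G 2 2 z * q 0 z * (G 1 1 z * l0 - G 0 1 z * l1) - q 0 z ^ 2 * hdet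
      - (f * pd 1 x z - s z * q 0 z) * hx1

/-- Existence of the functions `v, x` bringing a Kundt metric into normal form, in coordinates
adapted to `p^⊥`. -/
theorem exists_normalForm_functions (ha : a ≠ 0) {z₀ : E3} (h : ∀ᶠ z in 𝓝 z₀, KundtAt a G q s z)
    (h0 : lower G q 0 =ᶠ[𝓝 z₀] 0) (h1 : lower G q 1 =ᶠ[𝓝 z₀] 0) (h2 : 0 < lower G q 2 z₀) :
    ∃ v x C : E3 → ℝ, ∀ᶠ z in 𝓝 z₀, ContDiffAt ℝ ∞ v z ∧ ContDiffAt ℝ ∞ x z ∧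
      ContDiffAt ℝ ∞ C z ∧ NormalAt a G q s v x (fun z => z 2) C z := by
  set f : E3 → ℝ := lower G q 2 with hf
  have hfs : ∀ᶠ z in 𝓝 z₀, ContDiffAt ℝ ∞ f z := by
    filter_upwards [h] with z hz using hz.smooth_lower 2
  have hfpos : ∀ᶠ z in 𝓝 z₀, 0 < f z := hfs.self_of_nhds.continuousAt.eventually (lt_mem_nhds h2)
  set x : E3 → ℝ := fun z => -Real.log (f z) / a with hx
  have hxs : ∀ᶠ z in 𝓝 z₀, ContDiffAt ℝ ∞ x z := by
    filter_upwards [hfs, hfpos] with z hz hz2 using (hz.log hz2.ne').neg.div_const a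
  have hfx : f =ᶠ[𝓝 z₀] fun z => Real.exp (-a * x z) := by
    filter_upwards [hfpos] with z hz
    rw [hx, show -a * (-Real.log (f z) / a) = Real.log (f z) by field_simp, Real.exp_log hz]
  have hA : ∀ᶠ z in 𝓝 z₀, q 2 z = 0 ∧ (∀ i, pd i f z = -a * f z * pd i x z) ∧
      f z * pd 0 x z = s z * q 1 z ∧ f z * pd 1 x z = -(s z * q 0 z) ∧
      G 0 0 z = pd 0 x z ^ 2 ∧ G 0 1 z = pd 0 x z * pd 1 x z ∧ G 1 1 z = pd 1 x z ^ 2 ∧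
      q 0 z * G 0 2 z + q 1 z * G 1 2 z = f z := by
    filter_upwards [h, h0.eventuallyEq_nhds, h1.eventuallyEq_nhds, hfpos, hxs,
      hfx.eventuallyEq_nhds] with z i1 i2 i3 i4 i5 i6 using i1.adapted ha i2 i3 i4 i5 i6
  have hqx : ∀ᶠ z in 𝓝 z₀, q 0 z * pd 0 x z + q 1 z * pd 1 x z = 0 := by
    filter_upwards [hA, hfpos] with z ⟨_, _, e0, e1, _⟩ hz
    apply mul_left_cancel₀ hz.ne'
    linear_combination q 0 z * e0 + q 1 z * e1
  -- the derivatives of `y`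
  set θ : Fin 3 → E3 → ℝ := fun i z => (G i 2 z - pd i x z * pd 2 x z) / f z with hθ
  have hθs : ∀ᶠ z in 𝓝 z₀, ∀ i, ContDiffAt ℝ ∞ (θ i) z := by
    filter_upwards [h, hxs, hfs, hfpos] with z i1 i2 i3 i4 i
    exact ((i1.smooth_metric i 2).sub ((pd_contDiffAt i i2).mul (pd_contDiffAt 2 i2))).div i3 i4.ne'
  have hG : ∀ᶠ z in 𝓝 z₀, ∀ i, G i 2 z = f z * θ i z + pd i x z * pd 2 x z := by
    filter_upwards [hfpos] with z hz i
    simp only [hθ]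
    field_simp
    ring
  have hθq : ∀ᶠ z in 𝓝 z₀, q 0 z * θ 0 z + q 1 z * θ 1 z = 1 := by
    filter_upwards [hA, hqx, hG, hfpos] with z i1 i2 i3 i4
    apply mul_left_cancel₀ i4.ne'
    linear_combination i1.2.2.2.2.2.2.2 - q 0 z * i3 0 - q 1 z * i3 1 - pd 2 x z * i2
  -- first derivatives of these identities
  have dqx : ∀ᶠ z in 𝓝 z₀, ∀ i, pd i (q 0) z * pd 0 x z + q 0 z * pd i (pd 0 x) z +
      (pd i (q 1) z * pd 1 x z + q 1 z * pd i (pd 1 x) z) = 0 := by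
    filter_upwards [h, hxs, hqx.eventually_nhds] with z i1 i2 i3 i
    have hq := fun k => (i1.smooth_field k).differentiableAt (by simp)
    have hp := fun k => (pd_contDiffAt k i2).differentiableAt (by simp)
    have := pd_congr i i3
    rw [pd_const, pd_add i ((hq 0).fun_mul (hp 0)) ((hq 1).fun_mul (hp 1)), pd_mul i (hq 0) (hp 0),
      pd_mul i (hq 1) (hp 1)] at this
    exact this
  have dθq : ∀ᶠ z in 𝓝 z₀, ∀ i, pd i (q 0) z * θ 0 z + q 0 z * pd i (θ 0) z +
      (pd i (q 1) z * θ 1 z + q 1 z * pd i (θ 1) z) = 0 := by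
    filter_upwards [h, hθs, hθq.eventually_nhds] with z i1 i2 i3 i
    have hq := fun k => (i1.smooth_field k).differentiableAt (by simp)
    have hp := fun k => (i2 k).differentiableAt (by simp)
    have := pd_congr i i3
    rw [pd_const, pd_add i ((hq 0).fun_mul (hp 0)) ((hq 1).fun_mul (hp 1)), pd_mul i (hq 0) (hp 0),
      pd_mul i (hq 1) (hp 1)] at this
    exact this
  have dG : ∀ᶠ z in 𝓝 z₀, ∀ i k, pd k (G i 2) z = pd k f z * θ i z + f z * pd k (θ i) z +
      (pd k (pd i x) z * pd 2 x z + pd i x z * pd k (pd 2 x) z) := by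
    filter_upwards [hxs, hθs, hfs, hG.eventually_nhds] with z i1 i2 i3 i4 i k
    have hf := i3.differentiableAt (by simp)
    have ht := fun k => (i2 k).differentiableAt (by simp)
    have hp := fun k => (pd_contDiffAt k i1).differentiableAt (by simp)
    rw [pd_congr k (i4.mono fun z hz => hz i), pd_add k (hf.fun_mul (ht i)) ((hp i).fun_mul (hp 2)),
      pd_mul k hf (ht i), pd_mul k (hp i) (hp 2)]
  -- The components (0,2) and (1,2) of L_p g contain p only through its contraction with dθ along
  -- the leaf. The component (2,2) is kept for the proof that C is constant along p.
  have hcon : ∀ᶠ z in 𝓝 z₀, pd 0 (θ 1) z = pd 1 (θ 0) z ∧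
      q 0 z * pd 0 (G 2 2) z + q 1 z * pd 1 (G 2 2) z + 2 * (G 0 2 z * pd 2 (q 0) z +
        G 1 2 z * pd 2 (q 1) z) = -2 * f z ^ 2 := by
    filter_upwards [h, hA, hqx, hxs, hG, hθq, dqx, dθq, dG, hfpos,
      h0, h1, hA.eventually_nhds] with z i1 i2 qx xs hG hθq dqx dθq dG fp l0 l1 hq2
    obtain ⟨q2, df, -, -, g00, g01, g11, -⟩ := i2
    have dq2 : ∀ i, pd i (q 2) z = 0 := fun i =>
      (pd_congr i (hq2.mono fun z hz => hz.1)).trans (pd_const i 0)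
    have e0 := i1.lie 0 2
    have e1 := i1.lie 1 2
    have e2 := i1.lie 2 2
    have l0' : lower G q 0 z = 0 := l0
    have l1' : lower G q 1 z = 0 := l1
    have d0 := dqx 0
    have d1 := dqx 1
    have d2 := dqx 2
    have t0 := dθq 0
    have t1 := dθq 1
    simp only [Fin.sum_univ_three, q2, dq2, i1.symm 2 0, i1.symm 2 1, i1.symm 1 0, g00, g01,
      g11, l0', l1'] at e0 e1 e2
    constructor
    · simp only [dG, hG, df] at e0 e1
      simp only [pd_pd_comm 0 1 xs, pd_pd_comm 0 2 xs, pd_pd_comm 1 2 xs] at e0 e1 d0 d1 d2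
      have r0 : f z * q 1 z * (pd 0 (θ 1) z - pd 1 (θ 0) z) = 0 := by
        linear_combination -e0 + pd 2 x z * d0 + pd 0 x z * d2 - a * f z * θ 0 z * qx + f z * t0
      have r1 : f z * q 0 z * (pd 0 (θ 1) z - pd 1 (θ 0) z) = 0 := by
        linear_combination e1 - pd 2 x z * d1 - pd 1 x z * d2 + a * f z * θ 1 z * qx - f z * t1
      -- The previous identities are multiplied by q₁ and q₀; the weights θ₁ and θ₀ combine these
      -- factors to θ(p) = 1, so no case distinction on q is needed.
      have r2 : f z * (pd 0 (θ 1) z - pd 1 (θ 0) z) = 0 := by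
        linear_combination θ 1 z * r0 + θ 0 z * r1 - f z * (pd 0 (θ 1) z - pd 1 (θ 0) z) * hθq
      exact sub_eq_zero.1 ((mul_eq_zero.1 r2).resolve_left fp.ne')
    · linear_combination e2
  obtain ⟨y, hys, hy⟩ := exists_parametric_primitive z₀ (hθs.mono fun z hz => hz 0)
    (hθs.mono fun z hz => hz 1) (hcon.mono fun z hz => hz.1)
  -- `C` is what is left of the (2,2) component after dx², 2f dy du and the term -2v e^{-ax} du² are
  -- removed.
  set C : E3 → ℝ := fun z => G 2 2 z - pd 2 x z * pd 2 x z - 2 * (f z * pd 2 y z) +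
    2 * (f z * (f z * y z)) with hC
  -- The choice v = f y gives dv = f dy - a v dx, which absorbs 2f dy du into 2dv du + 2av dx du.
  refine ⟨fun z => f z * y z, x, C, ?_⟩
  filter_upwards [h, hA, hqx, hxs, hG, hθq, dqx, dθq, hfpos, hfs, hys, hy.eventually_nhds, hcon,
    hfx, hθs] with z i1 i2 qx xs hG hθq dqx dθq fp fs ys hy hcon fx hθs
  obtain ⟨q2, df, fx0, fx1, g00, g01, g11, -⟩ := i2
  obtain ⟨y0, y1⟩ := hy.self_of_nhds
  have hcon2 := hcon.2
  have ht := fun k => (hθs k).differentiableAt (by simp)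
  have dy0 : pd 0 (pd 2 y) z = pd 2 (θ 0) z :=
    (pd_pd_comm 0 2 ys).trans (pd_congr 2 (hy.mono fun z hz => hz.1))
  have dy1 : pd 1 (pd 2 y) z = pd 2 (θ 1) z :=
    (pd_pd_comm 1 2 ys).trans (pd_congr 2 (hy.mono fun z hz => hz.2))
  have fd := fs.differentiableAt (by simp)
  have yd := ys.differentiableAt (by simp)
  have hv : ∀ i, pd i (fun z => f z * y z) z = -a * f z * pd i x z * y z + f z * pd i y z :=
    fun i => by rw [pd_mul i fd yd, df]
  have hu : ∀ i : Fin 3, pd i (fun z : E3 => z 2) z = if i = 2 then 1 else 0 :=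
    fun i => pd_coord i 2
  have hGd := (i1.smooth_metric 2 2).differentiableAt (by simp)
  have xd := (pd_contDiffAt 2 xs).differentiableAt (by simp)
  have y2d := (pd_contDiffAt 2 ys).differentiableAt (by simp)
  have hCd : ∀ i, pd i C z = pd i (G 2 2) z - 2 * (pd 2 x z * pd i (pd 2 x) z) -
      2 * (-a * f z * pd i x z * pd 2 y z + f z * pd i (pd 2 y) z) +
      2 * (-a * f z * pd i x z * (f z * y z) +
        f z * (-a * f z * pd i x z * y z + f z * pd i y z)) := by
    intro i
    rw [hC, pd_add i ((hGd.fun_sub (xd.fun_mul xd)).fun_sub ((fd.fun_mul y2d).const_mul 2))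
        ((fd.fun_mul (fd.fun_mul yd)).const_mul 2),
      pd_sub i (hGd.fun_sub (xd.fun_mul xd)) ((fd.fun_mul y2d).const_mul 2),
      pd_sub i hGd (xd.fun_mul xd), pd_mul i xd xd, pd_const_mul i 2 (fd.fun_mul y2d),
      pd_mul i fd y2d, pd_const_mul i 2 (fd.fun_mul (fd.fun_mul yd)),
      pd_mul i fd (fd.fun_mul yd), hv, df]
    ring
  refine ⟨fs.mul ys, xs, ?_, ⟨?_, ?_, ?_, ?_, ?_, ?_⟩⟩
  · exact (((i1.smooth_metric 2 2).sub ((pd_contDiffAt 2 xs).mul (pd_contDiffAt 2 xs))).sub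
      (contDiffAt_const.mul (fs.mul (pd_contDiffAt 2 ys)))).add
      (contDiffAt_const.mul (fs.mul (fs.mul ys)))
  · have G02 := hG 0
    have G12 := hG 1
    intro i j
    rw [← fx, hv, hv, hu, hu]
    fin_cases i <;> fin_cases j <;>
      simp [g00, g01, g11, i1.symm 1 0, i1.symm 2 0, i1.symm 2 1, hC, G02, G12, y0, y1] <;> ring
  · rw [← fx, Fin.sum_univ_three, hv, hv, hv, q2, y0, y1]
    linear_combination f z * hθq - a * f z * y z * qx
  · rw [Fin.sum_univ_three, q2]
    linear_combination qx
  · simp [hu, q2]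
  · rw [Fin.sum_univ_three, q2, hCd, hCd, hCd, dy0, dy1, y0, y1]
    have d2 := dqx 2
    have t2 := dθq 2
    rw [hG 0, hG 1] at hcon2
    rw [pd_pd_comm 0 2 xs, pd_pd_comm 1 2 xs]
    linear_combination hcon2 - 2 * pd 2 x z * d2 - 2 * f z * t2 + 2 * f z ^ 2 * hθq +
      (2 * a * f z * pd 2 y z - 4 * a * f z ^ 2 * y z) * qx
  · rw [Matrix.det_fin_three]
    simp [hv, hu, y0, y1]
    linear_combination -s z * hθq - θ 1 z * fx0 + θ 0 z * fx1

end NormalForm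

/-! ### The coordinate changes: adapting to p^⊥, then passing to normal form. -/

section NormalChart

variable {a : ℝ} {G : Fin 3 → Fin 3 → E3 → ℝ} {q : Fin 3 → E3 → ℝ} {s : E3 → ℝ}

lemma hasFDerivAt_toLp_vec {F : Fin 3 → E3 → ℝ} {z : E3} (h : ∀ i, DifferentiableAt ℝ (F i) z) :
    DifferentiableAt ℝ (fun z => WithLp.toLp 2 (fun i => F i z) : E3 → E3) z ∧
      ∀ (w : E3) (i : Fin 3),
        fderiv ℝ (fun z => WithLp.toLp 2 (fun i => F i z) : E3 → E3) z w i = fderiv ℝ (F i) z w := by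
  have hd : DifferentiableAt ℝ (fun z => WithLp.toLp 2 (fun i => F i z) : E3 → E3) z :=
    (differentiableAt_euclidean).2 h
  refine ⟨hd, fun w i => ?_⟩
  have := (EuclideanSpace.proj i : E3 →L[ℝ] ℝ).hasFDerivAt.comp z hd.hasFDerivAt
  exact congrArg (fun L : E3 →L[ℝ] ℝ => L w) (this.fderiv.symm)

/-- The local diffeomorphism bringing a Kundt metric into normal form, in coordinates adapted
to `p^⊥`. -/
theorem exists_normalForm_chart (ha : a ≠ 0) {z₀ : E3} (h : ∀ᶠ z in 𝓝 z₀, KundtAt a G q s z)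
    (h0 : lower G q 0 =ᶠ[𝓝 z₀] 0) (h1 : lower G q 1 =ᶠ[𝓝 z₀] 0) (h2 : 0 < lower G q 2 z₀)
    {U : Set E3} (hU : U ∈ 𝓝 z₀) :
    ∃ (e : OpenPartialHomeomorph E3 E3) (C₀ : E3 → ℝ) (C : ℝ × ℝ → ℝ),
      e ∈ contDiffGroupoid ∞ (𝓡 3) ∧ z₀ ∈ e.source ∧ e.source ⊆ U ∧
      ContDiffOn ℝ ∞ C ((fun w : E3 => (w 1, w 2)) '' e.target) ∧
      ∀ z ∈ e.source, (∀ i, DifferentiableAt ℝ (fun z => e z i) z) ∧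
        NormalAt a G q s (fun z => e z 0) (fun z => e z 1) (fun z => e z 2) C₀ z ∧
        C₀ z = C (e z 1, e z 2) := by
  obtain ⟨v, x, C₀, hev⟩ := exists_normalForm_functions ha h h0 h1 h2
  set Φ : E3 → E3 := fun z => WithLp.toLp 2 (fun i => (![v, x, fun z => z 2] : Fin 3 → E3 → ℝ) i z)
    with hΦ
  have hcomp : ∀ᶠ z in 𝓝 z₀, ∀ i,
      ContDiffAt ℝ ∞ ((![v, x, fun z => z 2] : Fin 3 → E3 → ℝ) i) z := by
    filter_upwards [hev] with z hz i
    fin_cases i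
    · exact hz.1
    · exact hz.2.1
    · exact (EuclideanSpace.proj 2 : E3 →L[ℝ] ℝ).contDiff.contDiffAt
  have hΦs : ∀ᶠ z in 𝓝 z₀, ContDiffAt ℝ ∞ Φ z := by
    filter_upwards [hcomp] with z hz using contDiffAt_euclidean.2 hz
  obtain ⟨-, hfd⟩ := hasFDerivAt_toLp_vec
    (fun i => (hcomp.self_of_nhds i).differentiableAt (by simp))
  have hu : ∀ (i : Fin 3) (z : E3), pd i (fun z : E3 => z 2) z = if i = 2 then 1 else 0 :=
    fun i z => pd_coord i 2
  -- The Jacobian determinant of (x, v, u) is the component `s` of the volume form, which does not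
  -- vanish.
  have hinj : Function.Injective (fderiv ℝ Φ z₀) := by
    refine (injective_iff_map_eq_zero _).2 fun w hw => ?_
    have hw0 : ∀ i, fderiv ℝ ((![v, x, fun z => z 2] : Fin 3 → E3 → ℝ) i) z₀ w = 0 := fun i => by
      rw [← hfd w i]
      change (fderiv ℝ Φ z₀ w) i = 0
      rw [hw]
      rfl
    have e0 : fderiv ℝ v z₀ w = 0 := hw0 0
    have e1 : fderiv ℝ x z₀ w = 0 := hw0 1
    have e2 : fderiv ℝ (fun z : E3 => z 2) z₀ w = 0 := hw0 2
    rw [fderiv_eq_sum_pd, Fin.sum_univ_three] at e0 e1 e2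
    simp only [hu] at e2
    have hs := h.self_of_nhds.vol_ne
    have hv := hev.self_of_nhds.2.2.2.vol
    rw [Matrix.det_fin_three] at hv
    simp [hu] at hv e2
    rw [e2, zero_mul, add_zero] at e0 e1
    have w0 : s z₀ * w 0 = 0 := by rw [hv]; linear_combination pd 1 v z₀ * e1 - pd 1 x z₀ * e0
    have w1 : s z₀ * w 1 = 0 := by rw [hv]; linear_combination pd 0 x z₀ * e0 - pd 0 v z₀ * e1
    ext i
    fin_cases i
    · exact (mul_eq_zero.1 w0).resolve_left hs
    · exact (mul_eq_zero.1 w1).resolve_left hs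
    · exact e2
  obtain ⟨e, hz₀, hsub, hcoe, ⟨r, hr, htar⟩, hgrp⟩ :=
    exists_localDiffeo hΦs hinj (Filter.inter_mem hU (hev.and hcomp))
  have hc0 : (fun z => e z 0) = v := funext fun z => by rw [hcoe]; rfl
  have hc1 : (fun z => e z 1) = x := funext fun z => by rw [hcoe]; rfl
  have hc2 : (fun z => e z 2) = fun z => z 2 := funext fun z => by rw [hcoe]; rfl
  have hsymm : ContDiffOn ℝ ∞ e.symm e.target := by
    have := hgrp
    rw [contDiffGroupoid, mem_groupoid_of_pregroupoid] at this
    simpa [contDiffPregroupoid] using! this.2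
  set Ct : E3 → ℝ := fun w => C₀ (e.symm w) with hCt
  have hCts : ∀ w ∈ e.target, ContDiffAt ℝ ∞ Ct w := by
    intro w hw
    exact (hsub (e.map_target hw)).2.1.2.2.1.comp w
      ((hsymm w hw).contDiffAt (e.open_target.mem_nhds hw))
  -- In the new coordinates p becomes e^{-ax}∂_v, so p(C₀) = 0 says that `Ct` has no derivative in
  -- v.
  have hCt0 : ∀ w ∈ e.target, fderiv ℝ Ct w (stdVec 0) = 0 := by
    intro w hw
    obtain ⟨-, ⟨-, -, hC, hn⟩, hcz⟩ := hsub (e.map_target hw)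
    set z := e.symm w with hz
    have hez : e z = w := e.right_inv hw
    obtain ⟨hd, hfd⟩ := hasFDerivAt_toLp_vec (fun i => (hcz i).differentiableAt (by simp))
    have hCe : Ct ∘ Φ =ᶠ[𝓝 z] C₀ := by
      filter_upwards [e.open_source.mem_nhds (e.map_target hw)] with z' hz'
      simp only [Function.comp_apply, hCt, ← hcoe, e.left_inv hz']
    set Q : E3 := WithLp.toLp 2 (fun k => q k z)
    have hQ : ∀ F : E3 → ℝ, fderiv ℝ F z Q = ∑ k, q k z * pd k F z :=
      fun F => fderiv_eq_sum_pd F z Q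
    have hΦQ : fderiv ℝ Φ z Q = Real.exp (-a * x z) • stdVec 0 := by
      ext i
      rw [hfd, hQ]
      fin_cases i
      · simpa [stdVec] using hn.field_v
      · simpa [stdVec] using hn.field_x
      · simpa [stdVec] using hn.field_u
    have hΦz : Φ z = w := by rw [← hcoe, hez]
    have h1 : HasFDerivAt (Ct ∘ Φ) (fderiv ℝ Ct w ∘L fderiv ℝ Φ z) z := by
      refine HasFDerivAt.comp z ?_ hd.hasFDerivAt
      rw [hΦz]
      exact ((hCts w hw).differentiableAt (by simp)).hasFDerivAt
    have h2 := h1.unique (((hC.differentiableAt (by simp)).hasFDerivAt).congr_of_eventuallyEq hCe)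
    have h3 := congrArg (fun L : E3 →L[ℝ] ℝ => L Q) h2
    simp only [ContinuousLinearMap.comp_apply, hΦQ, hQ, hn.field_C, map_smul, smul_eq_mul] at h3
    exact (mul_eq_zero.1 h3).resolve_left (Real.exp_pos _).ne'
  set w₀ := Φ z₀
  -- straightening along the first axis
  have hline : ∀ w ∈ e.target, !₂[w₀ 0, w 1, w 2] ∈ e.target ∧ Ct !₂[w₀ 0, w 1, w 2] = Ct w := by
    intro w hw
    -- Along this segment the first coordinate approaches that of the centre of the ball while the
    -- others are fixed, so the distance to the centre does not grow.
    have hseg : ∀ t ∈ Icc (0 : ℝ) 1, w + (t * (w₀ 0 - w 0)) • stdVec 0 ∈ e.target := by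
      intro t ht
      rw [htar, Metric.mem_ball, EuclideanSpace.dist_eq] at hw ⊢
      refine lt_of_le_of_lt (Real.sqrt_le_sqrt ?_) hw
      rw [Fin.sum_univ_three, Fin.sum_univ_three]
      simp only [Real.dist_eq, sq_abs]
      simp [stdVec]
      change (w 0 + t * (w₀ 0 - w 0) - w₀ 0) ^ 2 ≤ (w 0 - w₀ 0) ^ 2
      rw [show w 0 + t * (w₀ 0 - w 0) - w₀ 0 = (1 - t) * (w 0 - w₀ 0) by ring, mul_pow]
      refine mul_le_of_le_one_left (sq_nonneg _) ?_
      have := ht.1; have := ht.2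
      nlinarith
    have hend : w + ((1 : ℝ) * (w₀ 0 - w 0)) • stdVec 0 = !₂[w₀ 0, w 1, w 2] := by
      ext i
      fin_cases i <;> simp [stdVec]
    refine ⟨hend ▸ hseg 1 (by simp), ?_⟩
    have hder : ∀ t ∈ Icc (0 : ℝ) 1,
        HasDerivAt (fun t : ℝ => Ct (w + (t * (w₀ 0 - w 0)) • stdVec 0)) 0 t := by
      intro t ht
      have h1 := ((hCts _ (hseg t ht)).differentiableAt (by simp)).hasFDerivAt
      have h2 : HasDerivAt (fun t : ℝ => w + (t * (w₀ 0 - w 0)) • stdVec 0)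
          ((w₀ 0 - w 0) • stdVec 0) t := by
        have := (((hasDerivAt_id t).mul_const (w₀ 0 - w 0)).smul_const (stdVec 0)).const_add w
        simpa using this
      refine (h1.comp_hasDerivAt t h2).congr_deriv ?_
      rw [map_smul, hCt0 _ (hseg t ht), smul_zero]
    have h3 := constant_of_has_deriv_right_zero
      (fun t ht => (hder t ht).continuousAt.continuousWithinAt)
      (fun t ht => (hder t (Ico_subset_Icc_self ht)).hasDerivWithinAt) 1 (by simp)
    rw [hend] at h3
    simpa using h3
  -- `C` is read off on the slice where v has its value at the centre. Values outside the projection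
  -- of the target are immaterial.
  refine ⟨e, C₀, fun p => Ct !₂[w₀ 0, p.1, p.2], hgrp, hz₀, fun z hz => (hsub hz).1, ?_, ?_⟩
  · rintro _ ⟨w, hw, rfl⟩
    have h1 : ContDiff ℝ ∞ (fun p : ℝ × ℝ => (!₂[w₀ 0, p.1, p.2] : E3)) := by
      rw [contDiff_euclidean]
      intro i
      fin_cases i <;> simp <;> fun_prop
    exact ((hCts _ (hline w hw).1).comp (w 1, w 2) h1.contDiffAt).contDiffWithinAt
  · intro z hz
    obtain ⟨-, ⟨-, -, -, hn⟩, hcz⟩ := hsub hz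
    rw [hc0, hc1, hc2]
    refine ⟨fun i => ?_, hn, ?_⟩
    · have : (fun z => e z i) = (![v, x, fun z => z 2] : Fin 3 → E3 → ℝ) i :=
        funext fun z => by rw [hcoe]
      rw [this]
      exact (hcz i).differentiableAt (by simp)
    · change C₀ z = Ct !₂[w₀ 0, e z 1, e z 2]
      rw [(hline (e z) (e.map_source hz)).2, hCt]
      simp only [e.left_inv hz]

/-- The local diffeomorphism adapting the coordinates to the integrable plane field `p^⊥`. -/
theorem exists_adapted_chart {z₀ : E3} (h : ∀ᶠ z in 𝓝 z₀, KundtAt a G q s z)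
    (h2 : 0 < lower G q 2 z₀) :
    ∃ e : OpenPartialHomeomorph E3 E3, e ∈ contDiffGroupoid ∞ (𝓡 3) ∧ z₀ ∈ e.source ∧ e z₀ = z₀ ∧
      (∀ z ∈ e.source, (∀ i, DifferentiableAt ℝ (fun z => e z i) z) ∧
        (∑ i, lower G q i (e z) * pd 0 (fun z => e z i) z = 0) ∧
        ∑ i, lower G q i (e z) * pd 1 (fun z => e z i) z = 0) ∧
      0 < ∑ i, lower G q i (e z₀) * pd 2 (fun z => e z i) z₀ := by
  set P : Fin 3 → E3 → ℝ := lower G q with hP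
  have hPs : ∀ᶠ z in 𝓝 z₀, ∀ i, ContDiffAt ℝ ∞ (P i) z := by
    filter_upwards [h] with z hz i using hz.smooth_lower i
  have hpos : ∀ᶠ z in 𝓝 z₀, 0 < P 2 z :=
    (hPs.self_of_nhds 2).continuousAt.eventually (lt_mem_nhds h2)
  -- As P₂ ≠ 0, the plane field p♭ = 0 is the graph dz₂ = -(P₀/P₂) dz₀ - (P₁/P₂) dz₁.
  have hα : ∀ i, ∀ᶠ z in 𝓝 z₀, ContDiffAt ℝ ∞ (fun z => -P i z / P 2 z) z := by
    intro i
    filter_upwards [hPs, hpos] with z h1 h2 using (h1 i).neg.div (h1 2) h2.ne'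
  have hαd : ∀ᶠ z in 𝓝 z₀, ∀ i k, P 2 z ^ 2 * pd k (fun z => -P i z / P 2 z) z =
      -(pd k (P i) z * P 2 z) + P i z * pd k (P 2) z := by
    filter_upwards [hPs, hpos] with z h1 h2 i k
    have h3 := (h1 i).differentiableAt (by simp)
    have h4 := (h1 2).differentiableAt (by simp)
    have h5 : (fun z => P 2 z * (-P i z / P 2 z)) =ᶠ[𝓝 z] fun z => -1 * P i z := by
      filter_upwards [(h1 2).continuousAt.eventually (lt_mem_nhds h2)] with z hz
      field_simp
    have h6 := pd_congr k h5
    have h7 : DifferentiableAt ℝ (fun z => -P i z / P 2 z) z :=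
      ((h1 i).neg.div (h1 2) h2.ne').differentiableAt (by simp)
    rw [pd_mul k h4 h7, pd_const_mul k _ h3] at h6
    have r : P 2 z * (-P i z / P 2 z) = -P i z := by field_simp
    linear_combination P 2 z * h6 - pd k (P 2) z * r
  -- After clearing denominators the integrability condition is p♭∧dp♭ = 0. The formula for dp♭
  -- makes the left side a multiple of g(p,p), so it vanishes by `hn`.
  obtain ⟨f, hfs, hf0, hf2, hf⟩ := exists_leaf_function z₀ (hα 0) (hα 1) (by
    filter_upwards [hαd, hpos, h] with z hd hp hk
    have c01 := hk.curl 0 1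
    have c02 := hk.curl 0 2
    have c12 := hk.curl 1 2
    have hn := hk.null
    rw [← hP] at c01 c02 c12 hn
    simp [Matrix.det_fin_three] at c01 c02 c12
    rw [Fin.sum_univ_three] at hn
    apply mul_left_cancel₀ (pow_ne_zero 2 hp.ne')
    apply mul_left_cancel₀ hp.ne'
    have r0 : P 2 z * (-P 0 z / P 2 z) = -P 0 z := by field_simp
    have r1 : P 2 z * (-P 1 z / P 2 z) = -P 1 z := by field_simp
    linear_combination P 2 z * hd 1 0 + P 2 z * (-P 0 z / P 2 z) * hd 1 2 - P 2 z * hd 0 1 -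
      P 2 z * (-P 1 z / P 2 z) * hd 0 2 + (-(pd 2 (P 1) z * P 2 z) + P 1 z * pd 2 (P 2) z) * r0 -
      (-(pd 2 (P 0) z * P 2 z) + P 0 z * pd 2 (P 2) z) * r1 - P 2 z ^ 2 * c01 +
      P 2 z * P 1 z * c02 - P 2 z * P 0 z * c12 - a * s z * P 2 z * hn)
  -- This map goes from the adapted coordinates to the given ones: planes with fixed third
  -- coordinate are sent to the leaves.
  set F : Fin 3 → E3 → ℝ := ![fun z => z 0, fun z => z 1, f] with hF
  set Φ : E3 → E3 := fun z => WithLp.toLp 2 (fun i => F i z) with hΦ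
  have hcomp : ∀ᶠ z in 𝓝 z₀, ∀ i, ContDiffAt ℝ ∞ (F i) z := by
    filter_upwards [hfs] with z hz i
    fin_cases i
    · exact (EuclideanSpace.proj 0 : E3 →L[ℝ] ℝ).contDiff.contDiffAt
    · exact (EuclideanSpace.proj 1 : E3 →L[ℝ] ℝ).contDiff.contDiffAt
    · exact hz
  have hΦs : ∀ᶠ z in 𝓝 z₀, ContDiffAt ℝ ∞ Φ z := by
    filter_upwards [hcomp] with z hz using contDiffAt_euclidean.2 hz
  have hΦv : ∀ z, Φ z = !₂[z 0, z 1, f z] := fun z => by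
    ext i; fin_cases i <;> rfl
  have hΦ0 : Φ z₀ = z₀ := by
    rw [hΦv, hf0]
    ext i; fin_cases i <;> rfl
  obtain ⟨-, hfd⟩ := hasFDerivAt_toLp_vec
    (fun i => (hcomp.self_of_nhds i).differentiableAt (by simp))
  have hu : ∀ (i j : Fin 3) (z : E3), pd i (fun z : E3 => z j) z = if i = j then 1 else 0 :=
    fun i j z => pd_coord i j
  have hinj : Function.Injective (fderiv ℝ Φ z₀) := by
    refine (injective_iff_map_eq_zero _).2 fun w hw => ?_
    have hw0 : ∀ i, fderiv ℝ (F i) z₀ w = 0 := fun i => by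
      rw [← hfd w i]
      change (fderiv ℝ Φ z₀ w) i = 0
      rw [hw]
      rfl
    have e0 : fderiv ℝ (fun z : E3 => z 0) z₀ w = 0 := hw0 0
    have e1 : fderiv ℝ (fun z : E3 => z 1) z₀ w = 0 := hw0 1
    have e2 : fderiv ℝ f z₀ w = 0 := hw0 2
    rw [fderiv_eq_sum_pd, Fin.sum_univ_three] at e0 e1 e2
    simp [hu] at e0 e1
    rw [e0, e1, hf2] at e2
    ext i
    fin_cases i
    · exact e0
    · exact e1
    · simpa using e2
  have hpos' : ∀ᶠ z in 𝓝 z₀, 0 < P 2 (Φ z) := by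
    have hc : ContinuousAt Φ z₀ := hΦs.self_of_nhds.continuousAt
    refine hc.eventually (p := fun z => 0 < P 2 z) ?_
    rwa [hΦ0]
  obtain ⟨e, hz₀, hsub, hcoe, -, hgrp⟩ :=
    exists_localDiffeo hΦs hinj ((hcomp.and (hf.and hpos')) : _ ∈ 𝓝 z₀)
  have hei : ∀ i, (fun z => e z i) = F i := fun i => funext fun z => by rw [hcoe]
  refine ⟨e, hgrp, hz₀, by rw [hcoe, hΦ0], fun z hz => ?_, ?_⟩
  · obtain ⟨hc, ⟨hf0, hf1⟩, hp⟩ := hsub hz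
    refine ⟨fun i => ?_, ?_, ?_⟩
    · rw [hei]
      exact (hc i).differentiableAt (by simp)
    · rw [Fin.sum_univ_three, hei, hei, hei, hcoe]
      simp [hF, hu, hf0, ← hΦv]
      field_simp
      ring
    · rw [Fin.sum_univ_three, hei, hei, hei, hcoe]
      simp [hF, hu, hf1, ← hΦv]
      field_simp
      ring
  · rw [Fin.sum_univ_three, hei, hei, hei, hcoe, hΦ0]
    simp [hF, hu, hf2]
    exact h2

end NormalChart

/-! ### Components of metric, field and volume form in a chart. -/

section Coordinates

open VectorField

variable {M : Type*} [TopologicalSpace M] [ChartedSpace E3 M] [IsManifold (𝓡 3) ∞ M]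
  (g : LorentzMetric M)

/-- The components of the metric in a chart. -/
def LorentzMetric.coord (φ : OpenPartialHomeomorph M E3) (i j : Fin 3) : E3 → ℝ :=
  (fun y => g.form y (chartField φ i y) (chartField φ j y)) ∘ φ.symm

/-- The components of a vector field in a chart. -/
def VField.coord (p : VField M) (φ : OpenPartialHomeomorph M E3) (i : Fin 3) : E3 → ℝ :=
  (fun y => coordDiff φ i y (p y)) ∘ φ.symm

/-- The component of the volume form in a chart. -/
def volCoord (o : SmoothOrientation M) (φ : OpenPartialHomeomorph M E3) : E3 → ℝ :=
  (fun y => volForm g o y (fun i => chartField φ i y)) ∘ φ.symm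

variable {φ : OpenPartialHomeomorph M E3} (hφ : φ ∈ IsManifold.maximalAtlas (𝓡 3) ∞ M) {y : M}
  (hy : y ∈ φ.source) {p : VField M} {D : AffConn M}

include hφ hy

lemma contDiffAt_comp_chart_symm {F : M → ℝ} (hF : ContMDiffAt (𝓡 3) 𝓘(ℝ, ℝ) ∞ F y) :
    ContDiffAt ℝ ∞ (F ∘ φ.symm) (φ y) := by
  have h1 : ContMDiffAt (𝓡 3) (𝓡 3) ∞ φ.symm (φ y) :=
    (contMDiffOn_symm_of_mem_maximalAtlas hφ).contMDiffAt
      (φ.open_target.mem_nhds (φ.map_source hy))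
  rw [← contMDiffAt_iff_contDiffAt]
  refine ContMDiffAt.comp (φ y) ?_ h1
  rwa [φ.left_inv hy]

lemma contMDiffAt_chart_coord (i : Fin 3) :
    ContMDiffAt (𝓡 3) 𝓘(ℝ, ℝ) ∞ (fun z => φ z i) y :=
  ContMDiffAt.comp y ((EuclideanSpace.proj i : E3 →L[ℝ] ℝ).contDiff.contDiffAt.contMDiffAt)
    (chart_contMDiffAt hφ hy)

lemma contMDiffAt_coordDiff (hp : SmoothFieldAt p y) (i : Fin 3) :
    ContMDiffAt (𝓡 3) 𝓘(ℝ, ℝ) ∞ (fun y => coordDiff φ i y (p y)) y :=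
  contMDiffAt_mvfderiv_apply (contMDiffAt_chart_coord hφ hy i) hp

omit hφ in
lemma LorentzMetric.coord_apply (i j : Fin 3) :
    g.coord φ i j (φ y) = g.form y (chartField φ i y) (chartField φ j y) :=
  congrArg (fun z => g.form z (chartField φ i z) (chartField φ j z)) (φ.left_inv hy)

omit hφ in
lemma VField.coord_apply (i : Fin 3) : p.coord φ i (φ y) = coordDiff φ i y (p y) :=
  congrArg (fun z => coordDiff φ i z (p z)) (φ.left_inv hy)

omit hφ in
lemma volCoord_apply (o : SmoothOrientation M) :
    volCoord g o φ (φ y) = volForm g o y (fun i => chartField φ i y) :=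
  congrArg (fun z => volForm g o z (fun i => chartField φ i z)) (φ.left_inv hy)

lemma LorentzMetric.form_eq_sum (X Y : TangentSpace (𝓡 3) y) :
    g.form y X Y = ∑ i, ∑ j, coordDiff φ i y X * (coordDiff φ j y Y *
      g.coord φ i j (φ y)) := by
  conv_lhs => rw [← sum_coordDiff_smul hφ hy X, ← sum_coordDiff_smul hφ hy Y]
  simp only [map_sum, map_smul, sum_apply, smul_apply, smul_eq_mul, g.coord_apply hy,
    Finset.mul_sum]
  rw [Finset.sum_comm]
  refine Finset.sum_congr rfl fun i _ => Finset.sum_congr rfl fun j _ => by ring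

lemma lower_coord (j : Fin 3) :
    lower (g.coord φ) (p.coord φ) j (φ y) = g.form y (p y) (chartField φ j y) := by
  conv_rhs => rw [← sum_coordDiff_smul hφ hy (p y)]
  simp only [map_sum, map_smul, sum_apply, smul_apply, smul_eq_mul, lower, g.coord_apply hy,
    VField.coord_apply hy]

lemma volForm_eq_det (o : SmoothOrientation M) (X : Fin 3 → TangentSpace (𝓡 3) y) :
    volForm g o y X = volCoord g o φ (φ y) *
      Matrix.det (Matrix.of fun i j => coordDiff φ j y (X i)) := by
  have h := (volForm g o y).eq_smul_basis_det (chartBasis hφ hy)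
  have h2 : (fun i => chartField φ i y) = chartBasis hφ hy := by ext i; simp
  rw [volCoord_apply g hy, h2]
  conv_lhs => rw [h]
  rw [AlternatingMap.smul_apply, smul_eq_mul, Basis.det_apply, ← Matrix.det_transpose]
  rfl

omit hφ hy in
-- The sign that depends on the orientation occurs twice and cancels.
lemma volForm_mul_self (o : SmoothOrientation M) (X Y : Fin 3 → TangentSpace (𝓡 3) y) :
    volForm g o y X * volForm g o y Y =
      -Matrix.det (Matrix.of fun i j => g.form y (X i) (Y j)) := by
  rw [← g.frame_det_mul, volForm]
  split_ifs
  · rfl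
  · simp

lemma volCoord_sq (o : SmoothOrientation M) : volCoord g o φ (φ y) ^ 2 =
    -Matrix.det (Matrix.of fun i j => g.coord φ i j (φ y)) := by
  rw [volCoord_apply g hy, sq, volForm_mul_self]
  simp only [g.coord_apply hy]

lemma volCoord_ne_zero (o : SmoothOrientation M) : volCoord g o φ (φ y) ≠ 0 := by
  intro h
  have := volCoord_sq g hφ hy o
  simp only [g.coord_apply hy] at this
  rw [h, zero_pow two_ne_zero, zero_eq_neg] at this
  exact g.chart_gram_det_ne_zero hφ hy this

lemma koszul_chartField (k i j : Fin 3) :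
    g.koszul (chartField φ k) (chartField φ i) (chartField φ j) y =
      pd i (g.coord φ k j) (φ y) + pd k (g.coord φ i j) (φ y) - pd j (g.coord φ i k) (φ y) := by
  have hd := fun i => (chartField_smoothFieldAt hφ hy i).diffFieldAt
  have h : ∀ k i j, g.deriv (chartField φ i) (chartField φ j) y (chartField φ k y) =
      pd k (g.coord φ i j) (φ y) := fun k i j =>
    mvfderiv_chartField hφ hy k _ (g.mdifferentiableAt_apply (hd i) (hd j))
  simp only [LorentzMetric.koszul, mlieBracket_chartField hφ hy, h, map_zero, zero_apply]
  ring

/-- The first bracket is L_p g and the second dp♭: the symmetric and skew parts of 2∇^g p♭. The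
proof expands p in the commuting coordinate fields inside the Koszul formula. -/
lemma IsLeviCivita.two_mul_form_chartField (hD : IsLeviCivita g D) (hp : SmoothFieldAt p y)
    (i j : Fin 3) :
    2 * g.form y (D p y (chartField φ i y)) (chartField φ j y) =
      ((∑ k, p.coord φ k (φ y) * pd k (g.coord φ i j) (φ y)) +
        (∑ k, g.coord φ k j (φ y) * pd i (p.coord φ k) (φ y)) +
        (∑ k, g.coord φ i k (φ y) * pd j (p.coord φ k) (φ y))) +
      (pd i (lower (g.coord φ) (p.coord φ) j) (φ y) -
        pd j (lower (g.coord φ) (p.coord φ) i) (φ y)) := by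
  have hX := fun i => chartField_smoothFieldAt hφ hy i
  have hd := fun i => (hX i).diffFieldAt
  have hq := contMDiffAt_coordDiff hφ hy hp
  have hqm := fun k => (hq k).mdifferentiableAt (n := ∞) (by simp)
  have hqd : ∀ k, DifferentiableAt ℝ (p.coord φ k) (φ y) := fun k =>
    (contDiffAt_comp_chart_symm hφ hy (hq k)).differentiableAt (by simp)
  have hG : ∀ i j, DifferentiableAt ℝ (g.coord φ i j) (φ y) := fun i j =>
    (contDiffAt_comp_chart_symm hφ hy (g.smoothAt_apply (hX i) (hX j))).differentiableAt (by simp)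
  set F : Fin 3 → VField M := fun k => (fun z => coordDiff φ k z (p z)) • chartField φ k with hF
  have hFd : ∀ k, DiffFieldAt (F k) y := fun k => MDifferentiableAt.smul_section (hqm k) (hd k)
  have hFk : ∀ k, g.koszul (F k) (chartField φ i) (chartField φ j) y =
      p.coord φ k (φ y) * g.koszul (chartField φ k) (chartField φ i) (chartField φ j) y +
      2 * pd i (p.coord φ k) (φ y) * g.coord φ k j (φ y) := by
    intro k
    rw [hF, g.koszul_smul (hqm k) (hd k) (hd i) (hd j), mvfderiv_chartField hφ hy i _ (hqm k),
      VField.coord_apply hy, g.coord_apply hy]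
    rfl
  have hpF : p =ᶠ[𝓝 y] F 0 + F 1 + F 2 := by
    filter_upwards [φ.open_source.mem_nhds hy] with z hz
    have := sum_coordDiff_smul hφ hz (p z)
    rw [Fin.sum_univ_three] at this
    exact this.symm
  -- The expansion of p holds only on the chart domain, so the Koszul expression has to be seen to
  -- depend only on the germ of its first argument.
  have hpk : g.koszul p (chartField φ i) (chartField φ j) y =
      g.koszul (F 0 + F 1 + F 2) (chartField φ i) (chartField φ j) y := by
    have e1 : ∀ (W : VField M) (v : TangentSpace (𝓡 3) y),
        g.deriv p W y v = g.deriv (F 0 + F 1 + F 2) W y v := by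
      intro W v
      have : (fun z => g.form z (p z) (W z)) =ᶠ[𝓝 y]
          fun z => g.form z ((F 0 + F 1 + F 2) z) (W z) := by
        filter_upwards [hpF] with z hz
        rw [hz]
      unfold LorentzMetric.deriv mvfderiv
      rw [this.mfderiv_eq]
      rfl
    have e2 : mlieBracket (𝓡 3) p (chartField φ j) y =
        mlieBracket (𝓡 3) (F 0 + F 1 + F 2) (chartField φ j) y :=
      hpF.mlieBracket_vectorField_eq (EventuallyEq.refl _ _)
    have e3 : mlieBracket (𝓡 3) (chartField φ i) p y =
        mlieBracket (𝓡 3) (chartField φ i) (F 0 + F 1 + F 2) y :=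
      (EventuallyEq.refl _ _).mlieBracket_vectorField_eq hpF
    simp only [LorentzMetric.koszul, e1, g.deriv_comm _ p, g.deriv_comm _ (F 0 + F 1 + F 2),
      hpF.self_of_nhds, e2, e3]
  have hlow : ∀ i j, pd i (lower (g.coord φ) (p.coord φ) j) (φ y) =
      ∑ k, (pd i (p.coord φ k) (φ y) * g.coord φ k j (φ y) +
        p.coord φ k (φ y) * pd i (g.coord φ k j) (φ y)) := by
    intro i j
    have e : lower (g.coord φ) (p.coord φ) j = fun z => (p.coord φ 0 z * g.coord φ 0 j z +
        p.coord φ 1 z * g.coord φ 1 j z) + p.coord φ 2 z * g.coord φ 2 j z := by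
      ext z; simp [lower, Fin.sum_univ_three]
    rw [e, pd_add i (((hqd 0).fun_mul (hG 0 j)).fun_add ((hqd 1).fun_mul (hG 1 j)))
      ((hqd 2).fun_mul (hG 2 j)), pd_add i ((hqd 0).fun_mul (hG 0 j)) ((hqd 1).fun_mul (hG 1 j)),
      pd_mul i (hqd 0) (hG 0 j), pd_mul i (hqd 1) (hG 1 j), pd_mul i (hqd 2) (hG 2 j),
      Fin.sum_univ_three]
  have hGs : ∀ i j k, pd k (g.coord φ i j) (φ y) = pd k (g.coord φ j i) (φ y) := by
    intro i j k
    congr 1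
    ext z
    exact g.symm _ _ _
  have hGs' : ∀ i j, g.coord φ i j (φ y) = g.coord φ j i (φ y) := fun i j => g.symm _ _ _
  rw [hD.two_mul_form g hp.diffFieldAt (hd i) (hd j), hpk,
    g.koszul_add (mdifferentiableAt_add_section (hFd 0) (hFd 1)) (hFd 2) (hd i) (hd j),
    g.koszul_add (hFd 0) (hFd 1) (hd i) (hd j), hFk, hFk, hFk, hlow, hlow]
  simp only [koszul_chartField g hφ hy, Fin.sum_univ_three]
  rw [hGs' 0 i, hGs' 1 i, hGs' 2 i, hGs 0 i, hGs 1 i, hGs 2 i]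
  ring

end Coordinates

/-! ### The Kundt equation as a pair of equations for L_p g and dp♭. -/

section KundtCoordinates

variable {M : Type*} [TopologicalSpace M] [ChartedSpace E3 M] [IsManifold (𝓡 3) ∞ M]
  (g : LorentzMetric M)
  {φ : OpenPartialHomeomorph M E3} (hφ : φ ∈ IsManifold.maximalAtlas (𝓡 3) ∞ M) {y : M}
  (hy : y ∈ φ.source) {p : VField M} {D : AffConn M} {o : SmoothOrientation M} {a : ℝ}

include hφ hy

lemma volForm_chartField (X : TangentSpace (𝓡 3) y) (i j : Fin 3) :
    volForm g o y ![chartField φ i y, X, chartField φ j y] = volCoord g o φ (φ y) *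
      Matrix.det (Matrix.of ![Pi.single i 1, fun k => coordDiff φ k y X, Pi.single j 1]) := by
  rw [volForm_eq_det g hφ hy]
  congr 2
  ext k l
  fin_cases k <;> simp [coordDiff_chartField hφ hy, Pi.single_apply]

/-- A Kundt field satisfies the Kundt equation in coordinates. -/
lemma kundtAt_of_kundtEquation (hD : IsLeviCivita g D) (hp : SmoothFieldAt p y)
    (hnull : g.form y (p y) (p y) = 0) (hK : KundtEquation g D p (a • volForm g o)) :
    KundtAt a (g.coord φ) (p.coord φ) (volCoord g o φ) (φ y) := by
  have hX := fun i => chartField_smoothFieldAt hφ hy i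
  have key : ∀ i j, 2 * g.form y (D p y (chartField φ i y)) (chartField φ j y) =
      -2 * (lower (g.coord φ) (p.coord φ) i (φ y) * lower (g.coord φ) (p.coord φ) j (φ y)) -
      a * (volCoord g o φ (φ y) * Matrix.det
        (Matrix.of ![Pi.single i 1, fun k => p.coord φ k (φ y), Pi.single j 1])) := by
    intro i j
    have h1 := hK y (chartField φ i y) (chartField φ j y)
    have h2 : (a • volForm g o) y ![chartField φ i y, p y, chartField φ j y] =
        a * (volForm g o y ![chartField φ i y, p y, chartField φ j y]) := rfl
    rw [h2, volForm_chartField g hφ hy] at h1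
    simp only [VField.coord_apply hy]
    rw [h1, g.symm y _ (p y), ← lower_coord g hφ hy, ← lower_coord g hφ hy]
    ring
  -- The volume term changes sign under exchange of i and j while the term in p♭⊗p♭ does not. Half
  -- the sum and half the difference of the equations for (i,j) and (j,i) therefore separate the two
  -- parts.
  have hdet : ∀ i j : Fin 3, Matrix.det
        (Matrix.of ![Pi.single i 1, fun k => p.coord φ k (φ y), Pi.single j 1]) = -Matrix.det
        (Matrix.of ![Pi.single j 1, fun k => p.coord φ k (φ y), Pi.single i 1]) := by
    intro i j
    simp only [Matrix.det_fin_three, Matrix.of_apply, Matrix.cons_val]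
    ring
  have hGs' : ∀ i j, g.coord φ i j = g.coord φ j i := fun i j => by
    ext z; exact g.symm _ _ _
  refine ⟨fun i j => contDiffAt_comp_chart_symm hφ hy (g.smoothAt_apply (hX i) (hX j)),
    fun i => contDiffAt_comp_chart_symm hφ hy (contMDiffAt_coordDiff hφ hy hp i),
    fun i j => by rw [hGs'], volCoord_sq g hφ hy o, volCoord_ne_zero g hφ hy o, ?_, ?_, ?_⟩
  · rw [g.form_eq_sum hφ hy] at hnull
    rw [← hnull, Finset.sum_comm]
    refine Finset.sum_congr rfl fun j _ => ?_
    rw [lower, Finset.mul_sum]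
    refine Finset.sum_congr rfl fun i _ => ?_
    rw [VField.coord_apply hy, VField.coord_apply hy]
    ring
  · intro i j
    have h1 := hD.two_mul_form_chartField g hφ hy hp i j
    have h2 := hD.two_mul_form_chartField g hφ hy hp j i
    have h3 : ∑ k, g.coord φ j k (φ y) * pd i (p.coord φ k) (φ y) =
      ∑ k, g.coord φ k j (φ y) * pd i (p.coord φ k) (φ y) := by simp only [hGs' j]
    have h4 : ∑ k, g.coord φ k i (φ y) * pd j (p.coord φ k) (φ y) =
      ∑ k, g.coord φ i k (φ y) * pd j (p.coord φ k) (φ y) := by simp only [hGs' i]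
    rw [key] at h1 h2
    rw [hdet j i] at h2
    rw [hGs' j i, h3, h4] at h2
    linear_combination -1/2 * h1 - 1/2 * h2
  · intro i j
    have h1 := hD.two_mul_form_chartField g hφ hy hp i j
    have h2 := hD.two_mul_form_chartField g hφ hy hp j i
    have h3 : ∑ k, g.coord φ j k (φ y) * pd i (p.coord φ k) (φ y) =
      ∑ k, g.coord φ k j (φ y) * pd i (p.coord φ k) (φ y) := by simp only [hGs' j]
    have h4 : ∑ k, g.coord φ k i (φ y) * pd j (p.coord φ k) (φ y) =
      ∑ k, g.coord φ i k (φ y) * pd j (p.coord φ k) (φ y) := by simp only [hGs' i]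
    rw [key] at h1 h2
    rw [hdet j i] at h2
    rw [hGs' j i, h3, h4] at h2
    linear_combination -1/2 * h1 + 1/2 * h2

/-- The Kundt equation at a point follows from its symmetric and skew-symmetric parts in
coordinates. -/
lemma kundtEquation_of_coord (hD : IsLeviCivita g D) (hp : SmoothFieldAt p y)
    (lie : ∀ i j, (∑ k, p.coord φ k (φ y) * pd k (g.coord φ i j) (φ y)) +
      (∑ k, g.coord φ k j (φ y) * pd i (p.coord φ k) (φ y)) +
      (∑ k, g.coord φ i k (φ y) * pd j (p.coord φ k) (φ y)) =
      -2 * (lower (g.coord φ) (p.coord φ) i (φ y) * lower (g.coord φ) (p.coord φ) j (φ y)))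
    (curl : ∀ i j, pd i (lower (g.coord φ) (p.coord φ) j) (φ y) -
      pd j (lower (g.coord φ) (p.coord φ) i) (φ y) =
      -(a * (volCoord g o φ (φ y) * Matrix.det
        (Matrix.of ![Pi.single i 1, fun k => p.coord φ k (φ y), Pi.single j 1]))))
    (X Z : TangentSpace (𝓡 3) y) :
    g.form y (D p y X) Z =
      -(g.form y X (p y) * g.form y (p y) Z) - 1 / 2 * (a • volForm g o) y ![X, p y, Z] := by
  have key : ∀ i j, g.form y (D p y (chartField φ i y)) (chartField φ j y) =
      -(g.form y (p y) (chartField φ i y) * g.form y (p y) (chartField φ j y)) -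
      a / 2 * (volCoord g o φ (φ y) * Matrix.det
        (Matrix.of ![Pi.single i 1, fun k => coordDiff φ k y (p y), Pi.single j 1])) := by
    intro i j
    have h1 := hD.two_mul_form_chartField g hφ hy hp i j
    rw [lie, curl] at h1
    rw [← lower_coord g hφ hy, ← lower_coord g hφ hy]
    simp only [← VField.coord_apply hy]
    linear_combination 1/2 * h1
  have h2 : (a • volForm g o) y ![X, p y, Z] = a * (volForm g o y ![X, p y, Z]) := rfl
  rw [h2, volForm_eq_det g hφ hy]
  have hXZ : g.form y (D p y X) Z = ∑ i, ∑ j, coordDiff φ i y X * (coordDiff φ j y Z *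
      g.form y (D p y (chartField φ i y)) (chartField φ j y)) := by
    conv_lhs => rw [← sum_coordDiff_smul hφ hy X, ← sum_coordDiff_smul hφ hy Z]
    simp only [map_sum, map_smul, sum_apply, smul_apply, smul_eq_mul, Finset.mul_sum]
    rw [Finset.sum_comm]
    refine Finset.sum_congr rfl fun i _ => Finset.sum_congr rfl fun j _ => by ring
  have hP : ∀ Z, g.form y (p y) Z = ∑ j, coordDiff φ j y Z * g.form y (p y) (chartField φ j y) := by
    intro Z
    conv_lhs => rw [← sum_coordDiff_smul hφ hy Z]
    simp only [map_sum, map_smul, smul_eq_mul]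
  rw [hXZ, g.symm y X (p y), hP X, hP Z]
  simp only [key, Fin.sum_univ_three, Matrix.det_fin_three, Matrix.of_apply, Matrix.cons_val,
    Pi.single_apply, Fin.isValue, Fin.reduceEq, if_true, if_false]
  ring

end KundtCoordinates

/-! ### A metric in normal form satisfies the Kundt equation. -/

section KundtChart

/-- The components of the metric of a Kundt chart. -/
def kundtMatrix (a : ℝ) (C : ℝ × ℝ → ℝ) (z : E3) : Matrix (Fin 3) (Fin 3) ℝ :=
  !![0, 0, 1; 0, 1, a * z 0; 1, a * z 0, -2 * z 0 * Real.exp (-a * z 1) + C (z 1, z 2)]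

lemma differentiableAt_coord (j : Fin 3) (z : E3) : DifferentiableAt ℝ (fun z : E3 => z j) z :=
  (EuclideanSpace.proj j : E3 →L[ℝ] ℝ).differentiableAt

lemma pd_exp_coord (a : ℝ) (i : Fin 3) (z : E3) :
    pd i (fun z => Real.exp (-a * z 1)) z = if i = 1 then -a * Real.exp (-a * z 1) else 0 := by
  have h : HasFDerivAt (fun z : E3 => Real.exp (-a * z 1))
      (Real.exp (-a * z 1) • (-a) • (EuclideanSpace.proj 1 : E3 →L[ℝ] ℝ)) z :=
    (((EuclideanSpace.proj 1 : E3 →L[ℝ] ℝ).hasFDerivAt (x := z)).const_mul (-a)).exp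
  rw [pd, h.fderiv]
  fin_cases i <;> simp [stdVec, mul_comm]

lemma differentiableAt_exp_coord (a : ℝ) (z : E3) :
    DifferentiableAt ℝ (fun z : E3 => Real.exp (-a * z 1)) z :=
  ((differentiableAt_coord 1 z).const_mul (-a)).exp

/-- Since p is a multiple of ∂_v, L_p g involves only the v-derivative of the metric components, in
which C disappears. -/
lemma pd_zero_kundtMatrix (a : ℝ) {C : ℝ × ℝ → ℝ} {z : E3}
    (hC : DifferentiableAt ℝ C (z 1, z 2)) (i j : Fin 3) :
    pd 0 (fun z => kundtMatrix a C z i j) z =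
      !![0, 0, 0; 0, 0, a; 0, a, -2 * Real.exp (-a * z 1)] i j := by
  have hC' : HasFDerivAt (fun z : E3 => C (z 1, z 2)) ((fderiv ℝ C (z 1, z 2)).comp
      ((EuclideanSpace.proj 1 : E3 →L[ℝ] ℝ).prod (EuclideanSpace.proj 2 : E3 →L[ℝ] ℝ))) z :=
    HasFDerivAt.comp z (g := C) (f := fun z : E3 => (z 1, z 2)) hC.hasFDerivAt
      ((EuclideanSpace.proj 1 : E3 →L[ℝ] ℝ).prod (EuclideanSpace.proj 2 : E3 →L[ℝ] ℝ)).hasFDerivAt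
  have h1 : pd 0 (fun z : E3 => C (z 1, z 2)) z = 0 := by
    rw [pd, hC'.fderiv]
    simp only [stdVec, ContinuousLinearMap.comp_apply, ContinuousLinearMap.prod_apply]
    refine (congrArg (fderiv ℝ C (z 1, z 2)) ?_).trans (map_zero _)
    ext <;> simp
  have h2 : pd 0 (fun z : E3 => -2 * z 0 * Real.exp (-a * z 1) + C (z 1, z 2)) z =
      -2 * Real.exp (-a * z 1) := by
    rw [pd_add 0 (((differentiableAt_coord 0 z).const_mul (-2)).fun_mul
      (differentiableAt_exp_coord a z)) hC'.differentiableAt, h1,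
      pd_mul 0 ((differentiableAt_coord 0 z).const_mul (-2)) (differentiableAt_exp_coord a z),
      pd_const_mul 0 (-2) (differentiableAt_coord 0 z), pd_coord, pd_exp_coord]
    simp
  have h3 : pd 0 (fun z : E3 => a * z 0) z = a := by
    rw [pd_const_mul 0 a (differentiableAt_coord 0 z), pd_coord]
    simp
  fin_cases i <;> fin_cases j <;> simp [kundtMatrix, pd_const, h3]
  simpa using h2

variable {M : Type*} [TopologicalSpace M] [ChartedSpace E3 M] [IsManifold (𝓡 3) ∞ M]
  {g : LorentzMetric M} {φ : OpenPartialHomeomorph M E3}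
  (hφ : φ ∈ IsManifold.maximalAtlas (𝓡 3) ∞ M) {y : M}
  (hy : y ∈ φ.source) {p : VField M} {D : AffConn M} {o : SmoothOrientation M} {a : ℝ}
  {C : ℝ × ℝ → ℝ}

/-- The set of values (x,u) is open because a surjective linear projection is an open map, so
smoothness on it yields differentiability at its points. -/
lemma differentiableAt_of_contDiffOn_image
    (hC : ContDiffOn ℝ ∞ C ((fun y => (φ y 1, φ y 2)) '' φ.source)) (hy : y ∈ φ.source) :
    DifferentiableAt ℝ C (φ y 1, φ y 2) := by
  let L : E3 →L[ℝ] ℝ × ℝ :=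
    (EuclideanSpace.proj 1 : E3 →L[ℝ] ℝ).prod (EuclideanSpace.proj 2 : E3 →L[ℝ] ℝ)
  have hL : Function.Surjective L := fun w => ⟨!₂[0, w.1, w.2], by ext <;> simp [L]⟩
  have ho : IsOpen ((fun y => (φ y 1, φ y 2)) '' φ.source) := by
    have h := L.isOpenMap hL _ φ.open_target
    rw [← φ.image_source_eq_target, image_image] at h
    exact h
  exact (hC.contDiffAt (ho.mem_nhds ⟨y, hy, rfl⟩)).differentiableAt (by simp)

include hφ hy

lemma IsKundtChart.coord_eq (h : IsKundtChart g o p a φ C) (i j : Fin 3) :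
    g.coord φ i j (φ y) = kundtMatrix a C (φ y) i j := by
  rw [g.coord_apply hy, h.metric y hy]
  simp only [coordDiff_chartField hφ hy]
  fin_cases i <;> fin_cases j <;> simp [kundtMatrix]

omit hφ in
lemma IsKundtChart.field_eq (h : IsKundtChart g o p a φ C) (i : Fin 3) :
    p.coord φ i (φ y) = (![fun z => Real.exp (-a * z 1), fun _ => 0, fun _ => 0] :
      Fin 3 → E3 → ℝ) i (φ y) := by
  obtain ⟨h0, h1, h2⟩ := h.field y hy
  rw [VField.coord_apply hy]
  fin_cases i
  exacts [h0, h1, h2]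

/-- The chart lists the coordinates as (v,x,u), an odd permutation of the positive order (x,v,u). -/
lemma IsKundtChart.volCoord_eq (h : IsKundtChart g o p a φ C) : volCoord g o φ (φ y) = -1 := by
  rw [volCoord_apply g hy, h.oriented y hy]
  simp [coordDiff_chartField hφ hy, Matrix.det_fin_three]

omit hφ hy in
lemma eventually_of_forall_source {P : E3 → Prop} (hy : y ∈ φ.source)
    (h : ∀ z ∈ φ.source, P (φ z)) : ∀ᶠ z in 𝓝 (φ y), P z := by
  filter_upwards [φ.open_target.mem_nhds (φ.map_source hy)] with z hz
  have := h _ (φ.map_target hz)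
  rwa [φ.right_inv hz] at this

lemma IsKundtChart.isotropic (h : IsKundtChart g o p a φ C) :
    p y ≠ 0 ∧ g.form y (p y) (p y) = 0 := by
  obtain ⟨h0, h1, h2⟩ := h.field y hy
  constructor
  · intro h3
    rw [h3, map_zero] at h0
    exact (Real.exp_pos _).ne h0
  · rw [h.metric y hy, h1, h2]
    ring

/-- Here p♭ = e^{-ax}du, so dp♭ = -a e^{-ax} dx∧du. In L_p g the mixed dx du terms from av and from
the derivative of e^{-ax} cancel, leaving -2e^{-2ax}(du)². -/
lemma IsKundtChart.kundtEquation (h : IsKundtChart g o p a φ C) (hD : IsLeviCivita g D)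
    (hp : SmoothFieldAt p y)
    (hC : ContDiffOn ℝ ∞ C ((fun y => (φ y 1, φ y 2)) '' φ.source)) (X Z : TangentSpace (𝓡 3) y) :
    g.form y (D p y X) Z =
      -(g.form y X (p y) * g.form y (p y) Z) - 1 / 2 * (a • volForm g o) y ![X, p y, Z] := by
  have hG : ∀ i j, g.coord φ i j =ᶠ[𝓝 (φ y)] fun z => kundtMatrix a C z i j := fun i j =>
    eventually_of_forall_source hy fun z hz => h.coord_eq hφ hz i j
  have hq : ∀ i, p.coord φ i =ᶠ[𝓝 (φ y)] (![fun z => Real.exp (-a * z 1), fun _ => 0, fun _ => 0] :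
      Fin 3 → E3 → ℝ) i := fun i =>
    eventually_of_forall_source hy fun z hz => h.field_eq hz i
  have hl : ∀ i, lower (g.coord φ) (p.coord φ) i =ᶠ[𝓝 (φ y)]
      (![fun _ => 0, fun _ => 0, fun z => Real.exp (-a * z 1)] : Fin 3 → E3 → ℝ) i := by
    intro i
    refine eventually_of_forall_source hy fun z hz => ?_
    simp only [lower, h.coord_eq hφ hz, h.field_eq hz, Fin.sum_univ_three]
    fin_cases i <;> simp [kundtMatrix]
  have hC' := differentiableAt_of_contDiffOn_image hC hy
  have e0 : p.coord φ 0 (φ y) = Real.exp (-a * φ y 1) := h.field_eq hy 0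
  have e1 : p.coord φ 1 (φ y) = 0 := h.field_eq hy 1
  have e2 : p.coord φ 2 (φ y) = 0 := h.field_eq hy 2
  have f0 : ∀ i, pd i (p.coord φ 0) (φ y) = if i = 1 then -a * Real.exp (-a * φ y 1) else 0 :=
    fun i => (pd_congr i (hq 0)).trans (pd_exp_coord a i _)
  have f1 : ∀ i, pd i (p.coord φ 1) (φ y) = 0 := fun i => (pd_congr i (hq 1)).trans (pd_const i 0)
  have f2 : ∀ i, pd i (p.coord φ 2) (φ y) = 0 := fun i => (pd_congr i (hq 2)).trans (pd_const i 0)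
  have l0 : lower (g.coord φ) (p.coord φ) 0 (φ y) = 0 := (hl 0).self_of_nhds
  have l1 : lower (g.coord φ) (p.coord φ) 1 (φ y) = 0 := (hl 1).self_of_nhds
  have l2 : lower (g.coord φ) (p.coord φ) 2 (φ y) = Real.exp (-a * φ y 1) := (hl 2).self_of_nhds
  have m0 : ∀ i, pd i (lower (g.coord φ) (p.coord φ) 0) (φ y) = 0 := fun i =>
    (pd_congr i (hl 0)).trans (pd_const i 0)
  have m1 : ∀ i, pd i (lower (g.coord φ) (p.coord φ) 1) (φ y) = 0 := fun i =>
    (pd_congr i (hl 1)).trans (pd_const i 0)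
  have m2 : ∀ i, pd i (lower (g.coord φ) (p.coord φ) 2) (φ y) =
      if i = 1 then -a * Real.exp (-a * φ y 1) else 0 :=
    fun i => (pd_congr i (hl 2)).trans (pd_exp_coord a i _)
  refine kundtEquation_of_coord g hφ hy hD hp ?_ ?_ X Z
  · intro i j
    simp only [Fin.sum_univ_three, e0, e1, e2, f0, f1, f2, h.coord_eq hφ hy,
      (pd_congr 0 (hG i j)).trans (pd_zero_kundtMatrix a hC' i j)]
    fin_cases i <;> fin_cases j <;> simp [kundtMatrix, l0, l1, l2] <;> ring
  · intro i j
    rw [h.volCoord_eq hφ hy]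
    simp only [Matrix.det_fin_three, Matrix.of_apply, Matrix.cons_val, e0, e1, e2]
    fin_cases i <;> fin_cases j <;> simp [m0, m1, m2]

end KundtChart

/-! ### Change of charts and the existence of normal form charts. -/

section ChartChange

variable {M : Type*} [TopologicalSpace M] [ChartedSpace E3 M] [IsManifold (𝓡 3) ∞ M]
  (g : LorentzMetric M) {φ : OpenPartialHomeomorph M E3}
  (hφ : φ ∈ IsManifold.maximalAtlas (𝓡 3) ∞ M) {y : M} {p : VField M}
  {e : OpenPartialHomeomorph E3 E3}

include hφ

lemma coordDiff_trans (he : e ∈ contDiffGroupoid ∞ (𝓡 3)) (hy : y ∈ (φ ≫ₕ e).source) (k : Fin 3)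
    (X : TangentSpace (𝓡 3) y) :
    coordDiff (φ ≫ₕ e) k y X = ∑ i, coordDiff φ i y X * pd i (fun z => e z k) (φ y) := by
  have hψ := trans_mem_maximalAtlas hφ he
  have hy' : y ∈ φ.source := by
    rw [OpenPartialHomeomorph.trans_source] at hy
    exact hy.1
  conv_lhs => rw [← sum_coordDiff_smul hφ hy' X]
  rw [map_sum]
  refine Finset.sum_congr rfl fun i _ => ?_
  rw [map_smul, smul_eq_mul]
  congr 1
  refine (mvfderiv_chartField hφ hy' i _
    ((contMDiffAt_chart_coord hψ hy k).mdifferentiableAt (n := ∞) (by simp))).trans (pd_congr i ?_)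
  refine eventually_of_forall_source hy' fun z hz => ?_
  simp [φ.left_inv hz]

lemma coordDiff_chartField_trans_symm (he : e ∈ contDiffGroupoid ∞ (𝓡 3))
    (hy : y ∈ (φ ≫ₕ e.symm).source) (i j : Fin 3) :
    coordDiff φ i y (chartField (φ ≫ₕ e.symm) j y) = pd j (fun z => e z i) (e.symm (φ y)) := by
  have hψ := trans_mem_maximalAtlas hφ ((contDiffGroupoid ∞ (𝓡 3)).symm he)
  have hy' : y ∈ φ.source := by
    rw [OpenPartialHomeomorph.trans_source] at hy
    exact hy.1
  refine (mvfderiv_chartField hψ hy j _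
    ((contMDiffAt_chart_coord hφ hy' i).mdifferentiableAt (n := ∞) (by simp))).trans (pd_congr j ?_)
  refine eventually_of_forall_source hy fun z hz => ?_
  rw [OpenPartialHomeomorph.trans_source] at hz
  have h2 : φ z ∈ e.target := hz.2
  simp [φ.left_inv hz.1, e.right_inv h2]

lemma form_chartField_trans_symm (he : e ∈ contDiffGroupoid ∞ (𝓡 3))
    (hy : y ∈ (φ ≫ₕ e.symm).source) (j : Fin 3) :
    g.form y (p y) (chartField (φ ≫ₕ e.symm) j y) =
      ∑ i, lower (g.coord φ) (p.coord φ) i (φ y) * pd j (fun z => e z i) (e.symm (φ y)) := by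
  have hy' : y ∈ φ.source := by
    rw [OpenPartialHomeomorph.trans_source] at hy
    exact hy.1
  conv_lhs => rw [← sum_coordDiff_smul hφ hy' (chartField (φ ≫ₕ e.symm) j y)]
  rw [map_sum]
  refine Finset.sum_congr rfl fun i _ => ?_
  rw [map_smul, smul_eq_mul, coordDiff_chartField_trans_symm hφ he hy, lower_coord g hφ hy',
    mul_comm]

omit hφ in
/-- Around each point there is a chart such that the last coordinate field is not orthogonal to a
given nonzero vector. -/
lemma exists_chart_form_pos (x₀ : M) (hp : p x₀ ≠ 0) :
    ∃ φ ∈ IsManifold.maximalAtlas (𝓡 3) ∞ M, x₀ ∈ φ.source ∧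
      0 < g.form x₀ (p x₀) (chartField φ 2 x₀) := by
  set φ := chartAt E3 x₀ with hφdef
  have hφ : φ ∈ IsManifold.maximalAtlas (𝓡 3) ∞ M := IsManifold.chart_mem_maximalAtlas x₀
  have hx : x₀ ∈ φ.source := mem_chart_source E3 x₀
  obtain ⟨k, hk⟩ : ∃ k, g.form x₀ (p x₀) (chartField φ k x₀) ≠ 0 := by
    by_contra! h
    refine hp (g.eq_zero_of_forall fun w => ?_)
    rw [← sum_coordDiff_smul hφ hx w, map_sum]
    simp [h]
  obtain ⟨ε, hε, hpos⟩ : ∃ ε : ℝ, ε * ε = 1 ∧ 0 < ε * g.form x₀ (p x₀) (chartField φ k x₀) := by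
    rcases lt_or_gt_of_ne hk with h | h
    · exact ⟨-1, by norm_num, by linarith⟩
    · exact ⟨1, by norm_num, by linarith⟩
  -- An involution that exchanges the coordinates 2 and k and multiplies by the sign ε; after it the
  -- last coordinate field is ε times the old k-th one.
  let L : E3 →L[ℝ] E3 := LinearMap.toContinuousLinearMap
    { toFun := fun z => WithLp.toLp 2 fun i => ε * z (Equiv.swap 2 k i)
      map_add' := fun z w => by ext; simp [mul_add]
      map_smul' := fun c z => by ext; simp; ring }
  have hL : ∀ z i, L z i = ε * z (Equiv.swap 2 k i) := fun z i => rfl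
  have hLL : ∀ z, L (L z) = z := fun z => by
    ext i
    rw [hL, hL, Equiv.swap_apply_self, ← mul_assoc, hε, one_mul]
  obtain ⟨e, hz, -, heq, -, he⟩ := exists_localDiffeo (Φ := L) (z₀ := L (φ x₀)) (s := univ)
    (Eventually.of_forall fun z => L.contDiff.contDiffAt)
    (by rw [L.fderiv]; exact (Function.LeftInverse.injective hLL)) univ_mem
  have hs : x₀ ∈ (φ ≫ₕ e.symm).source := by
    rw [OpenPartialHomeomorph.trans_source]
    refine ⟨hx, ?_⟩
    have := e.map_source hz
    rwa [heq, hLL] at this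
  refine ⟨φ ≫ₕ e.symm, trans_mem_maximalAtlas hφ ((contDiffGroupoid ∞ (𝓡 3)).symm he), hs, ?_⟩
  rw [form_chartField_trans_symm g hφ he hs]
  have hpd : ∀ i z, pd 2 (fun z => e z i) z = if i = k then ε else 0 := by
    intro i z
    have : (fun z => e z i) = fun z => ε * z (Equiv.swap 2 k i) := by
      funext z; rw [heq, hL]
    rw [this, pd_const_mul 2 ε (differentiableAt_coord _ z), pd_coord]
    by_cases h : i = k
    · subst h; simp
    · have : (2 : Fin 3) ≠ Equiv.swap 2 k i := by
        intro h2
        have := congrArg (Equiv.swap 2 k) h2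
        rw [Equiv.swap_apply_self, Equiv.swap_apply_left] at this
        exact h this.symm
      simp [h, this]
  simp only [hpd, mul_ite, mul_zero, Finset.sum_ite_eq', Finset.mem_univ, if_true]
  rwa [lower_coord g hφ hx, mul_comm]

omit hφ in
/-- The normal form of a Kundt field. -/
theorem exists_kundtChart {D : AffConn M} {o : SmoothOrientation M} {a : ℝ} (ha : a ≠ 0)
    (hD : IsLeviCivita g D) (hp : SmoothField p) (hiso : IsIsotropic g p)
    (hK : KundtEquation g D p (a • volForm g o)) (x₀ : M) :
    ∃ φ ∈ IsManifold.maximalAtlas (𝓡 3) ∞ M, x₀ ∈ φ.source ∧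
      ∃ C : ℝ × ℝ → ℝ, ContDiffOn ℝ ∞ C ((fun y => (φ y 1, φ y 2)) '' φ.source) ∧
        IsKundtChart g o p a φ C := by
  have hkundt : ∀ φ ∈ IsManifold.maximalAtlas (𝓡 3) ∞ M, ∀ x ∈ φ.source,
      ∀ᶠ z in 𝓝 (φ x), KundtAt a (g.coord φ) (p.coord φ) (volCoord g o φ) z := fun φ hφ x hx =>
    eventually_of_forall_source hx fun z hz => kundtAt_of_kundtEquation g hφ hz hD
      (hp.smoothFieldAt z) (hiso z).2 hK
  obtain ⟨φ, hφ, hx, hpos⟩ := exists_chart_form_pos g x₀ (hiso x₀).1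
  rw [← lower_coord g hφ hx] at hpos
  obtain ⟨e, he, hze, hez, hadapt, hpos'⟩ := exists_adapted_chart (hkundt φ hφ x₀ hx) hpos
  -- `e` runs from the adapted to the old coordinates, hence the inverse.
  set ψ := φ ≫ₕ e.symm with hψdef
  have hψ : ψ ∈ IsManifold.maximalAtlas (𝓡 3) ∞ M :=
    trans_mem_maximalAtlas hφ ((contDiffGroupoid ∞ (𝓡 3)).symm he)
  have hxψ : x₀ ∈ ψ.source := by
    rw [hψdef, OpenPartialHomeomorph.trans_source]
    refine ⟨hx, ?_⟩
    have := e.map_source hze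
    rwa [hez] at this
  have hlow : ∀ y ∈ ψ.source, e.symm (φ y) ∈ e.source ∧ e (e.symm (φ y)) = φ y ∧
      ∀ j, lower (g.coord ψ) (p.coord ψ) j (ψ y) =
      ∑ i, lower (g.coord φ) (p.coord φ) i (φ y) * pd j (fun z => e z i) (e.symm (φ y)) := by
    intro y hy
    have hy2 := hy
    rw [hψdef, OpenPartialHomeomorph.trans_source] at hy2
    have h2 : φ y ∈ e.target := hy2.2
    exact ⟨e.map_target h2, e.right_inv h2, fun j => by
      rw [lower_coord g hψ hy, form_chartField_trans_symm g hφ he hy]⟩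
  have hl0 : lower (g.coord ψ) (p.coord ψ) 0 =ᶠ[𝓝 (ψ x₀)] 0 :=
    eventually_of_forall_source hxψ fun y hy => by
      obtain ⟨h1, h2, h3⟩ := hlow y hy
      have := (hadapt _ h1).2.1
      rw [h2] at this
      rw [h3, this]; rfl
  have hl1 : lower (g.coord ψ) (p.coord ψ) 1 =ᶠ[𝓝 (ψ x₀)] 0 :=
    eventually_of_forall_source hxψ fun y hy => by
      obtain ⟨h1, h2, h3⟩ := hlow y hy
      have := (hadapt _ h1).2.2
      rw [h2] at this
      rw [h3, this]; rfl
  have hl2 : 0 < lower (g.coord ψ) (p.coord ψ) 2 (ψ x₀) := by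
    obtain ⟨h1, h2, h3⟩ := hlow x₀ hxψ
    have hxe : e.symm (φ x₀) = φ x₀ := by
      conv_lhs => rw [← hez]
      exact e.left_inv hze
    rw [h3, hxe]
    rwa [hez] at hpos'
  obtain ⟨f, C₀, C, hf, hzf, hsub, hC, hnf⟩ := exists_normalForm_chart ha (hkundt ψ hψ x₀ hxψ)
    hl0 hl1 hl2 (ψ.open_target.mem_nhds (ψ.map_source hxψ))
  have hsrc : ∀ y ∈ (ψ ≫ₕ f).source, y ∈ ψ.source ∧ ψ y ∈ f.source := by
    intro y hy
    rwa [OpenPartialHomeomorph.trans_source] at hy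
  refine ⟨ψ ≫ₕ f, trans_mem_maximalAtlas hψ hf, ?_, C, hC.mono ?_, ?_, ?_, ?_⟩
  · rw [OpenPartialHomeomorph.trans_source]
    exact ⟨hxψ, hzf⟩
  · rintro _ ⟨y, hy, rfl⟩
    exact ⟨f (ψ y), f.map_source (hsrc y hy).2, rfl⟩
  · intro y hy X Y
    obtain ⟨h1, h2⟩ := hsrc y hy
    obtain ⟨-, hn, hCy⟩ := hnf _ h2
    have hv : ∀ k, (ψ ≫ₕ f) y k = f (ψ y) k := fun k => rfl
    rw [g.form_eq_sum hψ h1]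
    simp only [coordDiff_trans hψ hf hy, hn.metric, hCy, hv, Fin.sum_univ_three]
    ring
  · intro y hy
    obtain ⟨h1, h2⟩ := hsrc y hy
    obtain ⟨-, hn, -⟩ := hnf _ h2
    simp only [coordDiff_trans hψ hf hy, ← VField.coord_apply h1]
    exact ⟨hn.field_v, hn.field_x, hn.field_u⟩
  · intro y hy X
    obtain ⟨h1, h2⟩ := hsrc y hy
    obtain ⟨-, hn, -⟩ := hnf _ h2
    rw [volForm_eq_det g hψ h1, hn.vol, mul_comm, ← Matrix.det_mul]
    congr 1
    ext i j
    rw [Matrix.of_apply, coordDiff_trans hψ hf hy, Matrix.mul_apply]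
    refine Finset.sum_congr rfl fun k _ => ?_
    rw [Matrix.of_apply, Matrix.of_apply]
    fin_cases j <;> rfl

end ChartChange

/-! ### Kundt fields: traces and norms in an orthonormal frame. -/

section KundtField

variable {M : Type*} [TopologicalSpace M] [ChartedSpace E3 M] [IsManifold (𝓡 3) ∞ M]
  (g : LorentzMetric M)

lemma lsign_mul_self (i : Fin 3) : lsign i * lsign i = 1 := by
  unfold lsign; split_ifs <;> norm_num

lemma LorentzMetric.form_frame_right (x : M) (X : TangentSpace (𝓡 3) x) (i : Fin 3) :
    g.form x X (g.frame x i) = lsign i * (g.frame x).repr X i := by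
  conv_lhs => rw [← (g.frame x).sum_repr X]
  simp only [map_sum, map_smul, sum_apply, smul_apply, g.frame_apply, smul_eq_mul, mul_ite,
    mul_zero, Finset.sum_ite_eq', Finset.mem_univ, if_true]
  ring

lemma LorentzMetric.form_eq_sum_repr (x : M) (X Y : TangentSpace (𝓡 3) x) :
    g.form x X Y = ∑ i, lsign i * (g.frame x).repr X i * (g.frame x).repr Y i := by
  conv_lhs => rw [← (g.frame x).sum_repr Y]
  simp only [map_sum, map_smul, smul_eq_mul, g.form_frame_right]
  exact Finset.sum_congr rfl fun i _ => by ring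

lemma LorentzMetric.trace_eq (x : M) (A : TangentSpace (𝓡 3) x →ₗ[ℝ] TangentSpace (𝓡 3) x) :
    LinearMap.trace ℝ _ A = ∑ i, lsign i * g.form x (A (g.frame x i)) (g.frame x i) := by
  rw [LinearMap.trace_eq_matrix_trace ℝ (g.frame x), Matrix.trace]
  refine Finset.sum_congr rfl fun i _ => ?_
  rw [g.form_frame_right, ← mul_assoc, lsign_mul_self, one_mul, Matrix.diag_apply,
    LinearMap.toMatrix_apply]

lemma exists_volForm_eq (o : SmoothOrientation M) (x : M) :
    ∃ ε : ℝ, ε * ε = 1 ∧ ∀ X, volForm g o x X = ε * (g.frame x).det X := by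
  unfold volForm
  split_ifs
  · exact ⟨1, by norm_num, fun X => by simp⟩
  · exact ⟨-1, by norm_num, fun X => by simp⟩

lemma form3_swap (S : Form3 M) (x : M) (X Y Z : TangentSpace (𝓡 3) x) :
    S x ![Z, Y, X] = -S x ![X, Y, Z] := by
  have h := (S x).map_swap (v := ![X, Y, Z]) (i := 0) (j := 2) (by decide)
  rw [← h]
  congr 1
  ext i : 1
  fin_cases i <;> rfl

lemma form3_left_eq (S : Form3 M) (x : M) (X Y : TangentSpace (𝓡 3) x) :
    S x ![X, X, Y] = 0 :=
  (S x).map_eq_zero_of_eq _ (i := 0) (j := 1) rfl (by decide)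

lemma form3_right_eq (S : Form3 M) (x : M) (X Y : TangentSpace (𝓡 3) x) :
    S x ![X, Y, Y] = 0 :=
  (S x).map_eq_zero_of_eq _ (i := 1) (j := 2) rfl (by decide)

lemma form3_outer_eq (S : Form3 M) (x : M) (X Y : TangentSpace (𝓡 3) x) :
    S x ![X, Y, X] = 0 :=
  (S x).map_eq_zero_of_eq _ (i := 0) (j := 2) rfl (by decide)

variable {g}

/-- The volume term vanishes when two of its arguments coincide, so it affects neither ∇^g_p p nor
the trace, which is -g(p,p). The symmetric part -p♭⊗p♭ has squared norm g(p,p)², and the squared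
norm of the skew part is a multiple of a² g(p,p). -/
theorem isKundtField_of_kundtEquation {D : AffConn M} {p : VField M} {o : SmoothOrientation M}
    {a : ℝ} (hp : SmoothField p) (hiso : IsIsotropic g p)
    (hK : KundtEquation g D p (a • volForm g o)) : IsKundtField g D p where
  smooth := hp
  isotropic := hiso
  geodesic x := g.eq_zero_of_forall fun Z => by
    rw [hK, (hiso x).2, form3_left_eq]
    ring
  expansion_free x := by
    have h := (hiso x).2
    rw [g.form_eq_sum_repr] at h
    rw [g.trace_eq]
    have hi (i : Fin 3) : g.form x ((D p x).toLinearMap (g.frame x i)) (g.frame x i) =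
        -((g.frame x).repr (p x) i * (g.frame x).repr (p x) i) := by
      change g.form x (D p x (g.frame x i)) (g.frame x i) = _
      rw [hK, form3_outer_eq, g.symm x _ (p x), g.form_frame_right]
      linear_combination (-(g.frame x).repr (p x) i * (g.frame x).repr (p x) i) * lsign_mul_self i
    simp only [hi]
    rw [← neg_eq_zero, ← Finset.sum_neg_distrib, ← h]
    exact Finset.sum_congr rfl fun i _ => by ring
  shear_free x := by
    have h := (hiso x).2
    rw [g.form_eq_sum_repr, Fin.sum_univ_three] at h
    have (X Y : TangentSpace (𝓡 3) x) :
        1 / 2 * (g.form x (D p x X) Y + g.form x (D p x Y) X) =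
          -(g.form x (p x) X * g.form x (p x) Y) := by
      rw [hK, hK, form3_swap _ x X, g.symm x X, g.symm x Y]
      ring
    simp only [normSq2, this]
    simp only [g.form_frame_right, Fin.sum_univ_three]
    simp only [lsign, Fin.isValue, Fin.reduceEq, if_true, if_false] at h ⊢
    linear_combination (-(g.frame x).repr (p x) 0 ^ 2 + (g.frame x).repr (p x) 1 ^ 2 +
      (g.frame x).repr (p x) 2 ^ 2) * h
  twist_free x := by
    have h := (hiso x).2
    rw [g.form_eq_sum_repr, Fin.sum_univ_three] at h
    obtain ⟨ε, hε, hvol⟩ := exists_volForm_eq g o x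
    have (X Y : TangentSpace (𝓡 3) x) :
        1 / 2 * (g.form x (D p x X) Y - g.form x (D p x Y) X) =
          -(1 / 2) * (a * (ε * (g.frame x).det ![X, p x, Y])) := by
      have e : (a • volForm g o) x ![X, p x, Y] = a * (ε * (g.frame x).det ![X, p x, Y]) := by
        rw [← hvol]; rfl
      rw [hK, hK, form3_swap _ x X, e, g.symm x X, g.symm x Y]
      ring
    have hd (i j) : (g.frame x).det ![g.frame x i, p x, g.frame x j] =
        Matrix.det (Matrix.of ![Pi.single i 1, fun k => (g.frame x).repr (p x) k,
          Pi.single j 1]) := by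
      rw [Basis.det_apply, ← Matrix.det_transpose]
      congr 1
      ext k l
      fin_cases k <;> simp [Basis.toMatrix_apply, Finsupp.single_apply, Pi.single_apply, eq_comm]
    simp only [normSq2, this]
    simp only [hd, Fin.sum_univ_three]
    simp only [lsign, Fin.isValue, Fin.reduceEq, if_true, if_false, Matrix.det_fin_three,
      Matrix.of_apply, Matrix.cons_val, Pi.single_apply] at h ⊢
    linear_combination (-1 / 2 * a ^ 2 * ε ^ 2) * h

end KundtField

/-! ### The model metrics on `E3` with arbitrary C. -/

section Example

/-- The bilinear form on `E3` with a given matrix. -/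
def matrixForm (m : Matrix (Fin 3) (Fin 3) ℝ) : E3 →L[ℝ] E3 →L[ℝ] ℝ :=
  ∑ i, ∑ j, m i j •
    ((EuclideanSpace.proj i : E3 →L[ℝ] ℝ).smulRight (EuclideanSpace.proj j : E3 →L[ℝ] ℝ))

lemma matrixForm_apply (m : Matrix (Fin 3) (Fin 3) ℝ) (v w : E3) :
    matrixForm m v w = ∑ i, ∑ j, m i j * v i * w j := by
  simp [matrixForm, mul_assoc]

lemma contMDiff_bilinear {B : E3 → E3 →L[ℝ] E3 →L[ℝ] ℝ} (hB : ContDiff ℝ ∞ B) :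
    ContMDiff (𝓡 3) ((𝓡 3).prod 𝓘(ℝ, E3 →L[ℝ] E3 →L[ℝ] ℝ)) ∞
      (fun x ↦ TotalSpace.mk' (E3 →L[ℝ] E3 →L[ℝ] ℝ)
        (E := fun y : E3 ↦ TangentSpace (𝓡 3) y →L[ℝ] TangentSpace (𝓡 3) y →L[ℝ] ℝ) x (B x)) := by
  intro x
  rw [contMDiffAt_hom_bundle]
  refine ⟨contMDiffAt_id, ?_⟩
  refine hB.contDiffAt.contMDiffAt.congr_of_eventuallyEq (Eventually.of_forall fun z => ?_)
  ext v w
  simp only [ContinuousLinearMap.inCoordinates, TangentBundle.symmL_model_space,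
    ContinuousLinearMap.comp_apply, Trivialization.continuousLinearMapAt_apply]
  rw [Trivialization.coe_linearMapAt_of_mem _ (by simp; rw [chartAt_self_eq]; trivial)]
  change (ContinuousLinearMap.inCoordinates E3 (TangentSpace (𝓡 3) : E3 → Type _) ℝ
    (Bundle.Trivial E3 ℝ) x z x z (B z v)) w = _
  simp [ContinuousLinearMap.inCoordinates]
  rfl

/-- The metric `2dvdu + 2av dxdu + (dx)² + (-2v e^{-ax} + C(x,u))(du)²` on `E3`. -/
def kundtMetric (a : ℝ) {C : ℝ × ℝ → ℝ} (hC : ContDiff ℝ ∞ C) : LorentzMetric E3 where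
  form z := matrixForm (kundtMatrix a C z)
  contMDiff := contMDiff_bilinear (by
    refine contDiff_clm_apply_iff.2 fun v => contDiff_clm_apply_iff.2 fun w => ?_
    simp only [matrixForm_apply]
    refine ContDiff.sum fun i _ => ContDiff.sum fun j _ => ?_
    refine ContDiff.mul (ContDiff.mul ?_ contDiff_const) contDiff_const
    have h (j : Fin 3) : ContDiff ℝ ∞ (fun z : E3 => z j) :=
      (EuclideanSpace.proj j : E3 →L[ℝ] ℝ).contDiff
    have h2 : ContDiff ℝ ∞ (fun z : E3 => C (z 1, z 2)) := hC.comp ((h 1).prodMk (h 2))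
    fin_cases i <;> fin_cases j <;> simp only [kundtMatrix] <;> simp <;> fun_prop)
  symm z v w := by
    refine (matrixForm_apply _ v w).trans (Eq.trans ?_ (matrixForm_apply _ w v).symm)
    simp [kundtMatrix, Fin.sum_univ_three]
    ring
  exists_frame z := by
    obtain ⟨h, hm⟩ : ∃ h, kundtMatrix a C z = !![0, 0, 1; 0, 1, a * z 0; 1, a * z 0, h] :=
      ⟨_, rfl⟩
    -- With h = g(∂_u,∂_u), the outer vectors are combinations of ∂_v and ∂_u of squares -1 and 1.
    -- The middle one is ∂_x corrected by a multiple of the null vector ∂_v to be orthogonal to ∂_u.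
    let b : Fin 3 → E3 := ![!₂[(1 + h) / 2, 0, -1], !₂[-(a * z 0), 1, 0], !₂[(1 - h) / 2, 0, 1]]
    have hb (i j : Fin 3) : matrixForm (kundtMatrix a C z) (b i) (b j) =
        if i = j then lsign i else 0 := by
      rw [matrixForm_apply, hm]
      fin_cases i <;> fin_cases j <;> simp [b, Fin.sum_univ_three, lsign] <;> ring
    -- Orthogonal vectors of nonzero square are independent: pairing a relation with `b j` isolates
    -- its j-th coefficient.
    have hli : LinearIndependent ℝ b := by
      rw [Fintype.linearIndependent_iff]
      intro c hc j
      have h1 : matrixForm (kundtMatrix a C z) (∑ i, c i • b i) (b j) = 0 := by rw [hc]; simp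
      simp only [map_sum, map_smul, sum_apply, smul_apply, hb, smul_eq_mul, mul_ite, mul_zero,
        Finset.sum_ite_eq', Finset.mem_univ, if_true] at h1
      refine (mul_eq_zero.1 h1).resolve_right ?_
      unfold lsign
      split_ifs <;> norm_num
    refine ⟨basisOfLinearIndependentOfCardEqFinrank (V := E3) hli
      (by rw [Fintype.card_fin]; exact finrank_euclideanSpace_fin.symm), fun i j => ?_⟩
    have e := coe_basisOfLinearIndependentOfCardEqFinrank (V := E3) hli
      (by rw [Fintype.card_fin]; exact finrank_euclideanSpace_fin.symm)
    exact (congrArg₂ (fun v w => matrixForm (kundtMatrix a C z) v w) (congrFun e i)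
      (congrFun e j)).trans (hb i j)

/-- The basis `(∂_x, ∂_v, ∂_u)` of `E3`. -/
def kundtBasis : Basis (Fin 3) ℝ E3 :=
  ((EuclideanSpace.basisFun (Fin 3) ℝ).toBasis).reindex (Equiv.swap 0 1)

lemma kundtBasis_apply (i : Fin 3) : kundtBasis i = stdVec ((![1, 0, 2] : Fin 3 → Fin 3) i) := by
  have : Equiv.swap (0 : Fin 3) 1 2 = 2 := by decide
  fin_cases i <;> simp [kundtBasis, stdVec, this]

lemma kundtBasis_repr (X : E3) (i : Fin 3) :
    kundtBasis.repr X i = X ((![1, 0, 2] : Fin 3 → Fin 3) i) := by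
  have : Equiv.swap (0 : Fin 3) 1 2 = 2 := by decide
  fin_cases i <;> simp [kundtBasis, this]

/-- The frame `(∂_x, ∂_v, ∂_u)`. -/
def kundtFrame (z : E3) : Basis (Fin 3) ℝ (TangentSpace (𝓡 3) z) := kundtBasis

/-- The orientation of `E3` in which `(∂_x, ∂_v, ∂_u)` is positive. -/
def kundtOrientation : SmoothOrientation E3 where
  orient z := (kundtFrame z).orientation
  exists_frame _ := ⟨univ, univ_mem, fun i _ => kundtBasis i,
    fun i _ _ => (contMDiffAt_vectorSpace_iff_contDiffAt.2
      (contDiffAt_const (c := kundtBasis i))).contMDiffWithinAt,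
    fun z _ => ⟨kundtFrame z, fun _ => rfl, rfl⟩⟩

/-- The field `e^{-ax}∂_v`. -/
def kundtField (a : ℝ) : VField E3 := fun z => Real.exp (-a * z 1) • stdVec 0

lemma kundtField_smooth (a : ℝ) : SmoothField (kundtField a) := fun z =>
  contMDiffAt_vectorSpace_iff_contDiffAt.2 (by
    have h : ContDiff ℝ ∞ (fun z : E3 => z 1) := (EuclideanSpace.proj 1 : E3 →L[ℝ] ℝ).contDiff
    change ContDiffAt ℝ ∞ (fun z : E3 => Real.exp (-a * z 1) • stdVec 0) z
    exact ((contDiff_const.mul h).exp.smul contDiff_const).contDiffAt)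

lemma refl_mem_maximalAtlas :
    OpenPartialHomeomorph.refl E3 ∈ IsManifold.maximalAtlas (𝓡 3) ∞ E3 :=
  IsManifold.subset_maximalAtlas (by simp)

lemma coordDiff_refl (i : Fin 3) (z : E3) (X : TangentSpace (𝓡 3) z) :
    coordDiff (OpenPartialHomeomorph.refl E3) i z X = (show E3 from X) i := by
  rw [coordDiff_apply refl_mem_maximalAtlas (mem_univ z)]
  have : mfderiv (𝓡 3) (𝓡 3) (OpenPartialHomeomorph.refl E3) z =
      ContinuousLinearMap.id ℝ (TangentSpace (𝓡 3) z) := mfderiv_id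
  rw [this]
  rfl

/-- The Gram determinant of (∂_x,∂_v,∂_u) is -1, so its determinant in the orthonormal frame is 1 or
-1; the orientation decides the sign, and the volume form is 1 on it in both cases. -/
lemma volForm_kundtMetric (a : ℝ) {C : ℝ × ℝ → ℝ} (hC : ContDiff ℝ ∞ C) (z : E3)
    (X : Fin 3 → TangentSpace (𝓡 3) z) :
    volForm (kundtMetric a hC) kundtOrientation z X = (kundtFrame z).det X := by
  set g := kundtMetric a hC
  have hsq : (g.frame z).det (kundtFrame z) * (g.frame z).det (kundtFrame z) = 1 := by
    rw [g.frame_det_mul]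
    have h (i j : Fin 3) : g.form z ((kundtFrame z) i) ((kundtFrame z) j) =
        kundtMatrix a C z ((![1, 0, 2] : Fin 3 → Fin 3) i) ((![1, 0, 2] : Fin 3 → Fin 3) j) := by
      refine (matrixForm_apply _ _ _).trans ?_
      have e (i : Fin 3) : kundtFrame z i = stdVec ((![1, 0, 2] : Fin 3 → Fin 3) i) :=
        kundtBasis_apply i
      rw [e, e]
      simp [stdVec]
    simp only [h]
    simp [Matrix.det_fin_three, kundtMatrix]
  have h1 : volForm g kundtOrientation z (kundtFrame z) = 1 := by
    have ho := (g.frame z).orientation_eq_iff_det_pos (kundtFrame z)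
    rcases mul_self_eq_one_iff.1 hsq with h | h
    · have : (g.frame z).orientation = kundtOrientation.orient z := ho.2 (by rw [h]; norm_num)
      rw [volForm, if_pos this, h]
    · have : ¬ (g.frame z).orientation = kundtOrientation.orient z := fun h2 => by
        have := ho.1 h2
        rw [h] at this
        norm_num at this
      rw [volForm, if_neg this, AlternatingMap.neg_apply, h, neg_neg]
  have h2 := (volForm g kundtOrientation z).eq_smul_basis_det (kundtFrame z)
  rw [h2]
  rw [h1]
  rw [one_smul]

lemma isKundtChart_refl (a : ℝ) {C : ℝ × ℝ → ℝ} (hC : ContDiff ℝ ∞ C) :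
    IsKundtChart (kundtMetric a hC) kundtOrientation (kundtField a) a
      (OpenPartialHomeomorph.refl E3) C where
  metric z _ X Y := by
    refine (matrixForm_apply _ X Y).trans ?_
    simp only [coordDiff_refl]
    simp [kundtMatrix, Fin.sum_univ_three]
    ring
  field z _ := by
    simp only [coordDiff_refl]
    simp [kundtField, stdVec]
  oriented z _ X := by
    rw [volForm_kundtMetric, Basis.det_apply, ← Matrix.det_transpose]
    congr 1
    ext i j
    rw [Matrix.transpose_apply, Basis.toMatrix_apply, Matrix.of_apply, coordDiff_refl,
      ← kundtBasis_repr]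
    rfl

/-- All smooth functions `C` occur in the normal form. -/
theorem exists_kundt_example (a : ℝ) (C : ℝ × ℝ → ℝ) (hC : ContDiff ℝ ∞ C) :
    ∃ (g₀ : LorentzMetric E3) (o₀ : SmoothOrientation E3) (p₀ : VField E3) (D₀ : AffConn E3),
      SmoothField p₀ ∧ IsLeviCivita g₀ D₀ ∧
      IsKundtChart g₀ o₀ p₀ a (OpenPartialHomeomorph.refl E3) C ∧
      IsIsotropic g₀ p₀ ∧ KundtEquation g₀ D₀ p₀ (a • volForm g₀ o₀) :=
  ⟨kundtMetric a hC, kundtOrientation, kundtField a, (kundtMetric a hC).leviCivita,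
    kundtField_smooth a, LorentzMetric.isLeviCivita_leviCivita _, isKundtChart_refl a hC,
    fun z => (isKundtChart_refl a hC).isotropic refl_mem_maximalAtlas (mem_univ z),
    fun z => (isKundtChart_refl a hC).kundtEquation refl_mem_maximalAtlas (mem_univ z)
      (LorentzMetric.isLeviCivita_leviCivita _) ((kundtField_smooth a).smoothFieldAt z)
      hC.contDiffOn⟩

end Example

/-! ### 3-forms and Gram determinants. -/

section ParallelForms

variable {M : Type*} [TopologicalSpace M] [ChartedSpace E3 M] [IsManifold (𝓡 3) ∞ M]
  (g : LorentzMetric M) (S : Form3 M) {x : M}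

lemma form3_eq_curry (X Y Z : TangentSpace (𝓡 3) x) :
    S x ![X, Y, Z] = (((S x).curryLeft X).curryLeft Y).curryLeft Z ![] := rfl

lemma form3_cycle (X Y Z : TangentSpace (𝓡 3) x) : S x ![Y, Z, X] = S x ![X, Y, Z] := by
  have h1 := (S x).map_swap (v := ![Y, Z, X]) (i := 0) (j := 2) (by decide)
  have h2 := (S x).map_swap (v := ![X, Z, Y]) (i := 1) (j := 2) (by decide)
  have e1 : ![Y, Z, X] ∘ Equiv.swap 0 2 = ![X, Z, Y] := by
    ext i : 1
    fin_cases i <;> rfl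
  have e2 : ![X, Z, Y] ∘ Equiv.swap 1 2 = ![X, Y, Z] := by
    ext i : 1
    fin_cases i <;> rfl
  rw [e1] at h1
  rw [e2] at h2
  rw [h2, h1, neg_neg]

/-- The Gram determinant of two triples of tangent vectors. -/
def LorentzMetric.gram (x : M) (X Y : Fin 3 → TangentSpace (𝓡 3) x) : ℝ :=
  Matrix.det (Matrix.of fun i j => g.form x (X i) (Y j))

/-- The square of the component of a 3-form in an orthonormal frame. -/
def LorentzMetric.sqComponent (x : M) : ℝ := S x (g.frame x) ^ 2

lemma form3_eq_smul_det (X : Fin 3 → TangentSpace (𝓡 3) x) :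
    S x X = S x (g.frame x) * (g.frame x).det X := by
  conv_lhs => rw [(S x).eq_smul_basis_det (g.frame x)]
  rfl

/-- 3-forms on a three-dimensional space are proportional to the determinant, so products of two
values of S are metric quantities. This is how compatibility with g controls the derivative of S. -/
lemma form3_mul (X Y : Fin 3 → TangentSpace (𝓡 3) x) :
    S x X * S x Y = -g.sqComponent S x * g.gram x X Y := by
  rw [form3_eq_smul_det g S X, form3_eq_smul_det g S Y, LorentzMetric.sqComponent,
    LorentzMetric.gram]
  linear_combination S x (g.frame x) ^ 2 * g.frame_det_mul x X Y

/-- The six permutations of the frame contribute equally, each with the sign (-1)·1·1. -/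
lemma normSq3_eq (x : M) : normSq3 g S x = -6 * g.sqComponent S x := by
  have h (i j k : Fin 3) : S x ![g.frame x i, g.frame x j, g.frame x k] =
      S x (g.frame x) * Matrix.det (Matrix.of ![Pi.single i 1, Pi.single j 1, Pi.single k 1]) := by
    rw [form3_eq_smul_det g S, Basis.det_apply, ← Matrix.det_transpose]
    congr 2
    ext a b
    fin_cases a <;> simp [Basis.toMatrix_apply, Finsupp.single_apply, Pi.single_apply, eq_comm]
  simp only [normSq3, h, Fin.sum_univ_three, LorentzMetric.sqComponent]
  simp only [lsign, Fin.isValue, Fin.reduceEq, if_true, if_false, Matrix.det_fin_three,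
      Matrix.of_apply, Matrix.cons_val, Pi.single_apply]
  ring

variable {g}

lemma mvfderiv_mul_three {A B C : M → ℝ} (hA : MDifferentiableAt (𝓡 3) 𝓘(ℝ, ℝ) A x)
    (hB : MDifferentiableAt (𝓡 3) 𝓘(ℝ, ℝ) B x) (hC : MDifferentiableAt (𝓡 3) 𝓘(ℝ, ℝ) C x)
    (v : TangentSpace (𝓡 3) x) :
    mvfderiv (𝓡 3) (fun y => A y * B y * C y) x v = mvfderiv (𝓡 3) A x v * B x * C x +
      A x * mvfderiv (𝓡 3) B x v * C x + A x * B x * mvfderiv (𝓡 3) C x v := by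
  have hAB : MDifferentiableAt (𝓡 3) 𝓘(ℝ, ℝ) (fun y => A y * B y) x := hA.mul hB
  rw [mvfderiv_fun_mul hAB hC, mvfderiv_fun_mul hA hB]
  simp only [add_apply, smul_apply, smul_eq_mul]
  ring

lemma mdifferentiableAt_mul_three {A B C : M → ℝ} (hA : MDifferentiableAt (𝓡 3) 𝓘(ℝ, ℝ) A x)
    (hB : MDifferentiableAt (𝓡 3) 𝓘(ℝ, ℝ) B x) (hC : MDifferentiableAt (𝓡 3) 𝓘(ℝ, ℝ) C x) :
    MDifferentiableAt (𝓡 3) 𝓘(ℝ, ℝ) (fun y => A y * B y * C y) x :=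
  (hA.mul hB).mul hC

lemma mvfderiv_alternating_sum {A : Fin 6 → M → ℝ}
    (h : ∀ i, MDifferentiableAt (𝓡 3) 𝓘(ℝ, ℝ) (A i) x) (v : TangentSpace (𝓡 3) x) :
    mvfderiv (𝓡 3) (A 0 - A 1 - A 2 + A 3 + A 4 - A 5) x v =
      mvfderiv (𝓡 3) (A 0) x v - mvfderiv (𝓡 3) (A 1) x v - mvfderiv (𝓡 3) (A 2) x v
        + mvfderiv (𝓡 3) (A 3) x v + mvfderiv (𝓡 3) (A 4) x v - mvfderiv (𝓡 3) (A 5) x v := by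
  rw [mvfderiv_sub (((((h 0).sub (h 1)).sub (h 2)).add (h 3)).add (h 4)) (h 5),
    mvfderiv_add ((((h 0).sub (h 1)).sub (h 2)).add (h 3)) (h 4),
    mvfderiv_add (((h 0).sub (h 1)).sub (h 2)) (h 3),
    mvfderiv_sub ((h 0).sub (h 1)) (h 2), mvfderiv_sub (h 0) (h 1)]
  rfl

lemma gram_expand {X Y : Fin 3 → VField M} : (fun y => g.gram y (fun i => X i y) (fun i => Y i y)) =
    fun y => (((((g.form y (X 0 y) (Y 0 y) * g.form y (X 1 y) (Y 1 y) * g.form y (X 2 y) (Y 2 y)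
      - g.form y (X 0 y) (Y 0 y) * g.form y (X 1 y) (Y 2 y) * g.form y (X 2 y) (Y 1 y))
      - g.form y (X 0 y) (Y 1 y) * g.form y (X 1 y) (Y 0 y) * g.form y (X 2 y) (Y 2 y))
      + g.form y (X 0 y) (Y 1 y) * g.form y (X 1 y) (Y 2 y) * g.form y (X 2 y) (Y 0 y))
      + g.form y (X 0 y) (Y 2 y) * g.form y (X 1 y) (Y 0 y) * g.form y (X 2 y) (Y 1 y))
      - g.form y (X 0 y) (Y 2 y) * g.form y (X 1 y) (Y 1 y) * g.form y (X 2 y) (Y 0 y)) := by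
  ext y
  simp only [LorentzMetric.gram, Matrix.det_fin_three, Matrix.of_apply]

lemma mdifferentiableAt_gram {X Y : Fin 3 → VField M} (hX : ∀ i, DiffFieldAt (X i) x)
    (hY : ∀ i, DiffFieldAt (Y i) x) : MDifferentiableAt (𝓡 3) 𝓘(ℝ, ℝ)
      (fun y => g.gram y (fun i => X i y) (fun i => Y i y)) x := by
  have h (i j) := g.mdifferentiableAt_apply (hX i) (hY j)
  have h3 (i j i' j' i'' j'') := mdifferentiableAt_mul_three (h i j) (h i' j') (h i'' j'')
  rw [gram_expand]
  exact (((((h3 ..).sub (h3 ..)).sub (h3 ..)).add (h3 ..)).add (h3 ..)).sub (h3 ..)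

/-- A metric connection satisfies the product rule for Gram determinants. -/
lemma IsMetricConn.mvfderiv_gram {cov : AffConn M} (hm : IsMetricConn g cov)
    {X Y : Fin 3 → VField M} (hX : ∀ i, DiffFieldAt (X i) x) (hY : ∀ i, DiffFieldAt (Y i) x)
    (v : TangentSpace (𝓡 3) x) :
    mvfderiv (𝓡 3) (fun y => g.gram y (fun i => X i y) (fun i => Y i y)) x v =
      (g.gram x ![cov (X 0) x v, X 1 x, X 2 x] (fun i => Y i x) +
        g.gram x ![X 0 x, cov (X 1) x v, X 2 x] (fun i => Y i x) +
        g.gram x ![X 0 x, X 1 x, cov (X 2) x v] (fun i => Y i x)) +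
      (g.gram x (fun i => X i x) ![cov (Y 0) x v, Y 1 x, Y 2 x] +
        g.gram x (fun i => X i x) ![Y 0 x, cov (Y 1) x v, Y 2 x] +
        g.gram x (fun i => X i x) ![Y 0 x, Y 1 x, cov (Y 2) x v]) := by
  have h (i j) := g.mdifferentiableAt_apply (hX i) (hY j)
  have h3 (i j i' j' i'' j'') := mdifferentiableAt_mul_three (h i j) (h i' j') (h i'' j'')
  have d3 (i j i' j' i'' j'') := mvfderiv_mul_three (h i j) (h i' j') (h i'' j'') v
  have dm (i j) := hm x (X i) (Y j) (hX i) (hY j) v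
  rw [gram_expand]
  let τ (i j k : Fin 3) : M → ℝ := fun y =>
    g.form y (X 0 y) (Y i y) * g.form y (X 1 y) (Y j y) * g.form y (X 2 y) (Y k y)
  refine (mvfderiv_alternating_sum (A := ![τ 0 1 2, τ 0 2 1, τ 1 0 2, τ 1 2 0, τ 2 0 1, τ 2 1 0])
    (fun i => by fin_cases i <;> exact h3 ..) v).trans ?_
  simp only [Matrix.cons_val, τ, d3, dm, LorentzMetric.gram, Matrix.det_fin_three, Matrix.of_apply]
  ring

end ParallelForms

/-! ### Parallel 3-forms and 3-forms of constant norm. -/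

section ParallelForms

variable {M : Type*} [TopologicalSpace M] [ChartedSpace E3 M] [IsManifold (𝓡 3) ∞ M]
  {g : LorentzMetric M} {S : Form3 M} {x : M}

lemma eval_vec3 (Y Z W : VField M) (y : M) :
    (fun i => (![Y, Z, W] : Fin 3 → VField M) i y) = ![Y y, Z y, W y] := by
  ext i : 1
  fin_cases i <;> rfl

lemma eval_eq_vec3 (X : Fin 3 → VField M) (y : M) :
    (fun i => X i y) = ![X 0 y, X 1 y, X 2 y] := by
  ext i : 1
  fin_cases i <;> rfl

/-- The terms `S(∇X₀,X₁,X₂) + S(X₀,∇X₁,X₂) + S(X₀,X₁,∇X₂)` of the product rule. -/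
def derivTerms (cov : AffConn M) (S : Form3 M) (X : Fin 3 → VField M) (x : M)
    (v : TangentSpace (𝓡 3) x) : ℝ :=
  S x ![cov (X 0) x v, X 1 x, X 2 x] + S x ![X 0 x, cov (X 1) x v, X 2 x] +
    S x ![X 0 x, X 1 x, cov (X 2) x v]

lemma LorentzMetric.gram_comm (X Y : Fin 3 → TangentSpace (𝓡 3) x) :
    g.gram x X Y = g.gram x Y X := by
  rw [LorentzMetric.gram, ← Matrix.det_transpose, LorentzMetric.gram]
  congr 1
  ext i j
  exact g.symm _ _ _

lemma derivTerms_mul (cov : AffConn M) (X Y : Fin 3 → VField M) (v : TangentSpace (𝓡 3) x) :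
    derivTerms cov S X x v * S x (fun i => Y i x) = -g.sqComponent S x *
      (g.gram x ![cov (X 0) x v, X 1 x, X 2 x] (fun i => Y i x) +
        g.gram x ![X 0 x, cov (X 1) x v, X 2 x] (fun i => Y i x) +
        g.gram x ![X 0 x, X 1 x, cov (X 2) x v] (fun i => Y i x)) := by
  simp only [derivTerms, add_mul, mul_add, form3_mul g S]

lemma IsMetricConn.mul_mvfderiv_gram {cov : AffConn M} (hm : IsMetricConn g cov)
    {X Y : Fin 3 → VField M} (hX : ∀ i, DiffFieldAt (X i) x) (hY : ∀ i, DiffFieldAt (Y i) x)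
    (v : TangentSpace (𝓡 3) x) :
    -g.sqComponent S x * mvfderiv (𝓡 3) (fun y => g.gram y (fun i => X i y) (fun i => Y i y)) x v =
      derivTerms cov S X x v * S x (fun i => Y i x) +
        derivTerms cov S Y x v * S x (fun i => X i x) := by
  rw [hm.mvfderiv_gram hX hY, mul_add, derivTerms_mul (g := g), derivTerms_mul (g := g)]
  rw [LorentzMetric.gram_comm (fun i => X i x) ![cov (Y 0) x v, Y 1 x, Y 2 x],
    LorentzMetric.gram_comm (fun i => X i x) ![Y 0 x, cov (Y 1) x v, Y 2 x],
    LorentzMetric.gram_comm (fun i => X i x) ![Y 0 x, Y 1 x, cov (Y 2) x v]]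

lemma exists_smooth_frame_ne_zero [T2Space M] (x : M) (hS : g.sqComponent S x ≠ 0) :
    ∃ E : Fin 3 → VField M, (∀ i, SmoothField (E i)) ∧
      (∀ᶠ y in 𝓝 x, ∀ i, E i y = chartField (chartAt E3 x) i y) ∧ S x (fun i => E i x) ≠ 0 := by
  obtain ⟨E, hE, hE'⟩ := exists_smoothField_frame x
  refine ⟨E, hE, hE', fun h => ?_⟩
  have h1 := form3_mul g S (fun i => E i x) (fun i => E i x)
  simp only [hE'.self_of_nhds] at h h1
  rw [h, mul_zero] at h1
  refine mul_ne_zero (neg_ne_zero.2 hS) ?_ h1.symm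
  exact g.chart_gram_det_ne_zero (IsManifold.chart_mem_maximalAtlas x) (mem_chart_source E3 x)

lemma SmoothForm3.smooth_eval (hS : SmoothForm3 S) {E : Fin 3 → VField M}
    (hE : ∀ i, SmoothField (E i)) :
    ContMDiff (𝓡 3) 𝓘(ℝ, ℝ) ∞ (fun y => S y (fun i => E i y)) := by
  simp only [eval_eq_vec3]
  exact hS _ _ _ (hE 0) (hE 1) (hE 2)

/-- A 3-form of constant norm is parallel for all metric connections. -/
lemma IsMetricConn.mvfderiv_form3 [T2Space M] {cov : AffConn M} (hm : IsMetricConn g cov)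
    (hS : SmoothForm3 S) {c : ℝ} (hc : ∀ y, g.sqComponent S y = c) (hc0 : c ≠ 0)
    {X : Fin 3 → VField M} (hX : ∀ i, DiffFieldAt (X i) x) :
    MDifferentiableAt (𝓡 3) 𝓘(ℝ, ℝ) (fun y => S y (fun i => X i y)) x ∧
      ∀ v, mvfderiv (𝓡 3) (fun y => S y (fun i => X i y)) x v = derivTerms cov S X x v := by
  obtain ⟨E, hE, -, hne⟩ := exists_smooth_frame_ne_zero (g := g) (S := S) x (by rwa [hc])
  have hEd (i) := (hE i).diffFieldAt x
  have hs := ((hS.smooth_eval hE).contMDiffAt (x := x)).mdifferentiableAt (n := ∞) (by simp)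
  have hprod (X : Fin 3 → VField M) (y : M) : S y (fun i => X i y) * S y (fun i => E i y) =
      -c * g.gram y (fun i => X i y) (fun i => E i y) := by
    rw [form3_mul g, hc]
  have hev : ∀ᶠ y in 𝓝 x, S y (fun i => E i y) ≠ 0 :=
    hs.continuousAt.eventually_ne hne
  -- Smoothness of S concerns smooth arguments only. For arguments that are merely differentiable at
  -- `x`, S(X) is recovered by dividing -c Gram(X,E) by S(E) ≠ 0.
  have hmd {X : Fin 3 → VField M} (hX : ∀ i, DiffFieldAt (X i) x) :
      MDifferentiableAt (𝓡 3) 𝓘(ℝ, ℝ) (fun y => S y (fun i => X i y)) x := by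
    have hinv : MDifferentiableAt (𝓡 3) 𝓘(ℝ, ℝ) (fun y => (S y (fun i => E i y))⁻¹) x :=
      ((differentiableAt_inv hne).mdifferentiableAt).comp x hs
    have h1 : MDifferentiableAt (𝓡 3) 𝓘(ℝ, ℝ)
        (fun y => g.gram y (fun i => X i y) (fun i => E i y) * (S y (fun i => E i y))⁻¹) x :=
      (mdifferentiableAt_gram hX hEd).mul hinv
    have h2 : MDifferentiableAt (𝓡 3) 𝓘(ℝ, ℝ) (fun y => -c *
        (g.gram y (fun i => X i y) (fun i => E i y) * (S y (fun i => E i y))⁻¹)) x :=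
      mdifferentiableAt_const.mul h1
    refine h2.congr_of_eventuallyEq ?_
    filter_upwards [hev] with y hy
    rw [← mul_assoc, ← hprod, mul_assoc, mul_inv_cancel₀ hy, mul_one]
  -- The derivative of S(X)S(E) = -c Gram(X,E). The case X = E settles the derivative of S(E), after
  -- which the general case can be solved for that of S(X).
  have key {X : Fin 3 → VField M} (hX : ∀ i, DiffFieldAt (X i) x) (v) :
      mvfderiv (𝓡 3) (fun y => S y (fun i => X i y)) x v * S x (fun i => E i x) +
        mvfderiv (𝓡 3) (fun y => S y (fun i => E i y)) x v * S x (fun i => X i x) =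
      derivTerms cov S X x v * S x (fun i => E i x) +
        derivTerms cov S E x v * S x (fun i => X i x) := by
    rw [← hm.mul_mvfderiv_gram hX hEd, hc]
    have h1 : (fun y => S y (fun i => X i y) * S y (fun i => E i y)) =
      fun y => -c * g.gram y (fun i => X i y) (fun i => E i y) := funext (hprod X)
    have h2 := mvfderiv_fun_mul (hmd hX) hs
    rw [h1, mvfderiv_fun_mul mdifferentiableAt_const (mdifferentiableAt_gram hX hEd)] at h2
    have h3 := congrArg (fun L => L v) h2
    simp only [add_apply, smul_apply, smul_eq_mul, mvfderiv_const, zero_apply, mul_zero,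
      add_zero] at h3
    rw [h3]
    ring
  refine ⟨hmd hX, fun v => ?_⟩
  have hE0 : mvfderiv (𝓡 3) (fun y => S y (fun i => E i y)) x v = derivTerms cov S E x v := by
    have := key hEd v
    refine mul_right_cancel₀ hne ?_
    linarith
  have := key hX v
  rw [hE0] at this
  refine mul_right_cancel₀ hne ?_
  linarith

lemma eq_of_mvfderiv_eq_zero [ConnectedSpace M] {F : M → ℝ}
    (hF : ∀ x, MDifferentiableAt (𝓡 3) 𝓘(ℝ, ℝ) F x) (h0 : ∀ x, mvfderiv (𝓡 3) F x = 0) (x y : M) :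
    F x = F y := by
  refine IsLocallyConstant.apply_eq_of_preconnectedSpace ?_ x y
  refine (IsLocallyConstant.iff_eventually_eq F).2 fun x => ?_
  set φ := chartAt E3 x
  have hφ : φ ∈ IsManifold.maximalAtlas (𝓡 3) ∞ M := IsManifold.chart_mem_maximalAtlas x
  have hx : x ∈ φ.source := mem_chart_source E3 x
  obtain ⟨r, hr, hball⟩ := Metric.isOpen_iff.1 φ.open_target _ (φ.map_source hx)
  have hd : ∀ z ∈ φ.target, DifferentiableAt ℝ (F ∘ φ.symm) z ∧ fderiv ℝ (F ∘ φ.symm) z = 0 := by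
    intro z hz
    have hy := φ.map_target hz
    constructor
    · rw [← mdifferentiableAt_iff_differentiableAt]
      exact MDifferentiableAt.comp z (hF _) ((chart_mdifferentiable hφ).mdifferentiableAt_symm hz)
    · ext w
      rw [fderiv_eq_sum_pd, zero_apply]
      refine Finset.sum_eq_zero fun i _ => ?_
      have := mvfderiv_chartField hφ hy i F (hF _)
      rw [h0, φ.right_inv hz, zero_apply] at this
      rw [← this, mul_zero]
  filter_upwards [φ.open_source.mem_nhds hx,
    (φ.continuousAt hx).preimage_mem_nhds (Metric.ball_mem_nhds _ hr)] with y hy hyb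
  have := Metric.isOpen_ball.is_const_of_fderiv_eq_zero (𝕜 := ℝ) (f := F ∘ φ.symm)
    (convex_ball (φ x) r).isPreconnected
    (fun z hz => (hd z (hball hz)).1.differentiableWithinAt) (fun z hz => (hd z (hball hz)).2)
    hyb (Metric.mem_ball_self hr)
  simpa [φ.left_inv hy, φ.left_inv hx] using this

/-- A 3-form that is parallel for a metric connection has constant norm. -/
lemma IsMetricConn.sqComponent_eq [T2Space M] [ConnectedSpace M] {cov : AffConn M}
    (hm : IsMetricConn g cov) (hS : SmoothForm3 S)
    (hpar : ∀ E : Fin 3 → VField M, (∀ i, SmoothField (E i)) → ∀ x v,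
      mvfderiv (𝓡 3) (fun y => S y (fun i => E i y)) x v = derivTerms cov S E x v) (x y : M) :
    g.sqComponent S x = g.sqComponent S y := by
  have hloc (x : M) : MDifferentiableAt (𝓡 3) 𝓘(ℝ, ℝ) (g.sqComponent S) x ∧
      mvfderiv (𝓡 3) (g.sqComponent S) x = 0 := by
    obtain ⟨E, hE, hE'⟩ := exists_smoothField_frame x
    have hEd (i) := (hE i).diffFieldAt x
    have hs := ((hS.smooth_eval hE).contMDiffAt (x := x)).mdifferentiableAt (n := ∞) (by simp)
    have hg := mdifferentiableAt_gram (g := g) hEd hEd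
    have hne : g.gram x (fun i => E i x) (fun i => E i x) ≠ 0 := by
      simp only [hE'.self_of_nhds]
      exact g.chart_gram_det_ne_zero (IsManifold.chart_mem_maximalAtlas x) (mem_chart_source E3 x)
    have hprod (y : M) : S y (fun i => E i y) * S y (fun i => E i y) =
        -g.sqComponent S y * g.gram y (fun i => E i y) (fun i => E i y) := form3_mul g S _ _
    have hinv : MDifferentiableAt (𝓡 3) 𝓘(ℝ, ℝ)
        (fun y => (g.gram y (fun i => E i y) (fun i => E i y))⁻¹) x :=
      ((differentiableAt_inv hne).mdifferentiableAt).comp x hg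
    have hss : MDifferentiableAt (𝓡 3) 𝓘(ℝ, ℝ)
        (fun y => S y (fun i => E i y) * S y (fun i => E i y)) x := hs.mul hs
    -- The orthonormal frame is chosen point by point without regularity, so the component is
    -- differentiated as the quotient -S(E)²/Gram(E,E).
    have hmd : MDifferentiableAt (𝓡 3) 𝓘(ℝ, ℝ) (g.sqComponent S) x := by
      have h1 : MDifferentiableAt (𝓡 3) 𝓘(ℝ, ℝ)
          (fun y => (-(S y (fun i => E i y) * S y (fun i => E i y))) *
            (g.gram y (fun i => E i y) (fun i => E i y))⁻¹) x := hss.neg.mul hinv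
      refine h1.congr_of_eventuallyEq ?_
      filter_upwards [hg.continuousAt.eventually_ne hne] with y hy
      rw [hprod, eq_mul_inv_iff_mul_eq₀ hy]
      ring
    refine ⟨hmd, ?_⟩
    ext v
    have h1 : (fun y => S y (fun i => E i y) * S y (fun i => E i y)) =
        fun y => -g.sqComponent S y * g.gram y (fun i => E i y) (fun i => E i y) := funext hprod
    have h2 := mvfderiv_fun_mul hs hs
    have hneg : MDifferentiableAt (𝓡 3) 𝓘(ℝ, ℝ) (fun y => -g.sqComponent S y) x := hmd.neg
    rw [h1, mvfderiv_fun_mul hneg hg] at h2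
    have h3 := congrArg (fun L => L v) h2
    have h4 : mvfderiv (𝓡 3) (fun y => -g.sqComponent S y) x v =
        -mvfderiv (𝓡 3) (g.sqComponent S) x v := by
      rw [show (fun y => -g.sqComponent S y) = -g.sqComponent S from rfl, mvfderiv_neg]
      rfl
    simp only [add_apply, smul_apply, smul_eq_mul, h4, hm.mul_mvfderiv_gram hEd hEd,
      hpar E hE] at h3
    have h5 : g.gram x (fun i => E i x) (fun i => E i x) *
        mvfderiv (𝓡 3) (g.sqComponent S) x v = 0 := by
      linarith
    exact (mul_eq_zero.1 h5).resolve_left hne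
  exact eq_of_mvfderiv_eq_zero (fun x => (hloc x).1) (fun x => (hloc x).2) x y

end ParallelForms

/-! ### The orientation defined by a nowhere vanishing 3-form. -/

section Orientation

variable {M : Type*} [TopologicalSpace M] [ChartedSpace E3 M] [IsManifold (𝓡 3) ∞ M]
  {g : LorentzMetric M} {S : Form3 M} {x : M}

lemma sqComponent_smul_volForm (o : SmoothOrientation M) (a : ℝ) (x : M) :
    g.sqComponent (a • volForm g o) x = a ^ 2 := by
  obtain ⟨ε, hε, hvol⟩ := exists_volForm_eq g o x
  have h : (a • volForm g o) x (g.frame x) = a * volForm g o x (g.frame x) := rfl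
  rw [LorentzMetric.sqComponent, h, hvol, Basis.det_self]
  linear_combination a ^ 2 * hε

open Classical in
/-- The orientation of a tangent space for which a nonzero 3-form is positive. -/
def formOrient (g : LorentzMetric M) (S : Form3 M) (x : M) :
    Orientation ℝ (TangentSpace (𝓡 3) x) (Fin 3) :=
  if 0 < S x (g.frame x) then (g.frame x).orientation else -(g.frame x).orientation

lemma orientation_eq_formOrient (b : Basis (Fin 3) ℝ (TangentSpace (𝓡 3) x)) (hb : 0 < S x b) :
    b.orientation = formOrient g S x := by
  rw [form3_eq_smul_det g S] at hb
  have ho := (g.frame x).orientation_eq_iff_det_pos b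
  unfold formOrient
  split_ifs with h
  · exact (ho.2 (pos_of_mul_pos_right hb h.le)).symm
  · rcases Basis.orientation_eq_or_eq_neg b (g.frame x).orientation with h2 | h2
    · have := ho.1 h2
      exact absurd hb (not_lt.2 (mul_nonpos_of_nonpos_of_nonneg (not_lt.1 h) this.le))
    · rw [h2]
      exact (neg_neg b.orientation).symm

/-- A nowhere vanishing smooth 3-form orients the manifold. -/
def SmoothForm3.orientation [T2Space M] (hS : SmoothForm3 S) (h0 : ∀ x, g.sqComponent S x ≠ 0) :
    SmoothOrientation M where
  orient := formOrient g S
  exists_frame x₀ := by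
    obtain ⟨E, hE, hE', hne⟩ := exists_smooth_frame_ne_zero (g := g) (S := S) x₀ (h0 x₀)
    -- If S is negative on the coordinate frame, the first field is reversed; taking ε to be a unit
    -- keeps the result a basis.
    obtain ⟨ε, hpos⟩ : ∃ ε : ℝˣ, 0 < (ε : ℝ) * S x₀ (fun i => E i x₀) := by
      rcases lt_or_gt_of_ne hne with h | h
      · exact ⟨-1, by simpa using h⟩
      · exact ⟨1, by simpa using h⟩
    have hcont : ContinuousAt (fun y => (ε : ℝ) * S y (fun i => E i y)) x₀ :=
      ((hS.smooth_eval hE).continuous.continuousAt).const_mul _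
    have hev : ∀ᶠ y in 𝓝 x₀, y ∈ (chartAt E3 x₀).source ∧
        (∀ i, E i y = chartField (chartAt E3 x₀) i y) ∧ 0 < (ε : ℝ) * S y (fun i => E i y) := by
      filter_upwards [(chartAt E3 x₀).open_source.mem_nhds (mem_chart_source E3 x₀), hE',
        hcont.eventually (lt_mem_nhds hpos)] with y h1 h2 h3 using ⟨h1, h2, h3⟩
    let w : Fin 3 → ℝˣ := ![ε, 1, 1]
    refine ⟨_, hev, fun i y => (w i : ℝ) • E i y, fun i => ?_, fun y hy => ?_⟩
    · exact ((hE i).const_smul _).contMDiffOn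
    · obtain ⟨h1, h2, h3⟩ := hy
      let b := (chartBasis (IsManifold.chart_mem_maximalAtlas x₀) h1).unitsSMul w
      have hb (i : Fin 3) : b i = (w i : ℝ) • E i y := by
        simp only [b, Basis.unitsSMul_apply, chartBasis_apply, h2]
        rfl
      refine ⟨b, hb, orientation_eq_formOrient b ?_⟩
      have e : (b : Fin 3 → TangentSpace (𝓡 3) y) = fun i => (w i : ℝ) • E i y := funext hb
      rw [e, (S y).map_smul_univ]
      simpa [w, Fin.prod_univ_three] using h3

/-- A smooth 3-form of constant nonzero norm is a multiple of the volume form. -/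
lemma exists_eq_smul_volForm [T2Space M] (hS : SmoothForm3 S) {c : ℝ} (hc0 : c ≠ 0)
    (hc : ∀ x, g.sqComponent S x = c) :
    ∃ (o : SmoothOrientation M) (a : ℝ), a ≠ 0 ∧ S = a • volForm g o := by
  rcases isEmpty_or_nonempty M with hM | ⟨⟨x₀⟩⟩
  · exact ⟨⟨fun x => isEmptyElim x, fun x => isEmptyElim x⟩, 1, one_ne_zero,
      funext fun x => isEmptyElim x⟩
  have hcpos : 0 < c := lt_of_le_of_ne (by rw [← hc x₀]; exact sq_nonneg _) hc0.symm
  -- The orientation makes S positive, so the factor is the positive root of its squared component.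
  refine ⟨hS.orientation (g := g) (fun x => by rwa [hc]), √c, (Real.sqrt_pos.2 hcpos).ne', ?_⟩
  funext x
  ext X
  have hsq := hc x
  rw [LorentzMetric.sqComponent] at hsq
  have e : (√c • volForm g (hS.orientation (g := g) (fun x => by rwa [hc]))) x X =
    √c * volForm g (hS.orientation (g := g) (fun x => by rwa [hc])) x X := rfl
  rw [e, form3_eq_smul_det g S X, volForm]
  have hneg : (g.frame x).orientation ≠ -(g.frame x).orientation :=
    (Module.Ray.ne_neg_self _)
  by_cases hp : 0 < S x (g.frame x)
  · have h1 : (g.frame x).orientation = (hS.orientation (g := g) (fun x => by rwa [hc])).orient x :=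
      (if_pos hp).symm
    rw [if_pos h1, ← hsq, Real.sqrt_sq hp.le]
  · have h1 : ¬ (g.frame x).orientation =
        (hS.orientation (g := g) (fun x => by rwa [hc])).orient x := by
      have : (hS.orientation (g := g) (fun x => by rwa [hc])).orient x = -(g.frame x).orientation :=
        if_neg hp
      rwa [this]
    rw [if_neg h1, ← hsq, Real.sqrt_sq_eq_abs, abs_of_nonpos (not_lt.1 hp)]
    simp

end Orientation

/-! ### Metric connections with twistor-free torsion. -/

section Torsion

variable {M : Type*} [TopologicalSpace M] [ChartedSpace E3 M] [IsManifold (𝓡 3) ∞ M]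
  {g : LorentzMetric M} {S : Form3 M} {x : M} {D cov : AffConn M} {p : VField M}

/-- A metric connection is determined by its torsion. -/
lemma form_sub_leviCivita (hD : IsLeviCivita g D) (hm : IsMetricConn g cov)
    (ht : HasTwistorFreeTorsion g cov p S) {Y : VField M} (hY : DiffFieldAt Y x)
    (v w : TangentSpace (𝓡 3) x) :
    g.form x (cov Y x v) w = g.form x (D Y x v) w + (g.form x v (Y x) * g.form x (p x) w -
      g.form x (Y x) (p x) * g.form x v w + 1 / 2 * S x ![v, Y x, w]) := by
  obtain ⟨V, hV, rfl⟩ : ∃ V : VField M, DiffFieldAt V x ∧ V x = v :=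
    ⟨_, diffFieldAt_extend v, by simp⟩
  obtain ⟨W, hW, rfl⟩ : ∃ V : VField M, DiffFieldAt V x ∧ V x = w :=
    ⟨_, diffFieldAt_extend w, by simp⟩
  -- Both connections are metric, so their difference is skew in the differentiated argument and the
  -- test vector; `tor` gives its skew part in the other pair. As in the Koszul formula, the cyclic
  -- combination below then determines it.
  have anti {A B C : VField M} (hA : DiffFieldAt A x) (hB : DiffFieldAt B x) :
      g.form x (cov A x (C x)) (B x) - g.form x (D A x (C x)) (B x) =
      -(g.form x (cov B x (C x)) (A x) - g.form x (D B x (C x)) (A x)) := by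
    have h1 := hm x A B hA hB (C x)
    have h2 := hD.metric x A B hA hB (C x)
    rw [h1, g.symm x (A x), g.symm x (A x)] at h2
    linarith
  have tor {A B C : VField M} (hA : DiffFieldAt A x) (hB : DiffFieldAt B x) :
      (g.form x (cov B x (A x)) (C x) - g.form x (D B x (A x)) (C x)) -
        (g.form x (cov A x (B x)) (C x) - g.form x (D A x (B x)) (C x)) =
      g.form x (A x) (p x) * g.form x (B x) (C x) - g.form x (B x) (p x) * g.form x (A x) (C x) +
        S x ![A x, B x, C x] := by
    have h1 := ht x (A x) (B x) (C x)
    have h2 := hD.torsion_free x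
    have h3 : g.form x (D.torsion x (A x) (B x)) (C x) = 0 := by
      rw [h2]
      simp
    rw [CovariantDerivative.torsion_apply _ hA hB] at h1 h3
    simp only [map_sub, sub_apply] at h1 h3
    linarith
  have t1 := tor (C := W) hV hY
  have t2 := tor (C := V) hY hW
  have t3 := tor (C := Y) hW hV
  have a1 := anti (C := Y) hV hW
  have a2 := anti (C := V) hW hY
  have a3 := anti (C := W) hV hY
  rw [form3_cycle] at t2
  rw [← form3_cycle] at t3
  rw [g.symm x (Y x) (V x), g.symm x (W x) (V x)] at t2
  rw [g.symm x (W x) (Y x)] at t3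
  rw [g.symm x (p x) (W x)]
  linarith

lemma mdifferentiableAt_torsion_form (ht : HasTwistorFreeTorsion g cov p S)
    (hp : DiffFieldAt p x) {Y Z W : VField M} (hY : DiffFieldAt Y x) (hZ : DiffFieldAt Z x)
    (hW : DiffFieldAt W x)
    (hS : MDifferentiableAt (𝓡 3) 𝓘(ℝ, ℝ) (fun y => S y ![Y y, Z y, W y]) x) :
    MDifferentiableAt (𝓡 3) 𝓘(ℝ, ℝ)
      (fun y => g.form y (cov.torsion y (Y y) (Z y)) (W y)) x := by
  have h : (fun y => g.form y (cov.torsion y (Y y) (Z y)) (W y)) = fun y =>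
      g.form y (Y y) (p y) * g.form y (Z y) (W y) - g.form y (Z y) (p y) * g.form y (Y y) (W y) +
        S y ![Y y, Z y, W y] := funext fun y => ht y _ _ _
  rw [h]
  exact (((g.mdifferentiableAt_apply hY hp).mul (g.mdifferentiableAt_apply hZ hW)).sub
    ((g.mdifferentiableAt_apply hZ hp).mul (g.mdifferentiableAt_apply hY hW))).add hS

lemma diffFieldAt_torsion [T2Space M] (ht : HasTwistorFreeTorsion g cov p S)
    (hp : DiffFieldAt p x) {Y Z : VField M} (hY : DiffFieldAt Y x) (hZ : DiffFieldAt Z x)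
    (hS : ∀ W, SmoothField W →
      MDifferentiableAt (𝓡 3) 𝓘(ℝ, ℝ) (fun y => S y ![Y y, Z y, W y]) x) :
    DiffFieldAt (fun y => cov.torsion y (Y y) (Z y)) x := by
  obtain ⟨E, hE, hE'⟩ := exists_smoothField_frame x
  refine g.diffFieldAt_of_form (IsManifold.chart_mem_maximalAtlas x) (mem_chart_source E3 x) _
    fun i => ?_
  refine (mdifferentiableAt_torsion_form ht hp hY hZ ((hE i).diffFieldAt x)
    (hS _ (hE i))).congr_of_eventuallyEq ?_
  filter_upwards [hE'] with y hy
  rw [hy]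

/-- The covariant derivative of the torsion. -/
lemma IsMetricConn.form_deriv_torsion [T2Space M] (hm : IsMetricConn g cov)
    (ht : HasTwistorFreeTorsion g cov p S) (hp : DiffFieldAt p x) {Y Z W : VField M}
    (hY : DiffFieldAt Y x) (hZ : DiffFieldAt Z x) (hW : SmoothField W)
    (hS : ∀ W, SmoothField W →
      MDifferentiableAt (𝓡 3) 𝓘(ℝ, ℝ) (fun y => S y ![Y y, Z y, W y]) x)
    (v : TangentSpace (𝓡 3) x) :
    g.form x (cov (fun y => cov.torsion y (Y y) (Z y)) x v) (W x) -
        g.form x (cov.torsion x (cov Y x v) (Z x)) (W x) -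
        g.form x (cov.torsion x (Y x) (cov Z x v)) (W x) =
      g.form x (Y x) (cov p x v) * g.form x (Z x) (W x) -
        g.form x (Z x) (cov p x v) * g.form x (Y x) (W x) +
      (mvfderiv (𝓡 3) (fun y => S y ![Y y, Z y, W y]) x v -
        derivTerms cov S ![Y, Z, W] x v) := by
  have hWx := hW.diffFieldAt x
  have h1 := hm x _ W (diffFieldAt_torsion ht hp hY hZ hS) hWx v
  have h : (fun y => g.form y (cov.torsion y (Y y) (Z y)) (W y)) = fun y =>
      (g.form y (Y y) (p y) * g.form y (Z y) (W y) - g.form y (Z y) (p y) * g.form y (Y y) (W y)) +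
        S y ![Y y, Z y, W y] := funext fun y => ht y _ _ _
  have m1 : MDifferentiableAt (𝓡 3) 𝓘(ℝ, ℝ)
      (fun y => g.form y (Y y) (p y) * g.form y (Z y) (W y)) x :=
    (g.mdifferentiableAt_apply hY hp).mul (g.mdifferentiableAt_apply hZ hWx)
  have m2 : MDifferentiableAt (𝓡 3) 𝓘(ℝ, ℝ)
      (fun y => g.form y (Z y) (p y) * g.form y (Y y) (W y)) x :=
    (g.mdifferentiableAt_apply hZ hp).mul (g.mdifferentiableAt_apply hY hWx)
  have m3 : MDifferentiableAt (𝓡 3) 𝓘(ℝ, ℝ) (fun y => g.form y (Y y) (p y) * g.form y (Z y) (W y) -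
      g.form y (Z y) (p y) * g.form y (Y y) (W y)) x := m1.sub m2
  rw [h, mvfderiv_fun_add m3 (hS W hW), mvfderiv_fun_sub m1 m2,
    mvfderiv_fun_mul (g.mdifferentiableAt_apply hY hp) (g.mdifferentiableAt_apply hZ hWx),
    mvfderiv_fun_mul (g.mdifferentiableAt_apply hZ hp) (g.mdifferentiableAt_apply hY hWx)] at h1
  simp only [add_apply, sub_apply, smul_apply, smul_eq_mul, hm x Y p hY hp, hm x Z p hZ hp,
    hm x Y W hY hWx, hm x Z W hZ hWx] at h1
  have e : derivTerms cov S ![Y, Z, W] x v = S x ![cov Y x v, Z x, W x] +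
      S x ![Y x, cov Z x v, W x] + S x ![Y x, Z x, cov W x v] := rfl
  -- The terms with ∇_v Y and ∇_v Z are absorbed by T(∇_v Y,Z), T(Y,∇_v Z) and the S-terms, those
  -- with ∇_v W by g(T(Y,Z),∇_v W); only ∇_v p and ∇_v S remain.
  rw [ht, ht, e]
  rw [ht] at h1
  linarith

end Torsion

/-! ### The metric connection with prescribed twistor-free torsion. -/

section Contorsion

variable {M : Type*} [TopologicalSpace M] [ChartedSpace E3 M] [IsManifold (𝓡 3) ∞ M]
  (g : LorentzMetric M) (p : VField M) (S : Form3 M)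

lemma form3_linear_right {x : M} (X Y : TangentSpace (𝓡 3) x) :
    IsLinearMap ℝ (fun Z => S x ![X, Y, Z]) := by
  constructor <;> intros <;> simp only [form3_eq_curry, map_add, map_smul,
    AlternatingMap.add_apply, AlternatingMap.smul_apply]

lemma form3_linear_mid {x : M} (X Z : TangentSpace (𝓡 3) x) :
    IsLinearMap ℝ (fun Y => S x ![X, Y, Z]) := by
  simpa only [form3_cycle S Z X] using form3_linear_right S Z X

lemma form3_linear_left {x : M} (Y Z : TangentSpace (𝓡 3) x) :
    IsLinearMap ℝ (fun X => S x ![X, Y, Z]) := by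
  simpa only [form3_cycle S _ Y Z] using form3_linear_right S Y Z

lemma form3_swap_right {x : M} (X Y Z : TangentSpace (𝓡 3) x) :
    S x ![X, Z, Y] = -S x ![X, Y, Z] := by
  rw [form3_cycle S Y X Z, form3_swap S x Z X Y, form3_cycle S Z X Y]

/-- The vector `g(v,Y)p - g(Y,p)v + ½ S(v,Y)`. -/
lemma exists_contorsion (x : M) : ∃ A : TangentSpace (𝓡 3) x →L[ℝ] TangentSpace (𝓡 3) x →L[ℝ]
    TangentSpace (𝓡 3) x, ∀ Y v w, g.form x (A Y v) w = g.form x v Y * g.form x (p x) w -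
      g.form x Y (p x) * g.form x v w + 1 / 2 * S x ![v, Y, w] := by
  have h (Y v : TangentSpace (𝓡 3) x) : ∃ u, ∀ w, g.form x u w = g.form x v Y * g.form x (p x) w -
      g.form x Y (p x) * g.form x v w + 1 / 2 * S x ![v, Y, w] :=
    g.exists_form_eq
      { toFun := fun w => g.form x v Y * g.form x (p x) w -
          g.form x Y (p x) * g.form x v w + 1 / 2 * S x ![v, Y, w]
        map_add' := fun w w' => by
          rw [(form3_linear_right S v Y).map_add, map_add, map_add]
          ring
        map_smul' := fun c w => by
          rw [(form3_linear_right S v Y).map_smul, map_smul, map_smul]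
          simp only [smul_eq_mul, RingHom.id_apply]
          ring }
  choose A hA using h
  refine ⟨LinearMap.toContinuousBilinearMap (LinearMap.mk₂ ℝ A ?_ ?_ ?_ ?_), fun Y v w => hA Y v w⟩
  · intro Y Y' v
    refine g.ext_of_forall fun w => ?_
    simp only [map_add, add_apply, hA]
    rw [(form3_linear_mid S v w).map_add]
    ring
  · intro c Y v
    refine g.ext_of_forall fun w => ?_
    simp only [map_smul, smul_apply, hA, smul_eq_mul]
    rw [(form3_linear_mid S v w).map_smul, smul_eq_mul]
    ring
  · intro Y v v'
    refine g.ext_of_forall fun w => ?_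
    simp only [map_add, add_apply, hA]
    rw [(form3_linear_left S Y w).map_add]
    ring
  · intro c Y v
    refine g.ext_of_forall fun w => ?_
    simp only [map_smul, smul_apply, hA, smul_eq_mul]
    rw [(form3_linear_left S Y w).map_smul, smul_eq_mul]
    ring

/-- The contorsion of a metric connection with twistor-free torsion. -/
def LorentzMetric.contorsion (x : M) : TangentSpace (𝓡 3) x →L[ℝ] TangentSpace (𝓡 3) x →L[ℝ]
    TangentSpace (𝓡 3) x := (exists_contorsion g p S x).choose

lemma LorentzMetric.form_contorsion {x : M} (Y v w : TangentSpace (𝓡 3) x) :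
    g.form x (g.contorsion p S x Y v) w = g.form x v Y * g.form x (p x) w -
      g.form x Y (p x) * g.form x v w + 1 / 2 * S x ![v, Y, w] :=
  (exists_contorsion g p S x).choose_spec Y v w

variable {p S}

/-- `X` is only smooth at `x`, whereas `SmoothForm3` wants global fields; near `x` it is expanded in
a global frame. -/
lemma contMDiffAt_form3_left [T2Space M] (hS : SmoothForm3 S) {x : M} {X Y Z : VField M}
    (hX : SmoothFieldAt X x) (hY : SmoothField Y) (hZ : SmoothField Z) :
    ContMDiffAt (𝓡 3) 𝓘(ℝ, ℝ) ∞ (fun y => S y ![X y, Y y, Z y]) x := by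
  obtain ⟨E, hE, hE'⟩ := exists_smoothField_frame x
  have hφ : chartAt E3 x ∈ IsManifold.maximalAtlas (𝓡 3) ∞ M := IsManifold.chart_mem_maximalAtlas x
  have h : ContMDiffAt (𝓡 3) 𝓘(ℝ, ℝ) ∞ (fun y => ∑ i,
      coordDiff (chartAt E3 x) i y (X y) * S y ![E i y, Y y, Z y]) x :=
    ContMDiffAt.sum fun i _ => (contMDiffAt_coordDiff hφ (mem_chart_source E3 x) hX i).mul
      (hS _ _ _ (hE i) hY hZ).contMDiffAt
  refine h.congr_of_eventuallyEq ?_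
  filter_upwards [hE', (chartAt E3 x).open_source.mem_nhds (mem_chart_source E3 x)] with y h1 h2
  conv_lhs => rw [← sum_coordDiff_smul hφ h2 (X y)]
  have := map_sum (form3_linear_left S (Y y) (Z y)).mk'
    (fun i => coordDiff (chartAt E3 x) i y (X y) • chartField (chartAt E3 x) i y) Finset.univ
  refine this.trans (Finset.sum_congr rfl fun i _ => ?_)
  rw [map_smul, h1]
  rfl

/-- The metric connection with a given twistor-free torsion. -/
def LorentzMetric.torsionConn (D : AffConn M) (p : VField M) (S : Form3 M) : AffConn M where
  toFun σ x := D σ x + g.contorsion p S x (σ x)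
  isCovariantDerivativeOnUniv := D.isCovariantDerivativeOnUniv.add_one_form (g.contorsion p S)

variable {D : AffConn M}

lemma LorentzMetric.form_torsionConn (σ : VField M) {x : M} (v w : TangentSpace (𝓡 3) x) :
    g.form x (g.torsionConn D p S σ x v) w = g.form x (D σ x v) w +
      (g.form x v (σ x) * g.form x (p x) w - g.form x (σ x) (p x) * g.form x v w +
        1 / 2 * S x ![v, σ x, w]) := by
  rw [← g.form_contorsion]
  change g.form x (D σ x v + g.contorsion p S x (σ x) v) w = _
  rw [map_add, add_apply]

lemma LorentzMetric.torsionConn_smooth [T2Space M] (hD : IsLeviCivita g D) (hp : SmoothField p)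
    (hS : SmoothForm3 S) : (g.torsionConn D p S).ContMDiffCovariantDerivative ∞ := by
  refine ⟨⟨fun {σ} hσ x hx => ?_⟩⟩
  have hσ' : SmoothField σ := contMDiffOn_univ.1 (by simpa using hσ)
  have h1 := hD.smooth.contMDiff.contMDiff hσ x hx
  refine h1.add_section (ContMDiffAt.contMDiffWithinAt ?_)
  refine contMDiffAt_hom_of_forall (A := fun y => g.contorsion p S y (σ y)) fun X hX => ?_
  obtain ⟨E, hE, hE'⟩ := exists_smoothField_frame x
  refine g.smoothFieldAt_of_form (IsManifold.chart_mem_maximalAtlas x) (mem_chart_source E3 x) _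
    fun i => ?_
  have hs := hσ'.smoothFieldAt x
  have hpx := hp.smoothFieldAt x
  have hEx := (hE i).smoothFieldAt x
  have h2 : ContMDiffAt (𝓡 3) 𝓘(ℝ, ℝ) ∞ (fun y => g.form y (X y) (σ y) * g.form y (p y) (E i y) -
      g.form y (σ y) (p y) * g.form y (X y) (E i y) + 1 / 2 * S y ![X y, σ y, E i y]) x :=
    (((g.smoothAt_apply hX hs).mul (g.smoothAt_apply hpx hEx)).sub
      ((g.smoothAt_apply hs hpx).mul (g.smoothAt_apply hX hEx))).add
      (contMDiffAt_const.mul (contMDiffAt_form3_left hS hX hσ' (hE i)))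
  refine h2.congr_of_eventuallyEq ?_
  filter_upwards [hE'] with y hy
  rw [g.form_contorsion, hy]

/-- For each direction v the added term is a skew endomorphism: exchanging Y with the test vector
changes its sign. -/
lemma LorentzMetric.torsionConn_metric (hD : IsLeviCivita g D) :
    IsMetricConn g (g.torsionConn D p S) := by
  intro x Y Z hY hZ v
  rw [hD.metric x Y Z hY hZ v, g.form_torsionConn, g.symm x (Y x) (g.torsionConn D p S Z x v),
    g.form_torsionConn, g.symm x (D Z x v), form3_swap_right S v (Y x) (Z x), g.symm x (p x) (Y x),
    g.symm x (p x) (Z x)]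
  ring

/-- Skew-symmetrizing the added term in direction and argument removes g(v,Y)p and doubles ½S. -/
lemma LorentzMetric.torsionConn_torsion (hD : IsLeviCivita g D) :
    HasTwistorFreeTorsion g (g.torsionConn D p S) p S := by
  intro x v w u
  obtain ⟨V, hV, rfl⟩ : ∃ V : VField M, DiffFieldAt V x ∧ V x = v :=
    ⟨_, diffFieldAt_extend v, by simp⟩
  obtain ⟨W, hW, rfl⟩ : ∃ V : VField M, DiffFieldAt V x ∧ V x = w :=
    ⟨_, diffFieldAt_extend w, by simp⟩
  have h3 : g.form x (D.torsion x (V x) (W x)) u = 0 := by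
    rw [hD.torsion_free x]
    simp
  have hs : S x ![W x, V x, u] = -S x ![V x, W x, u] := by
    rw [← form3_cycle, form3_swap, form3_cycle]
  rw [CovariantDerivative.torsion_apply _ hV hW] at h3 ⊢
  simp only [map_sub, sub_apply, g.form_torsionConn, hs] at h3 ⊢
  rw [g.symm x (W x) (V x)]
  linarith

end Contorsion

/-! ### Parallel torsion and the Kundt equation. -/

section ParallelTorsion

variable {M : Type*} [TopologicalSpace M] [ChartedSpace E3 M] [IsManifold (𝓡 3) ∞ M]
  {g : LorentzMetric M} {S : Form3 M} {D cov : AffConn M} {p : VField M}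

/-- For orthogonal frame vectors Y ≠ Z the second term vanishes and g(Z,Z) ≠ 0 can be cancelled. It
is applied to ξ = ∇_v p. -/
lemma LorentzMetric.eq_zero_of_form_mul {x : M} {ξ : TangentSpace (𝓡 3) x}
    (h : ∀ Y Z, g.form x Y ξ * g.form x Z Z - g.form x Z ξ * g.form x Y Z = 0) : ξ = 0 := by
  have h1 (i j : Fin 3) (hij : i ≠ j) : g.form x ξ (g.frame x i) = 0 := by
    have := h (g.frame x i) (g.frame x j)
    rw [g.frame_apply, g.frame_apply, if_pos rfl, if_neg hij, mul_zero, sub_zero, g.symm] at this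
    refine (mul_eq_zero.1 this).resolve_right ?_
    unfold lsign
    split_ifs <;> norm_num
  refine g.eq_zero_of_forall fun w => ?_
  rw [← (g.frame x).sum_repr w, map_sum]
  refine Finset.sum_eq_zero fun i _ => ?_
  rw [map_smul, h1 i (i + 1) (by fin_cases i <;> decide), smul_zero]

/-- The components of a parallel twistor-free torsion are parallel. -/
lemma HasParallelTorsion.parallel [T2Space M] (hpar : HasParallelTorsion cov)
    (hm : IsMetricConn g cov) (ht : HasTwistorFreeTorsion g cov p S) (hp : SmoothField p)
    (hS : SmoothForm3 S) (x : M) (v : TangentSpace (𝓡 3) x) :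
    cov p x v = 0 ∧ ∀ E : Fin 3 → VField M, (∀ i, SmoothField (E i)) →
      mvfderiv (𝓡 3) (fun y => S y (fun i => E i y)) x v = derivTerms cov S E x v := by
  have key {Y Z W : VField M} (hY : SmoothField Y) (hZ : SmoothField Z) (hW : SmoothField W) :
      0 = g.form x (Y x) (cov p x v) * g.form x (Z x) (W x) -
        g.form x (Z x) (cov p x v) * g.form x (Y x) (W x) +
      (mvfderiv (𝓡 3) (fun y => S y ![Y y, Z y, W y]) x v - derivTerms cov S ![Y, Z, W] x v) := by
    rw [← hm.form_deriv_torsion ht (hp.diffFieldAt x) (hY.diffFieldAt x) (hZ.diffFieldAt x) hW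
      (fun W hW => ((hS Y Z W hY hZ hW).contMDiffAt).mdifferentiableAt (n := ∞) (by simp)) v,
      hpar x Y Z (hY.diffFieldAt x) (hZ.diffFieldAt x) v, map_add, add_apply]
    ring
  have hp0 : cov p x v = 0 := by
    refine g.eq_zero_of_form_mul fun Y Z => ?_
    obtain ⟨Y, hY, rfl⟩ := exists_smoothField_apply_eq Y
    -- Testing with W = Z removes the derivative of S, which is skew in its last two arguments, and
    -- isolates ∇_v p.
    obtain ⟨Z, hZ, rfl⟩ := exists_smoothField_apply_eq Z
    have h1 := key hY hZ hZ
    have h2 : derivTerms cov S ![Y, Z, Z] x v = S x ![cov Y x v, Z x, Z x] +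
        S x ![Y x, cov Z x v, Z x] + S x ![Y x, Z x, cov Z x v] := rfl
    have h3 : (fun y => S y ![Y y, Z y, Z y]) = fun _ => 0 :=
      funext fun y => form3_right_eq S y _ _
    rw [h2, h3, form3_right_eq, form3_swap_right S (Y x) (Z x) (cov Z x v), mvfderiv_const,
      zero_apply] at h1
    linarith
  refine ⟨hp0, fun E hE => ?_⟩
  have h1 := key (hE 0) (hE 1) (hE 2)
  have h2 : derivTerms cov S ![E 0, E 1, E 2] x v = derivTerms cov S E x v := rfl
  simp only [eval_eq_vec3]
  rw [hp0, map_zero, map_zero, h2] at h1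
  linarith

/-- Parallelism of S gives constant norm by connectedness, and nondegeneracy makes the constant
nonzero. The Kundt equation is ∇p = 0 rewritten through ∇^g, where the middle term drops because
g(p,p) = 0. -/
theorem kundtEquation_of_parallel [T2Space M] [ConnectedSpace M] (hD : IsLeviCivita g D)
    (hp : SmoothField p) (hS : SmoothForm3 S) (hadm : AdmitsParallelTwistorFree g p S)
    (hiso : IsIsotropic g p) (hnd : Nondegenerate3 g S) :
    ∃ (o : SmoothOrientation M) (a : ℝ), a ≠ 0 ∧ S = a • volForm g o ∧
      IsIsotropic g p ∧ KundtEquation g D p S := by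
  obtain ⟨cov, -, hm, ht, hpar⟩ := hadm
  have h := hpar.parallel hm ht hp hS
  obtain ⟨x₀, hx₀⟩ := not_forall.1 hnd
  have hc := hm.sqComponent_eq hS fun E hE x v => (h x v).2 E hE
  have hc0 : g.sqComponent S x₀ ≠ 0 := fun h0 => hx₀ (by rw [normSq3_eq, h0, mul_zero])
  obtain ⟨o, a, ha, hSa⟩ := exists_eq_smul_volForm hS hc0 fun x => hc x x₀
  refine ⟨o, a, ha, hSa, hiso, fun x X Z => ?_⟩
  have h1 := form_sub_leviCivita hD hm ht (hp.diffFieldAt x) X Z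
  rw [(h x X).1, map_zero, zero_apply, (hiso x).2] at h1
  linarith

/-- For null p the Kundt equation makes p parallel for `torsionConn`, and a multiple of the volume
form is parallel for every metric connection; the torsion is built from p, S and g alone. -/
theorem admits_of_kundtEquation [T2Space M] [Nonempty M] (hD : IsLeviCivita g D)
    (hp : SmoothField p) (hS : SmoothForm3 S) {o : SmoothOrientation M} {a : ℝ} (ha : a ≠ 0)
    (hSa : S = a • volForm g o) (hiso : IsIsotropic g p) (hK : KundtEquation g D p S) :
    AdmitsParallelTwistorFree g p S ∧ Nondegenerate3 g S := by
  have hc (x : M) : g.sqComponent S x = a ^ 2 := by rw [hSa, sqComponent_smul_volForm]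
  have ha2 : a ^ 2 ≠ 0 := pow_ne_zero 2 ha
  set cov := g.torsionConn D p S
  have hm : IsMetricConn g cov := g.torsionConn_metric hD
  have ht : HasTwistorFreeTorsion g cov p S := g.torsionConn_torsion hD
  refine ⟨⟨cov, g.torsionConn_smooth hD hp hS, hm, ht, fun x Y Z hY hZ v => ?_⟩, fun h => ?_⟩
  · have hp0 : cov p x v = 0 := g.eq_zero_of_forall fun w => by
      rw [g.form_torsionConn, hK, (hiso x).2]
      ring
    have hpar {W : VField M} (hW : DiffFieldAt W x) := hm.mvfderiv_form3 hS hc ha2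
      (X := ![Y, Z, W]) (x := x) (fun i => by fin_cases i <;> assumption)
    simp only [eval_vec3] at hpar
    refine g.ext_of_forall fun w => ?_
    obtain ⟨W, hW, rfl⟩ := exists_smoothField_apply_eq w
    have h1 := hm.form_deriv_torsion ht (hp.diffFieldAt x) hY hZ hW
      (fun W hW => (hpar (hW.diffFieldAt x)).1) v
    rw [(hpar (hW.diffFieldAt x)).2, hp0, map_zero, map_zero] at h1
    rw [map_add, add_apply]
    linarith
  · obtain ⟨x₀⟩ := ‹Nonempty M›
    have := h x₀
    rw [normSq3_eq, hc] at this
    exact ha2 (by linarith)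

end ParallelTorsion

end

/-! ### The main theorem. -/

theorem mainTheorem6 {M : Type*} [TopologicalSpace M] [ChartedSpace E3 M]
    [IsManifold (𝓡 3) ∞ M] [T2Space M] [SecondCountableTopology M] [ConnectedSpace M]
    (g : LorentzMetric M) :
    (∃ D : AffConn M, IsLeviCivita g D) ∧
    (∀ D : AffConn M, IsLeviCivita g D →
      (∀ (p : VField M) (S : Form3 M), SmoothField p → SmoothForm3 S →
        ((AdmitsParallelTwistorFree g p S ∧ IsIsotropic g p ∧ Nondegenerate3 g S) ↔
          ∃ (o : SmoothOrientation M) (a : ℝ), a ≠ 0 ∧ S = a • volForm g o ∧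
            IsIsotropic g p ∧ KundtEquation g D p S)) ∧
      (∀ (p : VField M) (o : SmoothOrientation M) (a : ℝ), SmoothField p → a ≠ 0 →
        (IsIsotropic g p ∧ KundtEquation g D p (a • volForm g o) → IsKundtField g D p) ∧
        ((IsIsotropic g p ∧ KundtEquation g D p (a • volForm g o)) ↔
          ∀ x₀ : M, ∃ φ ∈ IsManifold.maximalAtlas (𝓡 3) ∞ M, x₀ ∈ φ.source ∧
            ∃ C : ℝ × ℝ → ℝ, ContDiffOn ℝ ∞ C ((fun y => (φ y 1, φ y 2)) '' φ.source) ∧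
              IsKundtChart g o p a φ C))) ∧
    (∀ (a : ℝ) (C : ℝ × ℝ → ℝ), a ≠ 0 → ContDiff ℝ ∞ C →
      ∃ (g₀ : LorentzMetric E3) (o₀ : SmoothOrientation E3) (p₀ : VField E3) (D₀ : AffConn E3),
        SmoothField p₀ ∧ IsLeviCivita g₀ D₀ ∧
        IsKundtChart g₀ o₀ p₀ a (OpenPartialHomeomorph.refl E3) C ∧
        IsIsotropic g₀ p₀ ∧ KundtEquation g₀ D₀ p₀ (a • volForm g₀ o₀)) := by
  refine ⟨⟨g.leviCivita, g.isLeviCivita_leviCivita⟩, fun D hD => ⟨fun p S hp hS => ⟨?_, ?_⟩,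
    fun p o a hp ha => ⟨fun h => isKundtField_of_kundtEquation hp h.1 h.2, fun h x₀ =>
      exists_kundtChart g ha hD hp h.1 h.2 x₀, fun h => ⟨fun x => ?_, fun x X Z => ?_⟩⟩⟩,
    fun a C _ hC => exists_kundt_example a C hC⟩
  · exact fun ⟨hadm, hiso, hnd⟩ => kundtEquation_of_parallel hD hp hS hadm hiso hnd
  · rintro ⟨o, a, ha, hSa, hiso, hK⟩
    obtain ⟨h1, h2⟩ := admits_of_kundtEquation hD hp hS ha hSa hiso hK
    exact ⟨h1, hiso, h2⟩
  · obtain ⟨φ, hφ, hx, C, hC, hk⟩ := h x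
    exact hk.isotropic hφ hx
  · obtain ⟨φ, hφ, hx, C, hC, hk⟩ := h x
    exact hk.kundtEquation hφ hx hD (hp.smoothFieldAt x) hC X Z
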